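/- Let $X_1,X_2,\dots$ be i.i.d. with unknown probability density $f$ on $\mathbb{R}$, let $\varepsilon_1,\varepsilon_2,\dots$ be i.i.d. with known density $g$ and independent of the $X_i$, and let $Y_i=X_i+\varepsilon_i$, $i=1,\dots,n$, be observed. Write $\Phi(u)=\int e^{ixu}f(x)\,dx$ and $\Phi^g(u)=\int e^{ixu}g(x)\,dx$. Let $\sigma>1$, and suppose that $\Phi^g(u)\neq 0$ for all $u\in\mathbb{R}$ and $|\Phi^g(u)|\sim|u|^{-\sigma}$ as $|u|\to\infty$. Let $L>0$ and $0<\beta\le\sigma+1/4$. Let $\overline W(\beta,L)$ be the set of probability densities $f\in\mathbb{L}_2$ with $\int|\Phi(u)|^2|u|^{2\beta}\,du\le 2\pi L$, and let $W(\beta,L)$ be the set of those $f\in \overline W(\beta,L)$ that are of class $\mathcal{C}^\beta$, that is, $\lfloor\beta\rfloor$ times continuously differentiable with $f^{(\lfloor\beta\rfloor)}$ Hölder continuous of exponent $\beta-\lfloor\beta\rfloor$ on bounded intervals. For $h>0$ let $K_n(x)=\frac1{2\pi}\int_{-1}^1 e^{-iux}\,\Phi^g(u/h)^{-1}\,du$,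 $K_{n,h}(x)=h^{-1}K_n(x/h)$, and $$d_n=\frac1{n(n-1)}\sum_{k\ne j}\int K_{n,h}(x-Y_k)K_{n,h}(x-Y_j)\,dx .$$ Put $h=h_*=n^{-2/(4\beta+4\sigma+1)}$ and $\varphi_n=n^{-4\beta/(4\beta+4\sigma+1)}$. (i) $d_n$ is an estimator (a measurable function of $Y_1,\dots,Y_n$) that attains the rate $\varphi_n$: there is a constant $C>0$ such that $$\limsup_{n\to\infty}\ \sup_{f\in \overline W(\beta,L)}\varphi_n^{-1}E_f\Big[\Big|d_n-\int f^2\Big|\Big]\le C .$$ (ii) Suppose in addition that (Assumption (P)) $\Phi^g$ is three times continuously differentiable and there are $A_1,A_2>1$ and $u_0,u_1,u_2>0$ with $|\Phi^g(u)|\ge u_0$ for $|u|\le A_1$ and $|(\Phi^g)^{(k)}(u)|\le u_k|u|^{-\sigma-k}$ for $k=1,2$ and $|u|\ge A_2$. Then the rate is minimax: there is a constant $c>0$ such that $$\liminf_{n\to\infty}\ \inf_{\hat d_n}\ \sup_{f\in W(\beta,L)}\varphi_n^{-1}E_f\Big[\Big|\hat d_n-\int f^2\Big|\Big]\ge c ,$$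 where the infimum is over all estimators, that is, all measurable real functions $\hat d_n$ of $Y_1,\dots,Y_n$. Since $W(\beta,L)\subseteq\overline W(\beta,L)$, both bounds hold over both classes. -/

import Mathlib

open MeasureTheory Filter Topology Asymptotics
open scoped NNReal ENNReal

namespace Deconv

/-- `f` is a probability density on the real line (with respect to Lebesgue measure). -/
def IsDensity (f : ℝ → ℝ) : Prop :=
  (∀ x, 0 ≤ f x) ∧ Integrable f ∧ ∫ x, f x = 1

/-- The characteristic function `Φ(u) = ∫ exp(i x u) f(x) dx` of a density `f`. -/
noncomputable def charFn (f : ℝ → ℝ) (u : ℝ) : ℂ :=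
  ∫ x : ℝ, Complex.exp (Complex.I * x * u) * (f x : ℂ)

/-- The probability measure with density `f`. -/
noncomputable def law (f : ℝ → ℝ) : Measure ℝ :=
  volume.withDensity fun x => ENNReal.ofReal (f x)

/-- The joint law of `n` independent observations `Y_i = X_i + ε_i`, where `X_i` has density `f`
and `ε_i` has density `g`, all these variables being independent. -/
noncomputable def obsLaw (f g : ℝ → ℝ) (n : ℕ) : Measure (Fin n → ℝ) :=
  Measure.pi fun _ => Measure.conv (law f) (law g)

/-- The Sobolev ball of probability densities in `L²` with
`∫ |Φ(u)|² |u|^(2β) du ≤ 2 π L`. -/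
def sobolevBall (β L : ℝ) : Set (ℝ → ℝ) :=
  {f | IsDensity f ∧ MemLp f 2 ∧
    ∫⁻ u : ℝ, ENNReal.ofReal (‖charFn f u‖ ^ 2 * |u| ^ (2 * β)) ≤
      ENNReal.ofReal (2 * Real.pi * L)}

/-- `f` is of class `C^β` for a real `β ≥ 0`: it is `⌊β⌋` times continuously differentiable and
its derivative of order `⌊β⌋` is Hölder continuous of exponent `β - ⌊β⌋` on bounded intervals. -/
def IsClassC (β : ℝ) (f : ℝ → ℝ) : Prop :=
  ContDiff ℝ (⌊β⌋₊ : ℕ∞) f ∧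
    ∀ R : ℝ, ∃ C : ℝ≥0,
      HolderOnWith C (β - ⌊β⌋₊).toNNReal (iteratedDeriv ⌊β⌋₊ f) (Set.Icc (-R) R)

/-- The densities of class `C^β` in the Sobolev ball. -/
def sobolevClass (β L : ℝ) : Set (ℝ → ℝ) :=
  {f | f ∈ sobolevBall β L ∧ IsClassC β f}

/-- `g` is a noise density, with nowhere vanishing characteristic function, which is polynomially
smooth of order `σ > 1`: `|Φ^g(u)| ∼ |u|^(-σ)` as `|u| → ∞`. -/
def IsPolynomialNoise (σ : ℝ) (g : ℝ → ℝ) : Prop :=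
  IsDensity g ∧ (∀ u, charFn g u ≠ 0) ∧ 1 < σ ∧
    (fun u : ℝ => ‖charFn g u‖) ~[cocompact ℝ] fun u : ℝ => |u| ^ (-σ)

/-- Assumption (P) on a polynomial noise of order `σ`. -/
def AssumptionP (σ : ℝ) (g : ℝ → ℝ) : Prop :=
  ContDiff ℝ 3 (charFn g) ∧
    ∃ A₁ A₂ u₀ u₁ u₂ : ℝ, 1 < A₁ ∧ 1 < A₂ ∧ 0 < u₀ ∧ 0 < u₁ ∧ 0 < u₂ ∧
      (∀ u : ℝ, |u| ≤ A₁ → u₀ ≤ ‖charFn g u‖) ∧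
      (∀ u : ℝ, A₂ ≤ |u| → ‖iteratedDeriv 1 (charFn g) u‖ ≤ u₁ / |u| ^ (σ + 1)) ∧
      (∀ u : ℝ, A₂ ≤ |u| → ‖iteratedDeriv 2 (charFn g) u‖ ≤ u₂ / |u| ^ (σ + 2))

/-- The Fourier transform `Φ^{K_n}(u) = Φ^K(u) / Φ^g(u/h)` of the deconvolution kernel, where `K`
is the sinc kernel, so that `Φ^K` is the indicator function of `[-1, 1]`. -/
noncomputable def kernelFT (g : ℝ → ℝ) (h u : ℝ) : ℂ :=
  (charFn g (u / h))⁻¹ * (Set.Icc (-1 : ℝ) 1).indicator (fun _ => (1 : ℂ)) u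

/-- The inverse Fourier transform of `kernelFT`, as a complex number. -/
noncomputable def kernelC (g : ℝ → ℝ) (h x : ℝ) : ℂ :=
  (1 / (2 * Real.pi) : ℂ) * ∫ u : ℝ, Complex.exp (-(Complex.I * u * x)) * kernelFT g h u

/-- The deconvolution kernel `K_n`; it is real valued, see `kernel_eq`. -/
noncomputable def kernel (g : ℝ → ℝ) (h x : ℝ) : ℝ := (kernelC g h x).re

theorem charFn_neg (f : ℝ → ℝ) (u : ℝ) :
    charFn f (-u) = (starRingEnd ℂ) (charFn f u) := by
  unfold charFn
  rw [← integral_conj]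
  refine integral_congr_ae (Eventually.of_forall fun x => ?_)
  simp [← Complex.exp_conj]

theorem kernel_eq (g : ℝ → ℝ) (h x : ℝ) : ((kernel g h x : ℝ) : ℂ) = kernelC g h x := by
  unfold kernel
  rw [← Complex.conj_eq_iff_re]
  unfold kernelC
  rw [map_mul, ← integral_conj]
  congr 1
  · simp [map_ofNat]
  · rw [← integral_neg_eq_self]
    refine integral_congr_ae (Eventually.of_forall fun u => ?_)
    have hind : (Set.Icc (-1 : ℝ) 1).indicator (fun _ => (1 : ℂ)) (-u)
        = (Set.Icc (-1 : ℝ) 1).indicator (fun _ => (1 : ℂ)) u := by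
      simp only [Set.indicator, Set.mem_Icc]
      congr 1
      apply propext
      constructor <;> rintro ⟨a, b⟩ <;> constructor <;> linarith
    have hc : (starRingEnd ℂ) ((Set.Icc (-1 : ℝ) 1).indicator (fun _ => (1 : ℂ)) u)
        = (Set.Icc (-1 : ℝ) 1).indicator (fun _ => (1 : ℂ)) u := by
      by_cases hu : u ∈ Set.Icc (-1 : ℝ) 1 <;> simp [hu]
    simp only [kernelFT, map_mul, map_inv₀, neg_div, charFn_neg, Complex.conj_conj,
      ← Complex.exp_conj, hind, hc]
    simp

/-- The rescaled kernel `K_{n,h}(x) = K_n(x/h) / h`. -/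
noncomputable def scaledKernel (g : ℝ → ℝ) (h x : ℝ) : ℝ := 1 / h * kernel g h (x / h)

/-- The estimator
`d_n = (n (n-1))⁻¹ ∑_{k ≠ j} ∫ K_{n,h}(x - Y_k) K_{n,h}(x - Y_j) dx` of `∫ f²`. -/
noncomputable def estimator (g : ℝ → ℝ) (h : ℝ) (n : ℕ) (y : Fin n → ℝ) : ℝ :=
  1 / ((n : ℝ) * ((n : ℝ) - 1)) * ∑ q ∈ (Finset.univ : Finset (Fin n)).offDiag,
    ∫ x : ℝ, scaledKernel g h (x - y q.1) * scaledKernel g h (x - y q.2)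

/-- The risk `E_f |δ(Y_1, …, Y_n) - ∫ f²|` of an estimator `δ`. -/
noncomputable def risk (f g : ℝ → ℝ) (n : ℕ) (δ : (Fin n → ℝ) → ℝ) : ℝ≥0∞ :=
  ∫⁻ y, ENNReal.ofReal |δ y - ∫ x, f x ^ 2| ∂(obsLaw f g n)

/-- The sequence of estimators `δ` attains the rate `φ` over the class `W`:
`limsup_n sup_{f ∈ W} φ_n⁻¹ E_f |δ_n - ∫ f²| ≤ C` for some constant `C`. -/
def AttainsRate (W : Set (ℝ → ℝ)) (g : ℝ → ℝ) (δ : ∀ n : ℕ, (Fin n → ℝ) → ℝ) (φ : ℕ → ℝ) :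
    Prop :=
  (∀ n, Measurable (δ n)) ∧
    ∃ C : ℝ, 0 < C ∧
      limsup (fun n : ℕ => ⨆ f ∈ W, (ENNReal.ofReal (φ n))⁻¹ * risk f g n (δ n)) atTop
        ≤ ENNReal.ofReal C

/-- No estimator has a better rate than `φ` uniformly over the class `W`:
`liminf_n inf_δ sup_{f ∈ W} φ_n⁻¹ E_f |δ - ∫ f²| ≥ c` for some `c > 0`, the infimum being over all
measurable functions `δ` of the `n` observations. -/
def RateLowerBound (W : Set (ℝ → ℝ)) (g : ℝ → ℝ) (φ : ℕ → ℝ) : Prop :=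
  ∃ c : ℝ, 0 < c ∧
    ENNReal.ofReal c ≤
      liminf (fun n : ℕ => ⨅ (δ : (Fin n → ℝ) → ℝ) (_ : Measurable δ),
        ⨆ f ∈ W, (ENNReal.ofReal (φ n))⁻¹ * risk f g n δ) atTop

/-- The bandwidth `h_* = n^(-2/(4β+4σ+1))`. -/
noncomputable def bandwidth (β σ : ℝ) (n : ℕ) : ℝ := (n : ℝ) ^ (-2 / (4 * β + 4 * σ + 1))

/-- The rate `φ_n = n^(-4β/(4β+4σ+1))`. -/
noncomputable def rate (β σ : ℝ) (n : ℕ) : ℝ := (n : ℝ) ^ (-4 * β / (4 * β + 4 * σ + 1))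

end Deconv

namespace Deconv

open FourierTransform ComplexConjugate

/-! ### The Fourier transform on `L¹ ∩ L²` -/

/-! Upper bound. In the Fourier domain the kernel of the U-statistic `d_n` becomes the squared
modulus of `deconvFT`, supported on |u| ≤ 1/h, and there the noise cancels exactly
(`norm_deconvFT_mul_norm_charFn`). The mean of `d_n` is therefore (2π)⁻¹ ∫_{|u| ≤ 1/h} |Φ|², and the
Sobolev condition bounds the bias by L h^(2β) (`bias_le`). The Hoeffding decomposition
(`integral_sq_uStatistic_sub_le`) bounds the variance by a term n⁻¹ times the second moment of the
projection of the kernel and a term n⁻² times the second moment of the kernel itself. Because σ > 1,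
Φ^g is integrable, so the noise density, and with it the law of Y, is bounded by a constant that
does not depend on f; Plancherel then turns both moments into integrals of |Φ^g|⁻² |Φ|² and |Φ^g|⁻⁴
over |u| ≤ 1/h. The bandwidth solves n⁻¹ = h^((4β+4σ+1)/2), so the n⁻² term is of order h^(4β), the
square of the bias. The n⁻¹ term is of that order as well, and it is here that β ≤ σ + 1/4 is needed
(`rpow_weight_le`).

Lower bound. A fixed Cauchy density is tested against the uniform mixture of the densities obtained
by adding h^β κ ∑ θ_j wave(x/h - j), over signs θ and m = ⌊1/h⌋ positions. The wave is band-limited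
to an annulus 1 ≤ |η| ≤ 4. So the perturbation carries no mass, its Sobolev norm is of order κ, and
the cross term with the Cauchy characteristic function is exponentially small, whence ∫ f² grows by
at least a constant times h^(2β) whatever the signs are (`integral_sq_perturbed_ge`).

The two hypotheses remain indistinguishable if the second moment of the likelihood ratio of the
mixture is bounded (`le_risk_of_mixture`). That moment is at most exp(n² Λ² m / 2), where Λ bounds
the quadratic form of the noisy perturbations in L² weighted by the inverse of the noisy Cauchy
density (`sum_sum_pow_le_exp`). Translated waves overlap, but in the Fourier domain a combination of
them is the window times a trigonometric polynomial, so orthogonality of exponentials still bounds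
the form by a multiple of ∑ v_j². The Cauchy tails make the weight at most a multiple of 1 + x², and
x² costs one derivative in frequency, which Assumption (P) controls
(`integral_norm_sq_deriv_noisyFT_le`). This gives Λ of order h^(2β+2σ+1), and then n² Λ² m stays
bounded by the choice of h. -/

theorem integral_fourier_mul_eq {f g : ℝ → ℂ} (hf : Integrable f) (hg : Integrable g) :
    ∫ x, 𝓕 f x * g x = ∫ x, f x * 𝓕 g x := by
  have := VectorFourier.integral_fourierIntegral_smul_eq_flip (e := Real.fourierChar)
    (μ := volume) (ν := volume) (L := innerₗ ℝ) Real.continuous_fourierChar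
    continuous_inner hf hg
  simpa [smul_eq_mul, Real.fourier_eq, VectorFourier.fourierIntegral, real_inner_comm] using this

theorem continuous_fourier {f : ℝ → ℂ} (hf : Integrable f) : Continuous (𝓕 f) :=
  VectorFourier.fourierIntegral_continuous (L := innerₗ ℝ) Real.continuous_fourierChar
    continuous_inner hf

theorem norm_fourier_le (f : ℝ → ℂ) (x : ℝ) : ‖𝓕 f x‖ ≤ ∫ y, ‖f y‖ :=
  VectorFourier.norm_fourierIntegral_le_integral_norm (L := innerₗ ℝ) Real.fourierChar volume f x

/-- The L² transform is known only through its action as a tempered distribution. Tested against a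
smooth compactly supported function, both sides move the transform onto the test function, and they
agree there. -/
theorem fourier_toLp_ae_eq {f : ℝ → ℂ} (hf : Integrable f) (hf2 : MemLp f 2) :
    ((𝓕 (hf2.toLp f) : Lp ℂ 2 (volume : Measure ℝ)) : ℝ → ℂ) =ᵐ[volume] 𝓕 f := by
  refine ae_eq_of_integral_contDiff_smul_eq ?_ ?_ fun g hg hgc => ?_
  · exact (Lp.memLp _).locallyIntegrable (by norm_num)
  · exact (continuous_fourier hf).locallyIntegrable
  have hgc' : HasCompactSupport (fun x => (g x : ℂ)) :=
    hgc.comp_left (g := fun x : ℝ => (x : ℂ)) (by simp)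
  have hg' : ContDiff ℝ ((⊤ : ℕ∞) : WithTop ℕ∞) (fun x => (g x : ℂ)) :=
    Complex.ofRealCLM.contDiff.comp hg
  let G : SchwartzMap ℝ ℂ := hgc'.toSchwartzMap hg'
  have hG : ∀ x, G x = (g x : ℂ) := fun x => rfl
  have h1 := congrArg (fun T => T G) (Lp.fourier_toTemperedDistribution_eq (hf2.toLp f))
  simp only [TemperedDistribution.fourier_apply, Lp.toTemperedDistribution_apply] at h1
  have h2 : ∫ x, (𝓕 G) x • (hf2.toLp f : ℝ → ℂ) x = ∫ x, 𝓕 (G : ℝ → ℂ) x * f x := by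
    refine integral_congr_ae ?_
    filter_upwards [hf2.coeFn_toLp] with x hx
    rw [hx, smul_eq_mul, SchwartzMap.fourier_coe]
  rw [h2, integral_fourier_mul_eq G.integrable hf] at h1
  simpa [hG, smul_eq_mul] using h1.symm

theorem memLp_fourier {f : ℝ → ℂ} (hf : Integrable f) (hf2 : MemLp f 2) : MemLp (𝓕 f) 2 :=
  (memLp_congr_ae (fourier_toLp_ae_eq hf hf2)).1 (Lp.memLp _)

theorem integral_conj_fourier_mul_fourier {f g : ℝ → ℂ} (hf : Integrable f) (hf2 : MemLp f 2)
    (hg : Integrable g) (hg2 : MemLp g 2) :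
    ∫ x, conj (𝓕 f x) * 𝓕 g x = ∫ x, conj (f x) * g x := by
  have h := Lp.inner_fourier_eq (hf2.toLp f) (hg2.toLp g)
  rw [L2.inner_def, L2.inner_def] at h
  have e1 : ∫ x, conj (𝓕 f x) * 𝓕 g x =
      ∫ x, inner ℂ ((𝓕 (hf2.toLp f) : Lp ℂ 2 (volume : Measure ℝ)) x)
        ((𝓕 (hg2.toLp g) : Lp ℂ 2 (volume : Measure ℝ)) x) := by
    refine integral_congr_ae ?_
    filter_upwards [fourier_toLp_ae_eq hf hf2, fourier_toLp_ae_eq hg hg2] with x h1 h2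
    rw [h1, h2, RCLike.inner_apply']
  rw [e1, h]
  refine integral_congr_ae ?_
  filter_upwards [hf2.coeFn_toLp, hg2.coeFn_toLp] with x h1 h2
  rw [h1, h2, RCLike.inner_apply']

theorem integral_norm_sq_fourier {f : ℝ → ℂ} (hf : Integrable f) (hf2 : MemLp f 2) :
    ∫ x, ‖𝓕 f x‖ ^ 2 = ∫ x, ‖f x‖ ^ 2 := by
  have h := integral_conj_fourier_mul_fourier hf hf2 hf hf2
  simp only [Complex.conj_mul'] at h
  exact_mod_cast h

/-- Fixes the frequency scale used from here on, u = 2πξ. The sign is harmless wherever only the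
modulus matters. -/
theorem charFn_two_pi_mul (f : ℝ → ℝ) (ξ : ℝ) :
    charFn f (2 * Real.pi * ξ) = 𝓕 (fun x => (f x : ℂ)) (-ξ) := by
  rw [Real.fourier_real_eq_integral_exp_smul]
  unfold charFn
  refine integral_congr_ae (Eventually.of_forall fun x => ?_)
  simp only [smul_eq_mul]
  congr 2
  push_cast
  ring

theorem continuous_charFn {f : ℝ → ℝ} (hf : Integrable f) : Continuous (charFn f) := by
  have h : charFn f = fun u => 𝓕 (fun x => (f x : ℂ)) (-(u / (2 * Real.pi))) := by
    funext u
    rw [← charFn_two_pi_mul]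
    congr 1
    field_simp
  rw [h]
  exact (continuous_fourier hf.ofReal).comp (by fun_prop)

theorem norm_charFn_le_one {f : ℝ → ℝ} (hf : IsDensity f) (u : ℝ) : ‖charFn f u‖ ≤ 1 := by
  unfold charFn
  refine (norm_integral_le_integral_norm _).trans ?_
  rw [← hf.2.2]
  refine le_of_eq (integral_congr_ae (Eventually.of_forall fun x => ?_))
  have : Complex.I * x * u = ((x * u : ℝ) : ℂ) * Complex.I := by push_cast; ring
  simp only [norm_mul, this, Complex.norm_exp_ofReal_mul_I, one_mul, Complex.norm_real,
    Real.norm_eq_abs, abs_of_nonneg (hf.1 x)]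

theorem lintegral_comp_two_pi_mul (F : ℝ → ℝ≥0∞) :
    ∫⁻ u, F u = ENNReal.ofReal (2 * Real.pi) * ∫⁻ ξ, F (2 * Real.pi * ξ) := by
  have hpi : (0 : ℝ) < 2 * Real.pi := by positivity
  have h2 : ∫⁻ ξ, F (2 * Real.pi * ξ) = ENNReal.ofReal (2 * Real.pi)⁻¹ * ∫⁻ u, F u := by
    have e := lintegral_map_equiv (μ := (volume : Measure ℝ)) F
      (Homeomorph.mulLeft₀ (2 * Real.pi) hpi.ne').toMeasurableEquiv
    have hc : ⇑(Homeomorph.mulLeft₀ (2 * Real.pi) hpi.ne').toMeasurableEquiv =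
      fun x : ℝ => 2 * Real.pi * x := rfl
    rw [hc, Real.map_volume_mul_left hpi.ne', lintegral_smul_measure,
      abs_of_pos (inv_pos.2 hpi)] at e
    exact e.symm
  rw [h2, ← mul_assoc, ← ENNReal.ofReal_mul hpi.le, mul_inv_cancel₀ hpi.ne', ENNReal.ofReal_one,
    one_mul]

/-! ### Fourier inversion almost everywhere, and the law of one observation -/

/-- Inversion without continuity of f, hence only almost everywhere. A test function is written as
the transform of its inverse transform, and the transforms are moved across the integral. -/
theorem ae_eq_fourier_fourier_neg {f : ℝ → ℂ} (hf : Integrable f) (hf' : Integrable (𝓕 f)) :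
    f =ᵐ[volume] 𝓕 (fun x => 𝓕 f (-x)) := by
  refine ae_eq_of_integral_contDiff_smul_eq hf.locallyIntegrable
    (continuous_fourier hf'.comp_neg).locallyIntegrable fun g hg hgc => ?_
  have hgc' : HasCompactSupport (fun x => (g x : ℂ)) :=
    hgc.comp_left (g := fun x : ℝ => (x : ℂ)) (by simp)
  have hg' : ContDiff ℝ ((⊤ : ℕ∞) : WithTop ℕ∞) (fun x => (g x : ℂ)) :=
    Complex.ofRealCLM.contDiff.comp hg
  let G : SchwartzMap ℝ ℂ := hgc'.toSchwartzMap hg'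
  have hG : ∀ x, G x = (g x : ℂ) := fun x => rfl
  have h1 : ∫ x, g x • f x = ∫ x, 𝓕 ((𝓕⁻ G : SchwartzMap ℝ ℂ) : ℝ → ℂ) x * f x := by
    refine integral_congr_ae (Eventually.of_forall fun x => ?_)
    have : 𝓕 ((𝓕⁻ G : SchwartzMap ℝ ℂ) : ℝ → ℂ) x = (g x : ℂ) := by
      rw [← SchwartzMap.fourier_coe, FourierTransform.fourier_fourierInv_eq, hG]
    simp only [this, Complex.real_smul]
  have h2 : ∫ x, g x • 𝓕 (fun x => 𝓕 f (-x)) x = ∫ x, 𝓕 (G : ℝ → ℂ) x * 𝓕 f (-x) := by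
    rw [integral_fourier_mul_eq G.integrable hf'.comp_neg]
    simp [hG]
  rw [h1, h2, integral_fourier_mul_eq (𝓕⁻ G : SchwartzMap ℝ ℂ).integrable hf,
    ← integral_neg_eq_self (fun x => 𝓕 (G : ℝ → ℂ) x * 𝓕 f (-x))]
  refine integral_congr_ae (Eventually.of_forall fun x => ?_)
  simp only [neg_neg, SchwartzMap.fourierInv_coe, Real.fourierInv_eq_fourier_neg]

/-- Outside a compact set the asymptotic equivalence compares |Φ^g| with |u|^(-σ) up to a factor 2;
on the compact set the continuous positive function |Φ^g| (1 + |u|)^σ attains its extrema. The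
weight 1 + |u| in place of |u| makes the bounds valid at 0. -/
theorem IsPolynomialNoise.exists_bounds {σ : ℝ} {g : ℝ → ℝ} (hg : IsPolynomialNoise σ g) :
    ∃ c C : ℝ, 0 < c ∧ 0 < C ∧ ∀ u, c * (1 + |u|) ^ (-σ) ≤ ‖charFn g u‖ ∧
      ‖charFn g u‖ ≤ C * (1 + |u|) ^ (-σ) := by
  obtain ⟨hd, h0, hσ, heq⟩ := hg
  have hcont : Continuous (charFn g) := continuous_charFn hd.2.1
  have hev : ∀ᶠ u in cocompact ℝ, ‖‖charFn g u‖ - |u| ^ (-σ)‖ ≤ 1 / 2 * ‖|u| ^ (-σ)‖ :=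
    heq.isLittleO.def (by norm_num)
  obtain ⟨K, hK, hKs⟩ := mem_cocompact.1 hev
  obtain ⟨R, hR1, hR⟩ : ∃ R : ℝ, 1 ≤ R ∧ K ⊆ Metric.closedBall 0 R := by
    obtain ⟨R, hR⟩ := hK.isBounded.subset_closedBall 0
    exact ⟨max 1 R, le_max_left _ _, hR.trans (Metric.closedBall_subset_closedBall (le_max_right _ _))⟩
  have hr : Continuous fun u : ℝ => ‖charFn g u‖ * (1 + |u|) ^ σ :=
    hcont.norm.mul ((by fun_prop : Continuous fun u : ℝ => 1 + |u|).rpow_const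
      fun u => Or.inl (by positivity))
  have hpos : ∀ u : ℝ, 0 < ‖charFn g u‖ * (1 + |u|) ^ σ := fun u =>
    mul_pos (norm_pos_iff.2 (h0 u)) (by positivity)
  have hne : (Metric.closedBall (0 : ℝ) R).Nonempty := ⟨0, by simp; linarith⟩
  obtain ⟨a, -, ha⟩ := (isCompact_closedBall (0 : ℝ) R).exists_isMinOn hne hr.continuousOn
  obtain ⟨b, -, hb⟩ := (isCompact_closedBall (0 : ℝ) R).exists_isMaxOn hne hr.continuousOn
  have key : ∀ u, min (‖charFn g a‖ * (1 + |a|) ^ σ) (1 / 2) ≤ ‖charFn g u‖ * (1 + |u|) ^ σ ∧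
      ‖charFn g u‖ * (1 + |u|) ^ σ ≤ max (‖charFn g b‖ * (1 + |b|) ^ σ) (2 * 2 ^ σ) := by
    intro u
    by_cases hu : u ∈ Metric.closedBall (0 : ℝ) R
    · exact ⟨(min_le_left _ _).trans (ha hu), (hb hu).trans (le_max_left _ _)⟩
    have h1 : ‖‖charFn g u‖ - |u| ^ (-σ)‖ ≤ 1 / 2 * ‖|u| ^ (-σ)‖ := hKs fun h => hu (hR h)
    have hu1 : 1 < |u| := by
      simp only [Metric.mem_closedBall, dist_zero_right, Real.norm_eq_abs, not_le] at hu
      linarith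
    have hup : 0 < |u| := by linarith
    have hw : 0 < |u| ^ (-σ) := Real.rpow_pos_of_pos hup _
    rw [Real.norm_eq_abs, Real.norm_eq_abs, abs_of_pos hw, abs_le] at h1
    have e : |u| ^ (-σ) * |u| ^ σ = 1 := by
      rw [← Real.rpow_add hup]; simp
    have h3 : |u| ^ σ ≤ (1 + |u|) ^ σ :=
      Real.rpow_le_rpow hup.le (by linarith) (by linarith)
    have h4 : (1 + |u|) ^ σ ≤ 2 ^ σ * |u| ^ σ := by
      rw [← Real.mul_rpow (by norm_num) hup.le]
      exact Real.rpow_le_rpow (by positivity) (by linarith) (by linarith)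
    have hp : 0 < |u| ^ σ := Real.rpow_pos_of_pos hup _
    constructor
    · refine (min_le_right _ _).trans ?_
      calc (1 / 2 : ℝ) = 1 / 2 * |u| ^ (-σ) * |u| ^ σ := by rw [mul_assoc, e, mul_one]
        _ ≤ ‖charFn g u‖ * (1 + |u|) ^ σ := by gcongr; linarith
    · refine le_trans ?_ (le_max_right _ _)
      calc ‖charFn g u‖ * (1 + |u|) ^ σ ≤ (2 * |u| ^ (-σ)) * (2 ^ σ * |u| ^ σ) := by
            gcongr; linarith
        _ = 2 * 2 ^ σ * (|u| ^ (-σ) * |u| ^ σ) := by ring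
        _ = 2 * 2 ^ σ := by rw [e, mul_one]
  refine ⟨min (‖charFn g a‖ * (1 + |a|) ^ σ) (1 / 2),
    max (‖charFn g b‖ * (1 + |b|) ^ σ) (2 * 2 ^ σ), lt_min (hpos a) (by norm_num),
    lt_max_of_lt_left (hpos b), fun u => ?_⟩
  have h1u : 0 < 1 + |u| := by positivity
  have hp : 0 < (1 + |u|) ^ σ := Real.rpow_pos_of_pos h1u _
  rw [Real.rpow_neg h1u.le, ← div_eq_mul_inv, ← div_eq_mul_inv, div_le_iff₀ hp, le_div_iff₀ hp]
  exact key u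

theorem IsPolynomialNoise.integrable_charFn {σ : ℝ} {g : ℝ → ℝ} (hg : IsPolynomialNoise σ g) :
    Integrable (charFn g) := by
  obtain ⟨c, C, hc, hC, h⟩ := hg.exists_bounds
  have hi : Integrable fun u : ℝ => C * (1 + ‖u‖) ^ (-σ) :=
    (integrable_one_add_norm (by simpa using hg.2.2.1)).const_mul C
  exact hi.mono' (continuous_charFn hg.1.2.1).aestronglyMeasurable
    (Eventually.of_forall fun u => (h u).2)

/-- Since σ > 1 the characteristic function is integrable, and Fourier inversion bounds g by its L¹
norm. -/
theorem IsPolynomialNoise.exists_ae_le {σ : ℝ} {g : ℝ → ℝ} (hg : IsPolynomialNoise σ g) :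
    ∃ M : ℝ≥0, ∀ᵐ x, g x ≤ M := by
  have hi : Integrable (fun x => (g x : ℂ)) := hg.1.2.1.ofReal
  have hF : 𝓕 (fun x => (g x : ℂ)) = fun ξ => charFn g (2 * Real.pi * (-ξ)) := by
    funext ξ
    rw [charFn_two_pi_mul, neg_neg]
  have hi' : Integrable (𝓕 (fun x => (g x : ℂ))) := by
    rw [hF]
    exact (hg.integrable_charFn.comp_mul_left' (by positivity : (2 * Real.pi) ≠ 0)).comp_neg
  refine ⟨⟨∫ y, ‖𝓕 (fun x => (g x : ℂ)) (-y)‖, integral_nonneg fun _ => norm_nonneg _⟩, ?_⟩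
  filter_upwards [ae_eq_fourier_fourier_neg hi hi'] with x hx
  have h2 := norm_fourier_le (fun x => 𝓕 (fun x => (g x : ℂ)) (-x)) x
  rw [← hx, Complex.norm_real] at h2
  exact (le_abs_self _).trans h2

/-- The law of a single observation `Y = X + ε`. -/
noncomputable def marginal (f g : ℝ → ℝ) : Measure ℝ := Measure.conv (law f) (law g)

theorem isProbabilityMeasure_law {f : ℝ → ℝ} (hf : IsDensity f) :
    IsProbabilityMeasure (law f) := by
  constructor
  rw [law, withDensity_apply _ MeasurableSet.univ, Measure.restrict_univ,
    ← ofReal_integral_eq_lintegral_ofReal hf.2.1 (Eventually.of_forall hf.1), hf.2.2,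
    ENNReal.ofReal_one]

theorem isProbabilityMeasure_marginal {f g : ℝ → ℝ} (hf : IsDensity f) (hg : IsDensity g) :
    IsProbabilityMeasure (marginal f g) := by
  have := isProbabilityMeasure_law hf
  have := isProbabilityMeasure_law hg
  unfold marginal
  infer_instance

/-- Conditionally on X the observation is a translate of the noise, so the bound on g passes to Y
for every f. This is what makes the variance bounds uniform over the class. -/
theorem marginal_le {f g : ℝ → ℝ} (hf : IsDensity f) (hg : IsDensity g) {M : ℝ≥0}
    (hM : ∀ᵐ x, g x ≤ M) : marginal f g ≤ M • volume := by
  have := isProbabilityMeasure_law hf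
  have := isProbabilityMeasure_law hg
  have hlaw : law g ≤ M • volume := by
    have : (M • volume : Measure ℝ) = volume.withDensity fun _ => (M : ℝ≥0∞) := by
      rw [withDensity_const]; rfl
    rw [this]
    refine withDensity_mono ?_
    filter_upwards [hM] with x hx
    exact ENNReal.ofReal_le_of_le_toReal (by simpa using hx)
  refine Measure.le_iff.2 fun s hs => ?_
  rw [marginal, Measure.conv, Measure.map_apply (by fun_prop) hs,
    Measure.prod_apply (measurable_add hs)]
  calc ∫⁻ x, law g (Prod.mk x ⁻¹' ((fun p : ℝ × ℝ => p.1 + p.2) ⁻¹' s)) ∂(law f)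
      ≤ ∫⁻ x, (M • volume : Measure ℝ) s ∂(law f) := by
        refine lintegral_mono fun x => (hlaw _).trans (le_of_eq ?_)
        simp only [Measure.smul_apply]
        congr 1
        exact measure_preimage_add volume x s
    _ = (M • volume : Measure ℝ) s := by simp

theorem integral_exp_law {f : ℝ → ℝ} (hf : IsDensity f) (u : ℝ) :
    ∫ x : ℝ, Complex.exp (Complex.I * x * u) ∂(law f) = charFn f u := by
  unfold law charFn
  rw [integral_withDensity_eq_integral_toReal_smul₀ hf.2.1.aemeasurable.ennreal_ofReal
    (Eventually.of_forall fun _ => ENNReal.ofReal_lt_top)]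
  refine integral_congr_ae (Eventually.of_forall fun x => ?_)
  simp only [ENNReal.toReal_ofReal (hf.1 x), Complex.real_smul]
  ring

theorem integral_exp_marginal {f g : ℝ → ℝ} (hf : IsDensity f) (hg : IsDensity g) (u : ℝ) :
    ∫ y : ℝ, Complex.exp (Complex.I * y * u) ∂(marginal f g) = charFn f u * charFn g u := by
  have := isProbabilityMeasure_law hf
  have := isProbabilityMeasure_law hg
  rw [← integral_exp_law hf, ← integral_exp_law hg, ← integral_prod_mul, marginal, Measure.conv,
    integral_map (by fun_prop) (Continuous.aestronglyMeasurable (by fun_prop))]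
  refine integral_congr_ae (Eventually.of_forall fun p => ?_)
  simp only [← Complex.exp_add]
  congr 1
  push_cast
  ring

/-! ### The variance of a U-statistic of order two -/

/-- Resampling one coordinate leaves the product law unchanged. It gives Fubini in a single
coordinate without splitting the product space. -/
theorem measurePreserving_update {n : ℕ} (μ : Measure ℝ) [IsProbabilityMeasure μ] (j : Fin n) :
    MeasurePreserving (fun p : (Fin n → ℝ) × ℝ => Function.update p.1 j p.2)
      ((Measure.pi fun _ => μ).prod μ) (Measure.pi fun _ => μ) := by
  have hm : Measurable fun p : (Fin n → ℝ) × ℝ => Function.update p.1 j p.2 := by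
    refine measurable_pi_iff.2 fun i => ?_
    by_cases h : i = j
    · subst h
      simpa using measurable_snd
    · simp only [Function.update_of_ne h]
      fun_prop
  refine ⟨hm, (Measure.pi_eq fun s hs => ?_).symm⟩
  rw [Measure.map_apply hm (MeasurableSet.univ_pi hs)]
  have hpre : (fun p : (Fin n → ℝ) × ℝ => Function.update p.1 j p.2) ⁻¹' Set.univ.pi s =
      (Set.univ.pi (Function.update s j Set.univ)) ×ˢ s j := by
    ext p
    simp only [Set.mem_preimage, Set.mem_pi, Set.mem_univ, true_implies, Set.mem_prod]
    constructor
    · intro h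
      refine ⟨fun i => ?_, by simpa using h j⟩
      by_cases hi : i = j
      · subst hi; simp
      · simpa [Function.update_of_ne hi] using h i
    · rintro ⟨h1, h2⟩ i
      by_cases hi : i = j
      · subst hi; simpa using h2
      · simpa [Function.update_of_ne hi] using h1 i
  rw [hpre, Measure.prod_prod, Measure.pi_pi, ← Finset.prod_erase_mul _ _ (Finset.mem_univ j),
    ← Finset.prod_erase_mul (a := j) Finset.univ (fun i => μ (s i)) (Finset.mem_univ j)]
  simp only [Function.update_self, measure_univ, mul_one]
  congr 1
  refine Finset.prod_congr rfl fun i hi => ?_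
  rw [Function.update_of_ne (Finset.ne_of_mem_erase hi)]

theorem integral_pi_update {n : ℕ} (μ : Measure ℝ) [IsProbabilityMeasure μ] (j : Fin n)
    {F : (Fin n → ℝ) → ℝ} (hF : Measurable F) {B : ℝ} (hB : ∀ y, |F y| ≤ B) :
    ∫ y, F y ∂(Measure.pi fun _ => μ) =
      ∫ y, ∫ t, F (Function.update y j t) ∂μ ∂(Measure.pi fun _ => μ) := by
  have h := measurePreserving_update μ j
  rw [← integral_prod (μ := Measure.pi fun _ => μ) (ν := μ)
    (fun p : (Fin n → ℝ) × ℝ => F (Function.update p.1 j p.2))]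
  · rw [← h.map_eq, integral_map h.measurable.aemeasurable hF.aestronglyMeasurable, h.map_eq]
  · exact Integrable.of_bound (hF.comp h.measurable).aestronglyMeasurable B
      (Eventually.of_forall fun p => hB _)

theorem measurable_uncurry_eval {n : ℕ} {F : ℝ → ℝ → ℝ} (hF : Measurable (Function.uncurry F))
    (k j : Fin n) : Measurable fun y : Fin n → ℝ => F (y k) (y j) :=
  hF.comp (g := Function.uncurry F) (f := fun y : Fin n → ℝ => (y k, y j))
    ((measurable_pi_apply k).prodMk (measurable_pi_apply j))

theorem integral_pi_eval {n : ℕ} (μ : Measure ℝ) [IsProbabilityMeasure μ] (j : Fin n)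
    {F : ℝ → ℝ} (hF : Measurable F) {B : ℝ} (hB : ∀ y, |F y| ≤ B) :
    ∫ y, F (y j) ∂(Measure.pi fun _ => μ) = ∫ t, F t ∂μ := by
  rw [integral_pi_update μ j (F := fun y => F (y j)) (hF.comp (measurable_pi_apply j))
    fun y => hB _]
  simp

theorem integral_pi_eval_two {n : ℕ} (μ : Measure ℝ) [IsProbabilityMeasure μ] {k j : Fin n}
    (hkj : k ≠ j) {F : ℝ → ℝ → ℝ} (hF : Measurable (Function.uncurry F)) {B : ℝ}
    (hB : ∀ x y, |F x y| ≤ B) :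
    ∫ y, F (y k) (y j) ∂(Measure.pi fun _ => μ) = ∫ x, ∫ t, F x t ∂μ ∂μ := by
  have hm : Measurable fun y : Fin n → ℝ => F (y k) (y j) :=
    measurable_uncurry_eval hF k j
  rw [integral_pi_update μ j hm fun y => hB _ _]
  simp only [Function.update_self, Function.update_of_ne hkj]
  refine integral_pi_eval μ k (F := fun x => ∫ t, F x t ∂μ) (B := B)
    hF.stronglyMeasurable.integral_prod_right.measurable fun x => ?_
  simpa using norm_integral_le_of_norm_le_const (μ := μ) (f := F x)
    (Eventually.of_forall (hB x))

/-- The orthogonality behind the Hoeffding decomposition: integrate first over a coordinate on which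
only the centred factor depends. -/
theorem integral_pi_mul_eq_zero {n : ℕ} (μ : Measure ℝ) [IsProbabilityMeasure μ] (j : Fin n)
    {F G : (Fin n → ℝ) → ℝ} (hF : Measurable F) (hG : Measurable G) {B C : ℝ}
    (hB : ∀ y, |F y| ≤ B) (hC : ∀ y, |G y| ≤ C)
    (hGj : ∀ y t, G (Function.update y j t) = G y)
    (hFj : ∀ y, ∫ t, F (Function.update y j t) ∂μ = 0) :
    ∫ y, F y * G y ∂(Measure.pi fun _ => μ) = 0 := by
  rw [integral_pi_update μ j (F := fun y => F y * G y) (hF.mul hG) (B := B * C) fun y => ?_]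
  · simp only [hGj, integral_mul_const, hFj, zero_mul, integral_zero]
  · rw [abs_mul]
    exact mul_le_mul (hB y) (hC y) (abs_nonneg _) ((abs_nonneg _).trans (hB y))

theorem integral_sub_integral_sq {Ω : Type*} [MeasurableSpace Ω] {μ : Measure Ω}
    [IsProbabilityMeasure μ] {v : Ω → ℝ} (hv : Measurable v)
    {B : ℝ} (hB : ∀ y, |v y| ≤ B) :
    ∫ x, (v x - ∫ t, v t ∂μ) ^ 2 ∂μ = (∫ x, v x ^ 2 ∂μ) - (∫ t, v t ∂μ) ^ 2 := by
  have hi : Integrable v μ := Integrable.of_bound hv.aestronglyMeasurable B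
    (Eventually.of_forall hB)
  have hi2 : Integrable (fun x => v x ^ 2) μ := Integrable.of_bound
    (hv.pow_const 2).aestronglyMeasurable (B ^ 2) (Eventually.of_forall fun x => by
      rw [norm_pow]; exact pow_le_pow_left₀ (norm_nonneg _) (hB x) 2)
  set m := ∫ t, v t ∂μ with hm
  have : ∀ x, (v x - m) ^ 2 = v x ^ 2 - 2 * m * v x + m ^ 2 := fun x => by ring
  simp only [this]
  have hi3 : Integrable (fun x => v x ^ 2 - 2 * m * v x) μ := hi2.sub (hi.const_mul _)
  rw [integral_add hi3 (integrable_const _), integral_sub hi2 (hi.const_mul _),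
    integral_const_mul, ← hm]
  simp
  ring

theorem integral_sum_sq_eval_le {n : ℕ} (μ : Measure ℝ) [IsProbabilityMeasure μ] {u : ℝ → ℝ}
    (hu : Measurable u) {B : ℝ} (hB : ∀ y, |u y| ≤ B) (h0 : ∫ x, u x ∂μ = 0) :
    ∫ y, (∑ k : Fin n, u (y k)) ^ 2 ∂(Measure.pi fun _ => μ) = n * ∫ x, u x ^ 2 ∂μ := by
  have hm : ∀ k : Fin n, Measurable fun y : Fin n → ℝ => u (y k) := fun k =>
    hu.comp (measurable_pi_apply k)
  have hint : ∀ k l : Fin n, Integrable (fun y : Fin n → ℝ => u (y k) * u (y l))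
      (Measure.pi fun _ => μ) := fun k l =>
    Integrable.of_bound ((hm k).mul (hm l)).aestronglyMeasurable (B * B)
      (Eventually.of_forall fun y => by
        rw [norm_mul]
        exact mul_le_mul (hB _) (hB _) (norm_nonneg _) ((abs_nonneg _).trans (hB 0)))
  simp only [sq (∑ k : Fin n, _), Finset.sum_mul_sum]
  rw [integral_finsetSum _ fun k _ => integrable_finsetSum _ fun l _ => hint k l]
  have : ∀ k : Fin n, ∫ y, ∑ l : Fin n, u (y k) * u (y l) ∂(Measure.pi fun _ => μ) =
      ∫ x, u x ^ 2 ∂μ := by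
    intro k
    rw [integral_finsetSum _ fun l _ => hint k l, Finset.sum_eq_single k]
    · simp only [← sq]
      exact integral_pi_eval μ k (F := fun x => u x ^ 2) (hu.pow_const 2) (B := B ^ 2) fun y => by
        rw [abs_pow]; exact pow_le_pow_left₀ (abs_nonneg _) (hB y) 2
    · intro l _ hl
      refine integral_pi_mul_eq_zero μ k (hm k) (hm l) (fun y => hB _) (fun y => hB _) ?_ ?_
      · intro y t
        rw [Function.update_of_ne hl]
      · intro y
        simpa using h0
    · simp
  simp [this]

theorem integral_sum_sq_degenerate_le {n : ℕ} (μ : Measure ℝ) [IsProbabilityMeasure μ]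
    {D : ℝ → ℝ → ℝ} (hD : Measurable (Function.uncurry D)) {B : ℝ} (hB : ∀ x y, |D x y| ≤ B)
    (hr : ∀ x, ∫ t, D x t ∂μ = 0) (hl : ∀ x, ∫ t, D t x ∂μ = 0) :
    ∫ y, (∑ q ∈ (Finset.univ : Finset (Fin n)).offDiag, D (y q.1) (y q.2)) ^ 2
        ∂(Measure.pi fun _ => μ) ≤
      2 * (n * (n - 1)) * ∫ x, ∫ t, D x t ^ 2 ∂μ ∂μ := by
  set E := ∫ x, ∫ t, D x t ^ 2 ∂μ ∂μ with hE
  have hm : ∀ q : Fin n × Fin n, Measurable fun y : Fin n → ℝ => D (y q.1) (y q.2) := fun q =>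
    measurable_uncurry_eval hD q.1 q.2
  have hint : ∀ q q' : Fin n × Fin n, Integrable
      (fun y : Fin n → ℝ => D (y q.1) (y q.2) * D (y q'.1) (y q'.2))
      (Measure.pi fun _ => μ) := fun q q' =>
    Integrable.of_bound ((hm q).mul (hm q')).aestronglyMeasurable (B * B)
      (Eventually.of_forall fun y => by
        rw [norm_mul]
        exact mul_le_mul (hB _ _) (hB _ _) (norm_nonneg _) ((abs_nonneg _).trans (hB 0 0)))
  have hsq : ∀ q ∈ (Finset.univ : Finset (Fin n)).offDiag,
      ∫ y, D (y q.1) (y q.2) ^ 2 ∂(Measure.pi fun _ => μ) = E := fun q hq =>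
    integral_pi_eval_two μ (Finset.mem_offDiag.1 hq).2.2 (F := fun x t => D x t ^ 2)
      (hD.pow_const 2) (B := B ^ 2) fun x y => by
        rw [abs_pow]; exact pow_le_pow_left₀ (abs_nonneg _) (hB x y) 2
  have hint2 : ∀ q : Fin n × Fin n, Integrable (fun y : Fin n → ℝ => D (y q.1) (y q.2) ^ 2)
      (Measure.pi fun _ => μ) := fun q => by simpa only [sq] using hint q q
  have hE0 : 0 ≤ E := integral_nonneg fun x => integral_nonneg fun t => sq_nonneg _
  -- Only q itself and its transpose share both indices with q; any other pair leaves one index of q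
  -- free, and degeneracy in that variable kills the product.
  have hpair : ∀ q ∈ (Finset.univ : Finset (Fin n)).offDiag,
      ∀ q' ∈ (Finset.univ : Finset (Fin n)).offDiag,
      ∫ y, D (y q.1) (y q.2) * D (y q'.1) (y q'.2) ∂(Measure.pi fun _ => μ) ≤
        if q' = q ∨ q' = q.swap then E else 0 := by
    intro q hq q' hq'
    have hqn := (Finset.mem_offDiag.1 hq).2.2
    have hqn' := (Finset.mem_offDiag.1 hq').2.2
    split_ifs with hc
    · calc ∫ y, D (y q.1) (y q.2) * D (y q'.1) (y q'.2) ∂(Measure.pi fun _ => μ)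
          ≤ ∫ y, (1 / 2 * D (y q.1) (y q.2) ^ 2 + 1 / 2 * D (y q'.1) (y q'.2) ^ 2)
              ∂(Measure.pi fun _ => μ) := by
            refine integral_mono (hint q q') (((hint2 q).const_mul _).add
              ((hint2 q').const_mul _)) fun y => ?_
            have := sq_nonneg (D (y q.1) (y q.2) - D (y q'.1) (y q'.2))
            nlinarith
        _ = E := by
            rw [integral_add ((hint2 q).const_mul _) ((hint2 q').const_mul _),
              integral_const_mul, integral_const_mul, hsq q hq, hsq q' hq']
            ring
    · refine le_of_eq ?_
      by_cases h2 : q.2 ≠ q'.1 ∧ q.2 ≠ q'.2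
      · refine integral_pi_mul_eq_zero μ q.2 (hm q) (hm q') (fun y => hB _ _) (fun y => hB _ _)
          (fun y t => ?_) fun y => ?_
        · rw [Function.update_of_ne h2.1.symm, Function.update_of_ne h2.2.symm]
        · simpa [Function.update_of_ne hqn] using hr _
      -- Here the second index of q occurs in q'. If the first one did too, q' would be q or its
      -- transpose.
      have h1 : q.1 ≠ q'.1 ∧ q.1 ≠ q'.2 := by
        obtain ⟨a, b⟩ := q
        obtain ⟨a', b'⟩ := q'
        simp only [Prod.swap_prod_mk, Prod.mk.injEq] at *
        grind
      refine integral_pi_mul_eq_zero μ q.1 (hm q) (hm q') (fun y => hB _ _) (fun y => hB _ _)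
        (fun y t => ?_) fun y => ?_
      · rw [Function.update_of_ne h1.1.symm, Function.update_of_ne h1.2.symm]
      · simpa [Function.update_of_ne hqn.symm] using hl _
  simp only [sq (∑ q ∈ _, _), Finset.sum_mul_sum]
  rw [integral_finsetSum _ fun k _ => integrable_finsetSum _ fun l _ => hint k l]
  calc ∑ q ∈ (Finset.univ : Finset (Fin n)).offDiag,
        ∫ y, ∑ q' ∈ (Finset.univ : Finset (Fin n)).offDiag,
          D (y q.1) (y q.2) * D (y q'.1) (y q'.2) ∂(Measure.pi fun _ => μ)
      ≤ ∑ q ∈ (Finset.univ : Finset (Fin n)).offDiag, 2 * E := by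
        refine Finset.sum_le_sum fun q hq => ?_
        rw [integral_finsetSum _ fun l _ => hint q l]
        refine (Finset.sum_le_sum fun q' hq' => hpair q hq q' hq').trans ?_
        rw [← Finset.sum_filter, Finset.sum_const, nsmul_eq_mul]
        refine mul_le_mul_of_nonneg_right ?_ hE0
        have : (Finset.filter (fun q' => q' = q ∨ q' = q.swap)
            (Finset.univ : Finset (Fin n)).offDiag).card ≤ ({q, q.swap} : Finset _).card :=
          Finset.card_le_card fun x hx => by simpa using (Finset.mem_filter.1 hx).2
        exact_mod_cast this.trans Finset.card_le_two
    _ = 2 * (n * (n - 1)) * E := by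
        rw [Finset.sum_const, Finset.offDiag_card, nsmul_eq_mul, Finset.card_univ,
          Fintype.card_fin, Nat.cast_sub (Nat.le_mul_self n)]
        push_cast
        ring

/-- Second moment bound for a U-statistic with a bounded symmetric kernel. -/
theorem integral_sq_uStatistic_sub_le {n : ℕ} (hn : 2 ≤ n) (μ : Measure ℝ)
    [IsProbabilityMeasure μ] {W : ℝ → ℝ → ℝ} (hW : Measurable (Function.uncurry W))
    {B : ℝ} (hB : ∀ x y, |W x y| ≤ B) (hsymm : ∀ x y, W x y = W y x) :
    ∫ y, (1 / ((n : ℝ) * (n - 1)) * ∑ q ∈ (Finset.univ : Finset (Fin n)).offDiag,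
        W (y q.1) (y q.2) - ∫ x, ∫ t, W x t ∂μ ∂μ) ^ 2 ∂(Measure.pi fun _ => μ) ≤
      56 / n * (∫ x, (∫ t, W x t ∂μ) ^ 2 ∂μ) + 32 / n ^ 2 * ∫ x, ∫ t, W x t ^ 2 ∂μ ∂μ := by
  set v : ℝ → ℝ := fun x => ∫ t, W x t ∂μ with hv
  set θ := ∫ x, v x ∂μ with hθ
  set V := ∫ x, v x ^ 2 ∂μ with hV
  set E := ∫ x, ∫ t, W x t ^ 2 ∂μ ∂μ with hE
  have hB0 : 0 ≤ B := (abs_nonneg _).trans (hB 0 0)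
  have hvm : Measurable v := hW.stronglyMeasurable.integral_prod_right.measurable
  have hvB : ∀ x, |v x| ≤ B := fun x => by
    simpa using norm_integral_le_of_norm_le_const (μ := μ) (f := W x) (Eventually.of_forall (hB x))
  have hθB : |θ| ≤ B := by
    simpa using norm_integral_le_of_norm_le_const (μ := μ) (f := v) (Eventually.of_forall hvB)
  have hvi : Integrable v μ := Integrable.of_bound hvm.aestronglyMeasurable B
    (Eventually.of_forall hvB)
  have hWx : ∀ x, Measurable (W x) := fun x => hW.comp (measurable_const.prodMk measurable_id)
  have hWi : ∀ x, Integrable (W x) μ := fun x => Integrable.of_bound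
    (hWx x).aestronglyMeasurable B (Eventually.of_forall (hB x))
  have hvar := integral_sub_integral_sq (μ := μ) hvm hvB
  rw [← hθ, ← hV] at hvar
  have hvar0 : 0 ≤ ∫ x, (v x - θ) ^ 2 ∂μ := integral_nonneg fun x => sq_nonneg _
  have hθV : θ ^ 2 ≤ V := by linarith
  have hV0 : 0 ≤ V := (sq_nonneg θ).trans hθV
  have hE0 : 0 ≤ E := integral_nonneg fun x => integral_nonneg fun t => sq_nonneg _
  -- The doubly centred part of W, with zero mean in each variable.
  set D : ℝ → ℝ → ℝ := fun x t => W x t - v x - v t + θ with hD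
  have hDm : Measurable (Function.uncurry D) :=
    ((hW.sub (hvm.comp measurable_fst)).sub (hvm.comp measurable_snd)).add_const θ
  have hDB : ∀ x y, |D x y| ≤ 4 * B := fun x y => by
    have h1 := abs_le.1 (hB x y)
    have h2 := abs_le.1 (hvB x)
    have h3 := abs_le.1 (hvB y)
    have h4 := abs_le.1 hθB
    rw [abs_le]
    simp only [hD]
    constructor <;> linarith
  have hDr : ∀ x, ∫ t, D x t ∂μ = 0 := fun x => by
    simp only [hD]
    have i1 : Integrable (fun t => W x t - v x) μ := (hWi x).sub (integrable_const _)
    have i2 : Integrable (fun t => W x t - v x - v t) μ := i1.sub hvi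
    rw [integral_add i2 (integrable_const _), integral_sub i1 hvi, integral_sub (hWi x) (integrable_const _)]
    have e : ∫ t, W x t ∂μ = v x := rfl
    rw [e, ← hθ, integral_const, integral_const, probReal_univ, one_smul, one_smul]
    ring
  have hDs : ∀ x t, D x t = D t x := fun x t => by
    simp only [hD]; rw [hsymm x t]; ring
  have hDl : ∀ x, ∫ t, D t x ∂μ = 0 := fun x => by
    simp only [hDs _ x, hDr]
  have hsqm : ∀ {F : ℝ → ℝ → ℝ} {C : ℝ}, Measurable (Function.uncurry F) →
      (∀ x y, |F x y| ≤ C) → Integrable (fun p : ℝ × ℝ => F p.1 p.2 ^ 2) (μ.prod μ) := by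
    intro F C hF hC
    exact Integrable.of_bound (hF.pow_const 2).aestronglyMeasurable (C ^ 2)
      (Eventually.of_forall fun p => by
        rw [norm_pow]; exact pow_le_pow_left₀ (norm_nonneg _) (hC _ _) 2)
  have hDE : ∫ x, ∫ t, D x t ^ 2 ∂μ ∂μ ≤ 4 * (E + 3 * V) := by
    have iW := hsqm hW hB
    have iv1 := hsqm (F := fun x _ => v x) (hvm.comp measurable_fst) (fun x _ => hvB x)
    have iv2 := hsqm (F := fun _ t => v t) (hvm.comp measurable_snd) (fun _ t => hvB t)
    have iD := hsqm hDm hDB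
    have e1 : ∫ x, ∫ t, D x t ^ 2 ∂μ ∂μ = ∫ p : ℝ × ℝ, D p.1 p.2 ^ 2 ∂(μ.prod μ) :=
      (integral_prod _ iD).symm
    have e2 : E = ∫ p : ℝ × ℝ, W p.1 p.2 ^ 2 ∂(μ.prod μ) := (integral_prod _ iW).symm
    have e3 : ∫ p : ℝ × ℝ, v p.1 ^ 2 ∂(μ.prod μ) = V := by
      rw [integral_prod _ iv1]; simp [hV]
    have e4 : ∫ p : ℝ × ℝ, v p.2 ^ 2 ∂(μ.prod μ) = V := by
      rw [integral_prod _ iv2]; simp [hV]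
    calc ∫ x, ∫ t, D x t ^ 2 ∂μ ∂μ = ∫ p : ℝ × ℝ, D p.1 p.2 ^ 2 ∂(μ.prod μ) := e1
      _ ≤ ∫ p : ℝ × ℝ, 4 * (((W p.1 p.2 ^ 2 + v p.1 ^ 2) + v p.2 ^ 2) + θ ^ 2) ∂(μ.prod μ) := by
          refine integral_mono iD ((((iW.add iv1).add iv2).add (integrable_const _)).const_mul 4)
            fun p => ?_
          simp only [hD]
          -- The inequality (a - b - c + d)² ≤ 4 (a² + b² + c² + d²), whose defect is the sum of the
          -- six squares listed.
          nlinarith [sq_nonneg (W p.1 p.2 + v p.1), sq_nonneg (W p.1 p.2 + v p.2),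
            sq_nonneg (W p.1 p.2 - θ), sq_nonneg (v p.1 - v p.2), sq_nonneg (v p.1 + θ),
            sq_nonneg (v p.2 + θ)]
      _ = 4 * (((E + V) + V) + θ ^ 2) := by
          have iWv : Integrable (fun p : ℝ × ℝ => W p.1 p.2 ^ 2 + v p.1 ^ 2) (μ.prod μ) :=
            iW.add iv1
          have iWvv : Integrable (fun p : ℝ × ℝ => W p.1 p.2 ^ 2 + v p.1 ^ 2 + v p.2 ^ 2)
            (μ.prod μ) := iWv.add iv2
          rw [integral_const_mul, integral_add iWvv (integrable_const _),
            integral_add iWv iv2, integral_add iW iv1, ← e2, e3, e4]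
          simp
      _ ≤ 4 * (E + 3 * V) := by linarith
  have hn' : (2 : ℝ) ≤ n := by exact_mod_cast hn
  have hn0 : (0 : ℝ) < n := by linarith
  have hn1 : (0 : ℝ) < n - 1 := by linarith
  set P : Measure (Fin n → ℝ) := Measure.pi fun _ => μ with hP
  -- Hoeffding decomposition: each observation occurs in 2(n - 1) ordered pairs, which gives the
  -- coefficient of the linear part.
  have hdec : ∀ y : Fin n → ℝ, 1 / ((n : ℝ) * (n - 1)) *
      ∑ q ∈ (Finset.univ : Finset (Fin n)).offDiag, W (y q.1) (y q.2) - θ =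
      1 / ((n : ℝ) * (n - 1)) * (2 * (n - 1) * ∑ k, (v (y k) - θ) +
        ∑ q ∈ (Finset.univ : Finset (Fin n)).offDiag, D (y q.1) (y q.2)) := by
    intro y
    have hcard : ((Finset.univ : Finset (Fin n)).offDiag.card : ℝ) = n * (n - 1) := by
      rw [Finset.offDiag_card, Finset.card_univ, Fintype.card_fin,
        Nat.cast_sub (Nat.le_mul_self n)]
      push_cast; ring
    have hs1 : ∑ q ∈ (Finset.univ : Finset (Fin n)).offDiag, v (y q.1) =
        (n - 1) * ∑ k, v (y k) := by
      have : ∑ q ∈ (Finset.univ : Finset (Fin n)).offDiag, v (y q.1) =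
          ∑ k, ∑ j ∈ Finset.univ.erase k, v (y k) := by
        rw [Finset.sum_sigma']
        refine Finset.sum_bij' (fun q _ => ⟨q.1, q.2⟩) (fun q _ => (q.1, q.2)) ?_ ?_ ?_ ?_ ?_ <;>
          simp +contextual [eq_comm]
      rw [this, Finset.mul_sum]
      refine Finset.sum_congr rfl fun k _ => ?_
      rw [Finset.sum_const, Finset.card_erase_of_mem (Finset.mem_univ k), Finset.card_univ,
        Fintype.card_fin, nsmul_eq_mul, Nat.cast_sub (by omega)]
      simp
    have hs2 : ∑ q ∈ (Finset.univ : Finset (Fin n)).offDiag, v (y q.2) =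
        ∑ q ∈ (Finset.univ : Finset (Fin n)).offDiag, v (y q.1) := by
      refine Finset.sum_bij' (fun q _ => q.swap) (fun q _ => q.swap) ?_ ?_ ?_ ?_ ?_ <;>
        simp +contextual [eq_comm]
    simp only [hD, Finset.sum_add_distrib, Finset.sum_sub_distrib, hs2, hs1, Finset.sum_const,
      nsmul_eq_mul, hcard, Finset.card_univ, Fintype.card_fin]
    field_simp
    ring
  have hA := integral_sum_sq_eval_le (n := n) μ (u := fun x => v x - θ) (hvm.sub_const θ)
    (B := 2 * B) (fun x => by
      have h2 := abs_le.1 (hvB x)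
      have h4 := abs_le.1 hθB
      rw [abs_le]; constructor <;> linarith) (by
      rw [integral_sub hvi (integrable_const _)]; simp [← hθ])
  have hAm : Measurable fun y : Fin n → ℝ => ∑ k, (v (y k) - θ) :=
    Finset.measurable_sum _ fun k _ => (hvm.comp (measurable_pi_apply k)).sub_const θ
  have hDsm : Measurable fun y : Fin n → ℝ =>
      ∑ q ∈ (Finset.univ : Finset (Fin n)).offDiag, D (y q.1) (y q.2) :=
    Finset.measurable_sum _ fun q _ =>
      measurable_uncurry_eval hDm q.1 q.2
  have iA : Integrable (fun y : Fin n → ℝ => (∑ k, (v (y k) - θ)) ^ 2) P :=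
    Integrable.of_bound (hAm.pow_const 2).aestronglyMeasurable ((n * (2 * B)) ^ 2)
      (Eventually.of_forall fun y => by
        rw [norm_pow]
        refine pow_le_pow_left₀ (norm_nonneg _) ((norm_sum_le _ _).trans ?_) 2
        refine (Finset.sum_le_card_nsmul _ _ (2 * B) fun k _ => ?_).trans (by simp)
        have h2 := abs_le.1 (hvB (y k))
        have h4 := abs_le.1 hθB
        rw [Real.norm_eq_abs, abs_le]; constructor <;> linarith)
  have iD : Integrable (fun y : Fin n → ℝ =>
      (∑ q ∈ (Finset.univ : Finset (Fin n)).offDiag, D (y q.1) (y q.2)) ^ 2) P :=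
    Integrable.of_bound (hDsm.pow_const 2).aestronglyMeasurable
      (((Finset.univ : Finset (Fin n)).offDiag.card * (4 * B)) ^ 2)
      (Eventually.of_forall fun y => by
        rw [norm_pow]
        refine pow_le_pow_left₀ (norm_nonneg _) ((norm_sum_le _ _).trans ?_) 2
        refine (Finset.sum_le_card_nsmul _ _ (4 * B) fun q _ => hDB _ _).trans (by simp))
  have hDD := (integral_sum_sq_degenerate_le (n := n) μ hDm hDB hDr hDl).trans
    (mul_le_mul_of_nonneg_left hDE (by positivity))
  calc ∫ y, (1 / ((n : ℝ) * (n - 1)) * ∑ q ∈ (Finset.univ : Finset (Fin n)).offDiag,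
        W (y q.1) (y q.2) - θ) ^ 2 ∂P
      ≤ ∫ y, (8 / (n : ℝ) ^ 2 * (∑ k, (v (y k) - θ)) ^ 2 + 2 / ((n : ℝ) * (n - 1)) ^ 2 *
          (∑ q ∈ (Finset.univ : Finset (Fin n)).offDiag, D (y q.1) (y q.2)) ^ 2) ∂P := by
        refine integral_mono_of_nonneg (Eventually.of_forall fun y => sq_nonneg _)
          ((iA.const_mul _).add (iD.const_mul _)) (Eventually.of_forall fun y => ?_)
        simp only [hdec]
        set a := ∑ k, (v (y k) - θ)
        set b := ∑ q ∈ (Finset.univ : Finset (Fin n)).offDiag, D (y q.1) (y q.2)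
        have e : 8 / (n : ℝ) ^ 2 * a ^ 2 + 2 / ((n : ℝ) * (n - 1)) ^ 2 * b ^ 2 =
          1 / ((n : ℝ) * (n - 1)) ^ 2 * (2 * (2 * (n - 1) * a) ^ 2 + 2 * b ^ 2) := by
          field_simp
          ring
        rw [e, mul_pow, one_div_pow]
        refine mul_le_mul_of_nonneg_left ?_ (by positivity)
        nlinarith [sq_nonneg (2 * (n - 1) * a - b)]
    _ = 8 / (n : ℝ) ^ 2 * (n * ∫ x, (v x - θ) ^ 2 ∂μ) + 2 / ((n : ℝ) * (n - 1)) ^ 2 *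
          ∫ y, (∑ q ∈ (Finset.univ : Finset (Fin n)).offDiag, D (y q.1) (y q.2)) ^ 2 ∂P := by
        rw [integral_add (iA.const_mul _) (iD.const_mul _), integral_const_mul,
          integral_const_mul, hA]
    _ ≤ 8 / (n : ℝ) ^ 2 * (n * V) + 2 / ((n : ℝ) * (n - 1)) ^ 2 *
          (2 * (n * (n - 1)) * (4 * (E + 3 * V))) := by
        gcongr
        linarith [sq_nonneg θ]
    _ = 8 / n * V + 16 / ((n : ℝ) * (n - 1)) * E + 48 / ((n : ℝ) * (n - 1)) * V := by
        field_simp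
        ring
    _ ≤ 8 / n * V + 32 / (n : ℝ) ^ 2 * E + 48 / n * V := by
        -- Since n ≥ 2, both n - 1 ≥ n/2 and n - 1 ≥ 1.
        have h1 : 16 / ((n : ℝ) * (n - 1)) ≤ 32 / (n : ℝ) ^ 2 := by
          rw [div_le_div_iff₀ (by positivity) (by positivity)]
          nlinarith
        have h2 : 48 / ((n : ℝ) * (n - 1)) ≤ 48 / n := by
          rw [div_le_div_iff₀ (by positivity) (by positivity)]
          nlinarith
        gcongr
    _ = 56 / n * V + 32 / n ^ 2 * E := by ring

/-! ### The deconvolution kernel in the Fourier domain -/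

/-- Averaging a Fourier transform over a probability measure. -/
theorem integral_fourier_add_mul {a : ℝ → ℂ} (ha : Integrable a) (μ : Measure ℝ)
    [IsProbabilityMeasure μ] (x s : ℝ) :
    ∫ t, 𝓕 a (x + s * t) ∂μ = 𝓕 (fun ξ : ℝ => a ξ *
      ∫ t : ℝ, Complex.exp (Complex.I * t * ((-(s * (2 * Real.pi * ξ)) : ℝ) : ℂ)) ∂μ) x := by
  simp only [Real.fourier_real_eq_integral_exp_smul, smul_eq_mul]
  have hn : ∀ r : ℝ, ‖Complex.exp (r * Complex.I)‖ = 1 := Complex.norm_exp_ofReal_mul_I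
  rw [integral_integral_swap]
  · refine integral_congr_ae (Eventually.of_forall fun ξ => ?_)
    simp only
    rw [← integral_const_mul, ← integral_const_mul]
    refine integral_congr_ae (Eventually.of_forall fun t => ?_)
    simp only
    rw [mul_left_comm, mul_comm (a ξ), ← mul_assoc, ← Complex.exp_add]
    congr 2
    push_cast
    ring
  · have h1 : Integrable (fun p : ℝ × ℝ => (1 : ℂ) * a p.2) (μ.prod volume) :=
      (integrable_const (1 : ℂ)).mul_prod ha
    refine h1.mono ?_ (Eventually.of_forall fun p => ?_)
    · refine AEStronglyMeasurable.mul (Continuous.aestronglyMeasurable (by fun_prop)) ?_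
      simpa using h1.1
    · simp only [Function.uncurry, norm_mul, hn, norm_one]
      exact le_rfl

theorem fourier_exp_mul (k : ℝ → ℂ) (a x : ℝ) :
    𝓕 (fun ξ : ℝ => Complex.exp ((2 * Real.pi * a * ξ : ℝ) * Complex.I) * k ξ) x =
      𝓕 k (x - a) := by
  simp only [Real.fourier_real_eq_integral_exp_smul, smul_eq_mul]
  refine integral_congr_ae (Eventually.of_forall fun ξ => ?_)
  simp only
  rw [← mul_assoc, ← Complex.exp_add]
  congr 2
  push_cast
  ring

/-- The Fourier transform of the rescaled kernel, in the frequency variable `ξ = u / (2π)`. -/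
noncomputable def deconvFT (g : ℝ → ℝ) (h ξ : ℝ) : ℂ := kernelFT g h (2 * Real.pi * h * ξ)

theorem scaledKernel_eq_fourier (g : ℝ → ℝ) {h : ℝ} (hh : 0 < h) (x : ℝ) :
    ((scaledKernel g h x : ℝ) : ℂ) = 𝓕 (deconvFT g h) x := by
  rw [scaledKernel, Complex.ofReal_mul, kernel_eq, kernelC,
    Real.fourier_real_eq_integral_exp_smul]
  have hpi : (0 : ℝ) < 2 * Real.pi * h := by positivity
  have := Measure.integral_comp_mul_left (fun u : ℝ => Complex.exp (-(Complex.I * u *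
    ((x / h : ℝ) : ℂ))) * kernelFT g h u) (2 * Real.pi * h)
  rw [abs_of_pos (inv_pos.2 hpi)] at this
  have e : ∀ I : ℂ, ((1 / h : ℝ) : ℂ) * ((1 / (2 * Real.pi) : ℂ) * I) =
      (2 * Real.pi * h)⁻¹ • I := by
    intro I
    rw [Complex.real_smul]
    push_cast
    field_simp
  rw [e, ← this]
  refine integral_congr_ae (Eventually.of_forall fun ξ => ?_)
  simp only [deconvFT, smul_eq_mul]
  congr 2
  have hh' : (h : ℂ) ≠ 0 := by exact_mod_cast hh.ne'
  push_cast
  field_simp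

theorem deconvFT_eq (g : ℝ → ℝ) {h : ℝ} (hh : 0 < h) (ξ : ℝ) :
    deconvFT g h ξ = (Set.Icc (-(2 * Real.pi * h)⁻¹) (2 * Real.pi * h)⁻¹).indicator
      (fun ξ => (charFn g (2 * Real.pi * ξ))⁻¹) ξ := by
  have hpi : (0 : ℝ) < 2 * Real.pi * h := by positivity
  have h1 : 2 * Real.pi * h * ξ / h = 2 * Real.pi * ξ := by field_simp
  have h2 : 2 * Real.pi * h * ξ ∈ Set.Icc (-1 : ℝ) 1 ↔
      ξ ∈ Set.Icc (-(2 * Real.pi * h)⁻¹) (2 * Real.pi * h)⁻¹ := by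
    rw [Set.mem_Icc, Set.mem_Icc, ← abs_le, ← abs_le, abs_mul, abs_of_pos hpi, ← one_div,
      le_div_iff₀ hpi, mul_comm]
  unfold deconvFT kernelFT
  rw [h1]
  by_cases hm : 2 * Real.pi * h * ξ ∈ Set.Icc (-1 : ℝ) 1
  · rw [Set.indicator_of_mem hm, Set.indicator_of_mem (h2.1 hm), mul_one]
  · rw [Set.indicator_of_notMem hm, Set.indicator_of_notMem (mt h2.2 hm), mul_zero]

theorem measurable_deconvFT {g : ℝ → ℝ} (hg : Integrable g) {h : ℝ} (hh : 0 < h) :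
    Measurable (deconvFT g h) := by
  rw [funext (deconvFT_eq g hh)]
  refine Measurable.indicator ?_ measurableSet_Icc
  exact ((continuous_charFn hg).measurable.comp (measurable_const_mul _)).inv

/-- A bounded measurable function supported in a bounded interval is in every `Lᵖ`. -/
theorem memLp_of_bounded_indicator {F : ℝ → ℂ} (hF : Measurable F) {B R : ℝ}
    (hB : ∀ ξ, ‖F ξ‖ ≤ (Set.Icc (-R) R).indicator (fun _ => B) ξ) (p : ℝ≥0∞) : MemLp F p := by
  have h1 : MemLp ((Set.Icc (-R) R).indicator (fun _ => B)) p :=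
    memLp_indicator_const p measurableSet_Icc B (Or.inr (by simp))
  exact h1.mono hF.aestronglyMeasurable (Eventually.of_forall fun ξ =>
    (hB ξ).trans (le_abs_self _))

/-- The bound `|Φ^g(u)|⁻¹ ≤ c⁻¹ (1 + |u|)^σ` carried to the kernel. -/
theorem norm_deconvFT_le {g : ℝ → ℝ} {σ c : ℝ} (hσ : 0 ≤ σ) (hc : 0 < c)
    (hg : ∀ u, c * (1 + |u|) ^ (-σ) ≤ ‖charFn g u‖) {h : ℝ} (hh : 0 < h) (hh1 : h ≤ 1) (ξ : ℝ) :
    ‖deconvFT g h ξ‖ ≤ (Set.Icc (-(2 * Real.pi * h)⁻¹) (2 * Real.pi * h)⁻¹).indicator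
      (fun _ => c⁻¹ * (2 / h) ^ σ) ξ := by
  rw [deconvFT_eq g hh, norm_indicator_eq_indicator_norm]
  refine Set.indicator_le_indicator' fun hm => ?_
  have hpi : (0 : ℝ) < 2 * Real.pi := by positivity
  have hu : |2 * Real.pi * ξ| ≤ 1 / h := by
    rw [Set.mem_Icc, ← abs_le] at hm
    rw [abs_mul, abs_of_pos hpi, le_div_iff₀ hh]
    calc 2 * Real.pi * |ξ| * h = 2 * Real.pi * h * |ξ| := by ring
      _ ≤ 2 * Real.pi * h * (2 * Real.pi * h)⁻¹ := by gcongr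
      _ = 1 := mul_inv_cancel₀ (by positivity)
  have h2 : 1 + |2 * Real.pi * ξ| ≤ 2 / h := by
    have : 1 ≤ 1 / h := by rwa [le_div_iff₀ hh, one_mul]
    have e : 2 / h = 1 / h + 1 / h := by ring
    rw [e]
    exact add_le_add this hu
  have h3 : c * (2 / h) ^ (-σ) ≤ ‖charFn g (2 * Real.pi * ξ)‖ :=
    le_trans (mul_le_mul_of_nonneg_left (Real.rpow_le_rpow_of_nonpos (by positivity) h2
      (by linarith)) hc.le) (hg _)
  have h4 : 0 < (2 / h) ^ σ := Real.rpow_pos_of_pos (by positivity) _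
  rw [Real.rpow_neg (by positivity)] at h3
  rw [norm_inv]
  calc ‖charFn g (2 * Real.pi * ξ)‖⁻¹ ≤ (c * ((2 / h) ^ σ)⁻¹)⁻¹ :=
        inv_anti₀ (by positivity) h3
    _ = c⁻¹ * (2 / h) ^ σ := by rw [mul_inv, inv_inv]

/-- The kernel `∫ K_{n,h}(x - a) K_{n,h}(x - b) dx` of the U-statistic. -/
noncomputable def pairKernel (g : ℝ → ℝ) (h a b : ℝ) : ℝ :=
  ∫ x : ℝ, scaledKernel g h (x - a) * scaledKernel g h (x - b)

theorem pairKernel_symm (g : ℝ → ℝ) (h a b : ℝ) : pairKernel g h a b = pairKernel g h b a := by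
  unfold pairKernel
  simp only [mul_comm]

/-- Translating the kernel modulates its transform, so by Plancherel the two phases combine into one
that depends on a - b only, in front of the squared modulus. -/
theorem pairKernel_eq_fourier {g : ℝ → ℝ} {h : ℝ} (hh : 0 < h)
    (hk : Integrable (deconvFT g h)) (hk2 : MemLp (deconvFT g h) 2) (a b : ℝ) :
    ((pairKernel g h a b : ℝ) : ℂ) = 𝓕 (fun ξ => ((‖deconvFT g h ξ‖ ^ 2 : ℝ) : ℂ)) (a - b) := by
  have hph : ∀ r : ℝ, Continuous fun ξ : ℝ =>
      Complex.exp ((2 * Real.pi * r * ξ : ℝ) * Complex.I) := fun r => by fun_prop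
  have hi : ∀ r : ℝ, Integrable fun ξ : ℝ =>
      Complex.exp ((2 * Real.pi * r * ξ : ℝ) * Complex.I) * deconvFT g h ξ := fun r =>
    hk.mono ((hph r).aestronglyMeasurable.mul hk.1) (Eventually.of_forall fun ξ => by
      rw [norm_mul, Complex.norm_exp_ofReal_mul_I, one_mul])
  have hi2 : ∀ r : ℝ, MemLp (fun ξ : ℝ =>
      Complex.exp ((2 * Real.pi * r * ξ : ℝ) * Complex.I) * deconvFT g h ξ) 2 := fun r =>
    hk2.mono ((hph r).aestronglyMeasurable.mul hk.1) (Eventually.of_forall fun ξ => by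
      rw [norm_mul, Complex.norm_exp_ofReal_mul_I, one_mul])
  have h1 := integral_conj_fourier_mul_fourier (hi a) (hi2 a) (hi b) (hi2 b)
  simp only [fourier_exp_mul, ← scaledKernel_eq_fourier g hh, Complex.conj_ofReal] at h1
  rw [pairKernel, ← integral_complex_ofReal]
  simp only [Complex.ofReal_mul]
  rw [h1, Real.fourier_real_eq_integral_exp_smul]
  refine integral_congr_ae (Eventually.of_forall fun ξ => ?_)
  simp only [map_mul, smul_eq_mul]
  rw [mul_mul_mul_comm, ← Complex.exp_conj, ← Complex.exp_add, Complex.conj_mul']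
  push_cast
  congr 2
  simp [map_ofNat]
  ring

theorem integral_mono_of_le_smul {μ : Measure ℝ} {M : ℝ≥0} (hμ : μ ≤ M • volume)
    {F : ℝ → ℝ} (h0 : ∀ x, 0 ≤ F x) (hF : Integrable F) : ∫ x, F x ∂μ ≤ M * ∫ x, F x := by
  have h1 : Integrable F (M • volume : Measure ℝ) := hF.smul_measure_nnreal
  calc ∫ x, F x ∂μ ≤ ∫ x, F x ∂(M • volume : Measure ℝ) :=
        integral_mono_measure hμ (Eventually.of_forall h0) h1
    _ = M * ∫ x, F x := by rw [integral_smul_nnreal_measure]; rfl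

theorem continuous_charFn_mul {f g : ℝ → ℝ} (hf : IsDensity f) (hg : IsDensity g) :
    Continuous fun ξ : ℝ => charFn f (2 * Real.pi * ξ) * charFn g (2 * Real.pi * ξ) :=
  ((continuous_charFn hf.2.1).comp (by fun_prop)).mul
    ((continuous_charFn hg.2.1).comp (by fun_prop))

theorem memLp_sq_mul_charFn {f g : ℝ → ℝ} (hf : IsDensity f) (hg : IsDensity g) {h : ℝ}
    {p : ℝ≥0∞} (hk : MemLp (fun ξ => ((‖deconvFT g h ξ‖ ^ 2 : ℝ) : ℂ)) p) :
    MemLp (fun ξ : ℝ => ((‖deconvFT g h ξ‖ ^ 2 : ℝ) : ℂ) *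
      (charFn f (2 * Real.pi * ξ) * charFn g (2 * Real.pi * ξ))) p := by
  refine hk.mono (hk.1.mul (continuous_charFn_mul hf hg).aestronglyMeasurable)
    (Eventually.of_forall fun ξ => ?_)
  rw [norm_mul, norm_mul]
  exact mul_le_of_le_one_right (norm_nonneg _)
    (mul_le_one₀ (norm_charFn_le_one hf _) (norm_nonneg _) (norm_charFn_le_one hg _))

/-- Averaging over one observation multiplies the transform by the characteristic function of Y,
which is the product of those of X and of the noise. This is the projection of the kernel. -/
theorem integral_pairKernel {f g : ℝ → ℝ} {h : ℝ} (hf : IsDensity f) (hg : IsDensity g)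
    (hh : 0 < h) (hk : ∀ p, MemLp (deconvFT g h) p)
    (hk4 : ∀ p, MemLp (fun ξ => ((‖deconvFT g h ξ‖ ^ 2 : ℝ) : ℂ)) p) (x : ℝ) :
    ((∫ t, pairKernel g h x t ∂(marginal f g) : ℝ) : ℂ) =
      𝓕 (fun ξ : ℝ => ((‖deconvFT g h ξ‖ ^ 2 : ℝ) : ℂ) *
        (charFn f (2 * Real.pi * ξ) * charFn g (2 * Real.pi * ξ))) x := by
  have := isProbabilityMeasure_marginal hf hg
  have h1 := integral_fourier_add_mul (memLp_one_iff_integrable.1 (hk4 1)) (marginal f g) x (-1)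
  rw [← integral_complex_ofReal]
  simp only [integral_exp_marginal hf hg, neg_one_mul, neg_neg, ← sub_eq_add_neg] at h1
  simp only [pairKernel_eq_fourier hh (memLp_one_iff_integrable.1 (hk 1)) (hk 2)]
  exact h1

/-- Deconvolution undoes the noise exactly on the band |u| ≤ 1/h; this is the only property of the
kernel that the mean needs. -/
theorem norm_deconvFT_mul_norm_charFn {g : ℝ → ℝ} {h : ℝ} (hh : 0 < h)
    (h0 : ∀ u, charFn g u ≠ 0) (ξ : ℝ) :
    ‖deconvFT g h ξ‖ * ‖charFn g (2 * Real.pi * ξ)‖ =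
      (Set.Icc (-(2 * Real.pi * h)⁻¹) (2 * Real.pi * h)⁻¹).indicator (fun _ => (1 : ℝ)) ξ := by
  rw [deconvFT_eq g hh]
  by_cases hm : ξ ∈ Set.Icc (-(2 * Real.pi * h)⁻¹) (2 * Real.pi * h)⁻¹
  · rw [Set.indicator_of_mem hm, Set.indicator_of_mem hm, norm_inv,
      inv_mul_cancel₀ (norm_ne_zero_iff.2 (h0 _))]
  · rw [Set.indicator_of_notMem hm, Set.indicator_of_notMem hm, norm_zero, zero_mul]

/-- Averaging over both observations produces |k|² |Φ^g|² |Φ|², where k is `deconvFT`, and the first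
two factors cancel on the band. Hence the mean of the estimator is a spectral cut-off of ∫ f². -/
theorem integral_integral_pairKernel {f g : ℝ → ℝ} {h : ℝ} (hf : IsDensity f)
    (hg : IsDensity g) (h0 : ∀ u, charFn g u ≠ 0)
    (hh : 0 < h) (hk : ∀ p, MemLp (deconvFT g h) p)
    (hk4 : ∀ p, MemLp (fun ξ => ((‖deconvFT g h ξ‖ ^ 2 : ℝ) : ℂ)) p) :
    ∫ x, ∫ t, pairKernel g h x t ∂(marginal f g) ∂(marginal f g) =
      ∫ ξ in Set.Icc (-(2 * Real.pi * h)⁻¹) (2 * Real.pi * h)⁻¹,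
        ‖charFn f (2 * Real.pi * ξ)‖ ^ 2 := by
  have := isProbabilityMeasure_marginal hf hg
  have h1 := integral_fourier_add_mul (memLp_one_iff_integrable.1
    (memLp_sq_mul_charFn hf hg (hk4 1))) (marginal f g) 0 1
  simp only [zero_add, one_mul, ← integral_pairKernel hf hg hh hk hk4,
    integral_exp_marginal hf hg] at h1
  rw [integral_complex_ofReal, Real.fourier_real_eq_integral_exp_smul] at h1
  rw [← integral_indicator measurableSet_Icc, ← Complex.ofReal_inj, h1, ← integral_complex_ofReal]
  refine integral_congr_ae (Eventually.of_forall fun ξ => ?_)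
  simp only [mul_zero, Complex.ofReal_zero, zero_mul, Complex.exp_zero, one_smul, charFn_neg]
  have e := norm_deconvFT_mul_norm_charFn hh h0 ξ
  have e2 : ((‖deconvFT g h ξ‖ ^ 2 : ℝ) : ℂ) *
      (charFn f (2 * Real.pi * ξ) * charFn g (2 * Real.pi * ξ)) *
      (conj (charFn f (2 * Real.pi * ξ)) * conj (charFn g (2 * Real.pi * ξ))) =
      (((‖deconvFT g h ξ‖ * ‖charFn g (2 * Real.pi * ξ)‖) ^ 2 *
        ‖charFn f (2 * Real.pi * ξ)‖ ^ 2 : ℝ) : ℂ) := by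
    push_cast
    rw [mul_pow, ← Complex.mul_conj' (charFn f _), ← Complex.mul_conj' (charFn g _)]
    ring
  rw [e2, e]
  by_cases hm : ξ ∈ Set.Icc (-(2 * Real.pi * h)⁻¹) (2 * Real.pi * h)⁻¹
  · rw [Set.indicator_of_mem hm, Set.indicator_of_mem hm]; simp
  · rw [Set.indicator_of_notMem hm, Set.indicator_of_notMem hm]; simp

/-- The law of Y is dominated by M times Lebesgue measure, after which Plancherel applies. One pair
of noise factors cancels, which reduces |k|⁴ |Φ^g|² to |k|². -/
theorem integral_sq_integral_pairKernel_le {f g : ℝ → ℝ} {h : ℝ} (hf : IsDensity f)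
    (hg : IsDensity g) (h0 : ∀ u, charFn g u ≠ 0) {M : ℝ≥0} (hM : ∀ᵐ x, g x ≤ M)
    (hh : 0 < h) (hk : ∀ p, MemLp (deconvFT g h) p)
    (hk4 : ∀ p, MemLp (fun ξ => ((‖deconvFT g h ξ‖ ^ 2 : ℝ) : ℂ)) p) :
    ∫ x, (∫ t, pairKernel g h x t ∂(marginal f g)) ^ 2 ∂(marginal f g) ≤
      M * ∫ ξ, ‖deconvFT g h ξ‖ ^ 2 * ‖charFn f (2 * Real.pi * ξ)‖ ^ 2 := by
  have hb := fun p => memLp_sq_mul_charFn hf hg (hk4 p)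
  have hbi := memLp_one_iff_integrable.1 (hb 1)
  have e : ∀ x, (∫ t, pairKernel g h x t ∂(marginal f g)) ^ 2 =
      ‖𝓕 (fun ξ : ℝ => ((‖deconvFT g h ξ‖ ^ 2 : ℝ) : ℂ) *
        (charFn f (2 * Real.pi * ξ) * charFn g (2 * Real.pi * ξ))) x‖ ^ 2 := fun x => by
    rw [← integral_pairKernel hf hg hh hk hk4, Complex.norm_real, Real.norm_eq_abs, sq_abs]
  simp only [e]
  have hF := (memLp_fourier hbi (hb 2)).integrable_norm_pow (p := 2) (by norm_num)
  refine (integral_mono_of_le_smul (marginal_le hf hg hM) (fun x => by positivity) hF).trans (le_of_eq ?_)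
  rw [integral_norm_sq_fourier hbi (hb 2)]
  congr 1
  refine integral_congr_ae (Eventually.of_forall fun ξ => ?_)
  simp only [norm_mul, Complex.norm_real, norm_pow, norm_norm]
  have e := norm_deconvFT_mul_norm_charFn hh h0 ξ
  calc (‖deconvFT g h ξ‖ ^ 2 * (‖charFn f (2 * Real.pi * ξ)‖ *
        ‖charFn g (2 * Real.pi * ξ)‖)) ^ 2 = (‖deconvFT g h ξ‖ *
        (‖deconvFT g h ξ‖ * ‖charFn g (2 * Real.pi * ξ)‖)) ^ 2 *
        ‖charFn f (2 * Real.pi * ξ)‖ ^ 2 := by ring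
    _ = ‖deconvFT g h ξ‖ ^ 2 * ‖charFn f (2 * Real.pi * ξ)‖ ^ 2 := by
        rw [e, deconvFT_eq g hh]
        by_cases hm : ξ ∈ Set.Icc (-(2 * Real.pi * h)⁻¹) (2 * Real.pi * h)⁻¹
        · rw [Set.indicator_of_mem hm, Set.indicator_of_mem hm, mul_one]
        · rw [Set.indicator_of_notMem hm, norm_zero, zero_mul]

theorem integral_integral_sq_pairKernel_le {f g : ℝ → ℝ} {h : ℝ} (hf : IsDensity f)
    (hg : IsDensity g) {M : ℝ≥0} (hM : ∀ᵐ x, g x ≤ M)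
    (hh : 0 < h) (hk : ∀ p, MemLp (deconvFT g h) p)
    (hk4 : ∀ p, MemLp (fun ξ => ((‖deconvFT g h ξ‖ ^ 2 : ℝ) : ℂ)) p) :
    ∫ x, ∫ t, pairKernel g h x t ^ 2 ∂(marginal f g) ∂(marginal f g) ≤
      M * ∫ ξ, ‖deconvFT g h ξ‖ ^ 4 := by
  have := isProbabilityMeasure_marginal hf hg
  have hki := memLp_one_iff_integrable.1 (hk4 1)
  have e : ∀ x t, pairKernel g h x t ^ 2 =
      ‖𝓕 (fun ξ : ℝ => ((‖deconvFT g h ξ‖ ^ 2 : ℝ) : ℂ)) (x - t)‖ ^ 2 := fun x t => by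
    rw [← pairKernel_eq_fourier hh (memLp_one_iff_integrable.1 (hk 1)) (hk 2), Complex.norm_real,
      Real.norm_eq_abs, sq_abs]
  simp only [e]
  have hF : Integrable fun t => ‖𝓕 (fun ξ : ℝ => ((‖deconvFT g h ξ‖ ^ 2 : ℝ) : ℂ)) t‖ ^ 2 :=
    (memLp_fourier hki (hk4 2)).integrable_norm_pow (by norm_num)
  have hx : ∀ x, ∫ t, ‖𝓕 (fun ξ : ℝ => ((‖deconvFT g h ξ‖ ^ 2 : ℝ) : ℂ)) (x - t)‖ ^ 2
      ∂(marginal f g) ≤ M * ∫ ξ, ‖deconvFT g h ξ‖ ^ 4 := by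
    intro x
    refine (integral_mono_of_le_smul (marginal_le hf hg hM) (fun x => sq_nonneg _)
      (hF.comp_sub_left x)).trans (le_of_eq ?_)
    rw [integral_sub_left_eq_self (fun t => ‖𝓕 (fun ξ : ℝ =>
      ((‖deconvFT g h ξ‖ ^ 2 : ℝ) : ℂ)) t‖ ^ 2) volume x, integral_norm_sq_fourier hki (hk4 2)]
    congr 1
    refine integral_congr_ae (Eventually.of_forall fun ξ => ?_)
    simp only [Complex.norm_real, norm_pow, norm_norm]
    ring
  refine (integral_mono_of_nonneg (Eventually.of_forall fun x => integral_nonneg fun t =>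
    sq_nonneg _) (integrable_const _) (Eventually.of_forall hx)).trans (le_of_eq ?_)
  simp

/-! ### The Sobolev ball in the Fourier domain -/

theorem sobolev_integrable {β L : ℝ} (hL : 0 < L) {f : ℝ → ℝ} (hf : f ∈ sobolevBall β L) :
    Integrable (fun ξ : ℝ => ‖charFn f (2 * Real.pi * ξ)‖ ^ 2 * |2 * Real.pi * ξ| ^ (2 * β)) ∧
      ∫ ξ : ℝ, ‖charFn f (2 * Real.pi * ξ)‖ ^ 2 * |2 * Real.pi * ξ| ^ (2 * β) ≤ L := by
  obtain ⟨hd, h2, hs⟩ := hf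
  have hpi : (0 : ℝ) < 2 * Real.pi := by positivity
  rw [lintegral_comp_two_pi_mul, ENNReal.ofReal_mul hpi.le] at hs
  have hs' := (ENNReal.mul_le_mul_iff_right (by simpa using hpi) ENNReal.ofReal_ne_top).1 hs
  have hm : AEStronglyMeasurable (fun ξ : ℝ => ‖charFn f (2 * Real.pi * ξ)‖ ^ 2 *
      |2 * Real.pi * ξ| ^ (2 * β)) volume := by
    have := (continuous_charFn hd.2.1).measurable
    exact (by fun_prop : Measurable _).aestronglyMeasurable
  have h0 : ∀ ξ : ℝ, 0 ≤ ‖charFn f (2 * Real.pi * ξ)‖ ^ 2 * |2 * Real.pi * ξ| ^ (2 * β) :=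
    fun ξ => by positivity
  refine ⟨⟨hm, ?_⟩, ?_⟩
  · rw [hasFiniteIntegral_iff_ofReal (Eventually.of_forall h0)]
    exact hs'.trans_lt ENNReal.ofReal_lt_top
  · rw [integral_eq_lintegral_of_nonneg_ae (Eventually.of_forall h0) hm]
    exact ENNReal.toReal_le_of_le_ofReal hL.le hs'

theorem integral_sq_eq_charFn {f : ℝ → ℝ} (hf : IsDensity f) (hf2 : MemLp f 2) :
    Integrable (fun ξ : ℝ => ‖charFn f (2 * Real.pi * ξ)‖ ^ 2) ∧
      ∫ x, f x ^ 2 = ∫ ξ : ℝ, ‖charFn f (2 * Real.pi * ξ)‖ ^ 2 := by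
  have hi : Integrable (fun x => (f x : ℂ)) := hf.2.1.ofReal
  have hi2 : MemLp (fun x => (f x : ℂ)) 2 := hf2.ofReal
  have h1 := integral_norm_sq_fourier hi hi2
  have h2 : Integrable fun x => ‖𝓕 (fun x => (f x : ℂ)) x‖ ^ 2 :=
    (memLp_fourier hi hi2).integrable_norm_pow (by norm_num)
  simp only [charFn_two_pi_mul]
  refine ⟨h2.comp_neg, ?_⟩
  rw [integral_neg_eq_self (fun x => ‖𝓕 (fun x => (f x : ℂ)) x‖ ^ 2), h1]
  simp

/-! ### The upper bound -/

theorem bandwidth_pos {β σ : ℝ} {n : ℕ} (hn : 1 ≤ n) : 0 < bandwidth β σ n :=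
  Real.rpow_pos_of_pos (by exact_mod_cast hn) _

theorem bandwidth_le_one {β σ : ℝ} (hβ : 0 < β) (hσ : 0 < σ) {n : ℕ} (hn : 1 ≤ n) :
    bandwidth β σ n ≤ 1 :=
  Real.rpow_le_one_of_one_le_of_nonpos (by exact_mod_cast hn)
    (div_nonpos_of_nonpos_of_nonneg (by norm_num) (by positivity))

theorem rate_eq_bandwidth_rpow (β σ : ℝ) (n : ℕ) :
    rate β σ n = bandwidth β σ n ^ (2 * β) := by
  rw [rate, bandwidth, ← Real.rpow_mul (Nat.cast_nonneg n)]
  congr 1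
  ring

theorem bandwidth_rpow_eq_inv {β σ : ℝ} (hβ : 0 < β) (hσ : 0 < σ) (n : ℕ) :
    bandwidth β σ n ^ ((4 * β + 4 * σ + 1) / 2) = (n : ℝ)⁻¹ := by
  rw [bandwidth, ← Real.rpow_mul (Nat.cast_nonneg n), ← Real.rpow_neg_one]
  congr 1
  field_simp

/-- Compares the noise weight with the Sobolev weight at A = 1 + |u|, where h to the power
(4β+4σ+1)/2 stands for 1/n. If σ ≤ β the weight A^(2σ) is already dominated, and (4β+4σ+1)/2 ≥ 4β is
exactly β ≤ σ + 1/4. If β ≤ σ the excess A^(2σ-2β) is at most a multiple of h^(2β-2σ), and a spare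
factor h^(1/2) remains. -/
theorem rpow_weight_le {β σ h A : ℝ} (hβ : 0 < β) (hσ : 0 < σ) (hβσ : β ≤ σ + 1 / 4)
    (hh : 0 < h) (hh1 : h ≤ 1) (hA : 1 ≤ A) (hA2 : A ≤ 2 / h) :
    h ^ ((4 * β + 4 * σ + 1) / 2) * A ^ (2 * σ) ≤
      2 ^ (2 * σ) * h ^ (4 * β) * A ^ (2 * β) := by
  have hA0 : 0 < A := by linarith
  have h2 : (1 : ℝ) ≤ 2 ^ (2 * σ) := Real.one_le_rpow (by norm_num) (by positivity)
  rcases le_total σ β with hc | hc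
  · have e1 : h ^ ((4 * β + 4 * σ + 1) / 2) ≤ h ^ (4 * β) :=
      Real.rpow_le_rpow_of_exponent_ge hh hh1 (by linarith)
    have e2 : A ^ (2 * σ) ≤ A ^ (2 * β) := Real.rpow_le_rpow_of_exponent_le hA (by linarith)
    calc h ^ ((4 * β + 4 * σ + 1) / 2) * A ^ (2 * σ) ≤ h ^ (4 * β) * A ^ (2 * β) := by gcongr
      _ ≤ 2 ^ (2 * σ) * (h ^ (4 * β) * A ^ (2 * β)) :=
          le_mul_of_one_le_left (by positivity) h2
      _ = _ := by ring
  · have e1 : A ^ (2 * σ) = A ^ (2 * σ - 2 * β) * A ^ (2 * β) := by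
      rw [← Real.rpow_add hA0]; congr 1; ring
    have e2 : A ^ (2 * σ - 2 * β) ≤ (2 / h) ^ (2 * σ - 2 * β) :=
      Real.rpow_le_rpow hA0.le hA2 (by linarith)
    have e3 : (2 / h) ^ (2 * σ - 2 * β) = 2 ^ (2 * σ - 2 * β) * h ^ (2 * β - 2 * σ) := by
      rw [Real.div_rpow (by norm_num) hh.le, div_eq_mul_inv, ← Real.rpow_neg hh.le]
      congr 2; ring
    have e4 : (2 : ℝ) ^ (2 * σ - 2 * β) ≤ 2 ^ (2 * σ) :=
      Real.rpow_le_rpow_of_exponent_le (by norm_num) (by linarith)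
    have e5 : h ^ ((4 * β + 4 * σ + 1) / 2) * h ^ (2 * β - 2 * σ) ≤ h ^ (4 * β) := by
      rw [← Real.rpow_add hh]
      exact Real.rpow_le_rpow_of_exponent_ge hh hh1 (by linarith)
    calc h ^ ((4 * β + 4 * σ + 1) / 2) * A ^ (2 * σ)
        ≤ h ^ ((4 * β + 4 * σ + 1) / 2) * ((2 ^ (2 * σ) * h ^ (2 * β - 2 * σ)) * A ^ (2 * β)) := by
          rw [e1]
          gcongr
          exact e2.trans (e3.le.trans (by gcongr))
      _ = 2 ^ (2 * σ) * (h ^ ((4 * β + 4 * σ + 1) / 2) * h ^ (2 * β - 2 * σ)) * A ^ (2 * β) := by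
          ring
      _ ≤ _ := by gcongr

/-- The Sobolev ball controls only the homogeneous weight t^(2β); low frequencies are paid for by
|Φ| ≤ 1 on t ≤ 1. -/
theorem sobolev_weight_le {β t φ : ℝ} (hβ : 0 < β) (ht : 0 ≤ t) (hφ : 0 ≤ φ) (hφ1 : φ ≤ 1) :
    (1 + t) ^ (2 * β) * φ ≤
      2 ^ (2 * β) * ((Set.Icc (-1 : ℝ) 1).indicator (fun _ => (1 : ℝ)) t + φ * t ^ (2 * β)) := by
  by_cases h : t ≤ 1
  · rw [Set.indicator_of_mem (show t ∈ Set.Icc (-1 : ℝ) 1 from ⟨by linarith, h⟩)]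
    have h1 : (1 + t) ^ (2 * β) ≤ 2 ^ (2 * β) :=
      Real.rpow_le_rpow (by linarith) (by linarith) (by linarith)
    have h2 : 0 ≤ φ * t ^ (2 * β) := by positivity
    calc (1 + t) ^ (2 * β) * φ ≤ 2 ^ (2 * β) * 1 := by gcongr
      _ ≤ _ := by gcongr; linarith
  · rw [Set.indicator_of_notMem (fun hm => h hm.2), zero_add]
    have h1 : (1 + t) ^ (2 * β) ≤ (2 * t) ^ (2 * β) :=
      Real.rpow_le_rpow (by linarith) (by linarith) (by linarith)
    rw [Real.mul_rpow (by norm_num) ht] at h1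
    calc (1 + t) ^ (2 * β) * φ ≤ 2 ^ (2 * β) * t ^ (2 * β) * φ := by gcongr
      _ = _ := by ring

theorem one_add_abs_le_of_mem {h ξ : ℝ} (hh : 0 < h) (hh1 : h ≤ 1)
    (hm : ξ ∈ Set.Icc (-(2 * Real.pi * h)⁻¹) (2 * Real.pi * h)⁻¹) :
    1 + |2 * Real.pi * ξ| ≤ 2 / h := by
  have hpi : (0 : ℝ) < 2 * Real.pi := by positivity
  have hu : |2 * Real.pi * ξ| ≤ 1 / h := by
    rw [Set.mem_Icc, ← abs_le] at hm
    rw [abs_mul, abs_of_pos hpi, le_div_iff₀ hh]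
    calc 2 * Real.pi * |ξ| * h = 2 * Real.pi * h * |ξ| := by ring
      _ ≤ 2 * Real.pi * h * (2 * Real.pi * h)⁻¹ := by gcongr
      _ = 1 := mul_inv_cancel₀ (by positivity)
  have : 1 ≤ 1 / h := by rwa [le_div_iff₀ hh, one_mul]
  have e : 2 / h = 1 / h + 1 / h := by ring
  rw [e]
  exact add_le_add this hu

theorem integral_norm_sq_deconvFT_mul_le {β L σ c : ℝ} {f g : ℝ → ℝ} (hβ : 0 < β)
    (hσ : 0 < σ) (hβσ : β ≤ σ + 1 / 4) (hL : 0 < L) (hf : f ∈ sobolevBall β L) (hc : 0 < c)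
    (hg : ∀ u, c * (1 + |u|) ^ (-σ) ≤ ‖charFn g u‖) {h : ℝ} (hh : 0 < h) (hh1 : h ≤ 1) :
    h ^ ((4 * β + 4 * σ + 1) / 2) *
      ∫ ξ, ‖deconvFT g h ξ‖ ^ 2 * ‖charFn f (2 * Real.pi * ξ)‖ ^ 2 ≤
      c⁻¹ ^ 2 * 2 ^ (2 * σ) * 2 ^ (2 * β) * (1 + L) * h ^ (4 * β) := by
  obtain ⟨hSi, hSL⟩ := sobolev_integrable hL hf
  have hpi : (0 : ℝ) < 2 * Real.pi := by positivity
  set K := c⁻¹ ^ 2 * 2 ^ (2 * σ) * 2 ^ (2 * β) * h ^ (4 * β) with hK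
  have hK0 : 0 ≤ K := by positivity
  have hind : ∀ ξ : ℝ, (Set.Icc (-1 : ℝ) 1).indicator (fun _ => (1 : ℝ)) |2 * Real.pi * ξ| =
      (Set.Icc (-(2 * Real.pi)⁻¹) (2 * Real.pi)⁻¹).indicator (fun _ => (1 : ℝ)) ξ := by
    intro ξ
    have : |2 * Real.pi * ξ| ∈ Set.Icc (-1 : ℝ) 1 ↔
        ξ ∈ Set.Icc (-(2 * Real.pi)⁻¹) (2 * Real.pi)⁻¹ := by
      rw [Set.mem_Icc, Set.mem_Icc, ← abs_le, ← abs_le, abs_abs, abs_mul, abs_of_pos hpi,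
        ← one_div, le_div_iff₀ hpi, mul_comm]
    simp only [Set.indicator, this]
  have hI1 : Integrable ((Set.Icc (-(2 * Real.pi)⁻¹) (2 * Real.pi)⁻¹).indicator
      (fun _ => (1 : ℝ))) := (integrable_indicator_iff measurableSet_Icc).2
        (integrableOn_const (by simp) (by simp))
  have hpt : ∀ ξ, h ^ ((4 * β + 4 * σ + 1) / 2) *
      (‖deconvFT g h ξ‖ ^ 2 * ‖charFn f (2 * Real.pi * ξ)‖ ^ 2) ≤
      K * ((Set.Icc (-(2 * Real.pi)⁻¹) (2 * Real.pi)⁻¹).indicator (fun _ => (1 : ℝ)) ξ +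
        ‖charFn f (2 * Real.pi * ξ)‖ ^ 2 * |2 * Real.pi * ξ| ^ (2 * β)) := by
    intro ξ
    have hr0 : 0 ≤ (Set.Icc (-(2 * Real.pi)⁻¹) (2 * Real.pi)⁻¹).indicator (fun _ => (1 : ℝ)) ξ +
        ‖charFn f (2 * Real.pi * ξ)‖ ^ 2 * |2 * Real.pi * ξ| ^ (2 * β) :=
      add_nonneg (Set.indicator_nonneg (fun _ _ => zero_le_one) _) (by positivity)
    rw [deconvFT_eq g hh]
    by_cases hm : ξ ∈ Set.Icc (-(2 * Real.pi * h)⁻¹) (2 * Real.pi * h)⁻¹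
    · rw [Set.indicator_of_mem hm, norm_inv]
      set A := 1 + |2 * Real.pi * ξ| with hAdef
      have hA1 : 1 ≤ A := by simp [hAdef]
      have hA0 : 0 < A := by linarith
      have hA2 := one_add_abs_le_of_mem hh hh1 hm
      have hw := sobolev_weight_le hβ (abs_nonneg (2 * Real.pi * ξ))
        (sq_nonneg ‖charFn f (2 * Real.pi * ξ)‖)
        (pow_le_one₀ (norm_nonneg _) (norm_charFn_le_one hf.1 (2 * Real.pi * ξ)))
      rw [hind] at hw
      have hinv : ‖charFn g (2 * Real.pi * ξ)‖⁻¹ ≤ c⁻¹ * A ^ σ := by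
        calc ‖charFn g (2 * Real.pi * ξ)‖⁻¹ ≤ (c * A ^ (-σ))⁻¹ :=
              inv_anti₀ (by positivity) (hg _)
          _ = c⁻¹ * A ^ σ := by rw [mul_inv, Real.rpow_neg hA0.le, inv_inv]
      have e : (A ^ σ) ^ 2 = A ^ (2 * σ) := by
        rw [← Real.rpow_natCast, ← Real.rpow_mul hA0.le]; congr 1; push_cast; ring
      calc h ^ ((4 * β + 4 * σ + 1) / 2) *
          (‖charFn g (2 * Real.pi * ξ)‖⁻¹ ^ 2 * ‖charFn f (2 * Real.pi * ξ)‖ ^ 2)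
          ≤ h ^ ((4 * β + 4 * σ + 1) / 2) *
          ((c⁻¹ * A ^ σ) ^ 2 * ‖charFn f (2 * Real.pi * ξ)‖ ^ 2) := by gcongr
        _ = c⁻¹ ^ 2 * (h ^ ((4 * β + 4 * σ + 1) / 2) * A ^ (2 * σ)) *
          ‖charFn f (2 * Real.pi * ξ)‖ ^ 2 := by rw [mul_pow, e]; ring
        _ ≤ c⁻¹ ^ 2 * (2 ^ (2 * σ) * h ^ (4 * β) * A ^ (2 * β)) *
          ‖charFn f (2 * Real.pi * ξ)‖ ^ 2 := by
            gcongr ?_ * ?_ * ?_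
            exact rpow_weight_le hβ hσ hβσ hh hh1 hA1 hA2
        _ = c⁻¹ ^ 2 * 2 ^ (2 * σ) * h ^ (4 * β) * (A ^ (2 * β) *
          ‖charFn f (2 * Real.pi * ξ)‖ ^ 2) := by ring
        _ ≤ c⁻¹ ^ 2 * 2 ^ (2 * σ) * h ^ (4 * β) * (2 ^ (2 * β) *
          ((Set.Icc (-(2 * Real.pi)⁻¹) (2 * Real.pi)⁻¹).indicator (fun _ => (1 : ℝ)) ξ +
          ‖charFn f (2 * Real.pi * ξ)‖ ^ 2 * |2 * Real.pi * ξ| ^ (2 * β))) := by gcongr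
        _ = _ := by rw [hK]; ring
    · rw [Set.indicator_of_notMem hm, norm_zero]
      simp only [ne_eq, OfNat.ofNat_ne_zero, not_false_eq_true, zero_pow, zero_mul, mul_zero]
      exact mul_nonneg hK0 hr0
  rw [← integral_const_mul]
  calc ∫ ξ, h ^ ((4 * β + 4 * σ + 1) / 2) *
        (‖deconvFT g h ξ‖ ^ 2 * ‖charFn f (2 * Real.pi * ξ)‖ ^ 2)
      ≤ ∫ ξ, K * ((Set.Icc (-(2 * Real.pi)⁻¹) (2 * Real.pi)⁻¹).indicator (fun _ => (1 : ℝ)) ξ +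
        ‖charFn f (2 * Real.pi * ξ)‖ ^ 2 * |2 * Real.pi * ξ| ^ (2 * β)) :=
        integral_mono_of_nonneg (Eventually.of_forall fun ξ => by positivity)
          ((hI1.add hSi).const_mul K) (Eventually.of_forall hpt)
    _ ≤ K * (1 + L) := by
        rw [integral_const_mul, integral_add hI1 hSi, integral_indicator measurableSet_Icc]
        refine mul_le_mul_of_nonneg_left (add_le_add ?_ hSL) hK0
        rw [integral_const, smul_eq_mul, mul_one, measureReal_restrict_apply_univ,
          Real.volume_real_Icc_of_le (by linarith [inv_pos.2 hpi])]
        have : (2 * Real.pi)⁻¹ ≤ 2⁻¹ := inv_anti₀ (by norm_num) (by linarith [Real.pi_gt_three])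
        linarith
    _ = _ := by rw [hK]; ring

/-- The integrand is at most a constant times h^(-4σ) on an interval of length at most 1/h. -/
theorem integral_norm_pow_four_deconvFT_le {σ c : ℝ} {g : ℝ → ℝ} (hσ : 0 < σ) (hc : 0 < c)
    (hg : ∀ u, c * (1 + |u|) ^ (-σ) ≤ ‖charFn g u‖) {h : ℝ} (hh : 0 < h) (hh1 : h ≤ 1) :
    ∫ ξ, ‖deconvFT g h ξ‖ ^ 4 ≤ c⁻¹ ^ 4 * 2 ^ (4 * σ) * h ^ (-(4 * σ + 1)) := by
  have hpi : (0 : ℝ) < 2 * Real.pi * h := by positivity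
  have hpt : ∀ ξ, ‖deconvFT g h ξ‖ ^ 4 ≤ (Set.Icc (-(2 * Real.pi * h)⁻¹)
      (2 * Real.pi * h)⁻¹).indicator (fun _ => (c⁻¹ * (2 / h) ^ σ) ^ 4) ξ := by
    intro ξ
    refine (pow_le_pow_left₀ (norm_nonneg _) (norm_deconvFT_le hσ.le hc hg hh hh1 ξ) 4).trans
      (le_of_eq ?_)
    by_cases hm : ξ ∈ Set.Icc (-(2 * Real.pi * h)⁻¹) (2 * Real.pi * h)⁻¹
    · rw [Set.indicator_of_mem hm, Set.indicator_of_mem hm]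
    · rw [Set.indicator_of_notMem hm, Set.indicator_of_notMem hm]; simp
  refine (integral_mono_of_nonneg (Eventually.of_forall fun ξ => by positivity)
    ((integrable_indicator_iff measurableSet_Icc).2 (integrableOn_const (by simp) enorm_ne_top))
    (Eventually.of_forall hpt)).trans ?_
  rw [integral_indicator measurableSet_Icc, integral_const, smul_eq_mul,
    measureReal_restrict_apply_univ, Real.volume_real_Icc_of_le (by linarith [inv_pos.2 hpi])]
  have e1 : (2 * Real.pi * h)⁻¹ - -(2 * Real.pi * h)⁻¹ ≤ h⁻¹ := by
    rw [mul_inv, sub_neg_eq_add, ← two_mul, ← mul_assoc]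
    refine mul_le_of_le_one_left (inv_nonneg.2 hh.le) ?_
    rw [mul_inv, mul_inv_cancel_left₀ two_ne_zero]
    exact inv_le_one_of_one_le₀ (by linarith [Real.pi_gt_three])
  have e2 : ((2 / h) ^ σ) ^ 4 = 2 ^ (4 * σ) * h ^ (-(4 * σ)) := by
    rw [← Real.rpow_natCast, ← Real.rpow_mul (by positivity), Real.div_rpow (by norm_num) hh.le,
      Real.rpow_neg hh.le, div_eq_mul_inv]
    push_cast
    rw [mul_comm σ]
  have e3 : h ^ (-(4 * σ + 1)) = h⁻¹ * h ^ (-(4 * σ)) := by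
    rw [← Real.rpow_neg_one, ← Real.rpow_add hh]; congr 1; ring
  calc _ ≤ h⁻¹ * (c⁻¹ * (2 / h) ^ σ) ^ 4 := by gcongr
    _ = _ := by rw [mul_pow, e2, e3]; ring

/-- The discarded frequencies satisfy h |u| ≥ 1, so there the factor (h |u|)^(2β) may be inserted
for free. -/
theorem bias_le {β L : ℝ} {f : ℝ → ℝ} (hβ : 0 < β) (hL : 0 < L) (hf : f ∈ sobolevBall β L)
    {h : ℝ} (hh : 0 < h) :
    |(∫ ξ in Set.Icc (-(2 * Real.pi * h)⁻¹) (2 * Real.pi * h)⁻¹,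
      ‖charFn f (2 * Real.pi * ξ)‖ ^ 2) - ∫ x, f x ^ 2| ≤ L * h ^ (2 * β) := by
  obtain ⟨hSi, hSL⟩ := sobolev_integrable hL hf
  obtain ⟨hi, he⟩ := integral_sq_eq_charFn hf.1 hf.2.1
  have hpi : (0 : ℝ) < 2 * Real.pi := by positivity
  rw [he, ← integral_add_compl measurableSet_Icc hi, sub_add_cancel_left, abs_neg,
    abs_of_nonneg (integral_nonneg fun ξ => by positivity),
    ← integral_indicator measurableSet_Icc.compl]
  calc ∫ ξ, (Set.Icc (-(2 * Real.pi * h)⁻¹) (2 * Real.pi * h)⁻¹)ᶜ.indicator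
        (fun ξ => ‖charFn f (2 * Real.pi * ξ)‖ ^ 2) ξ
      ≤ ∫ ξ, h ^ (2 * β) *
        (‖charFn f (2 * Real.pi * ξ)‖ ^ 2 * |2 * Real.pi * ξ| ^ (2 * β)) := by
        refine integral_mono_of_nonneg (Eventually.of_forall fun ξ =>
          Set.indicator_nonneg (fun _ _ => by positivity) _) (hSi.const_mul _)
          (Eventually.of_forall fun ξ => ?_)
        by_cases hm : ξ ∈ Set.Icc (-(2 * Real.pi * h)⁻¹) (2 * Real.pi * h)⁻¹
        · rw [Set.indicator_of_notMem (Set.notMem_compl_iff.2 hm)]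
          positivity
        · rw [Set.indicator_of_mem hm]
          rw [Set.mem_Icc, ← abs_le, not_le] at hm
          have h1 : 1 ≤ h * |2 * Real.pi * ξ| := by
            rw [abs_mul, abs_of_pos hpi]
            calc 1 = 2 * Real.pi * h * (2 * Real.pi * h)⁻¹ := by
                  rw [mul_inv_cancel₀]; positivity
              _ ≤ 2 * Real.pi * h * |ξ| := by gcongr
              _ = _ := by ring
          have h2 : 1 ≤ h ^ (2 * β) * |2 * Real.pi * ξ| ^ (2 * β) := by
            rw [← Real.mul_rpow hh.le (abs_nonneg _)]
            exact Real.one_le_rpow h1 (by linarith)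
          calc ‖charFn f (2 * Real.pi * ξ)‖ ^ 2 ≤ (h ^ (2 * β) * |2 * Real.pi * ξ| ^ (2 * β)) *
                ‖charFn f (2 * Real.pi * ξ)‖ ^ 2 := le_mul_of_one_le_left (by positivity) h2
            _ = _ := by ring
    _ ≤ L * h ^ (2 * β) := by
        rw [integral_const_mul, mul_comm L]
        gcongr

theorem attainsRate_estimator {β L σ : ℝ} {g : ℝ → ℝ} (hβ : 0 < β) (hβσ : β ≤ σ + 1 / 4)
    (hL : 0 < L) (hg : IsPolynomialNoise σ g) :
    AttainsRate (sobolevBall β L) g (fun n => estimator g (bandwidth β σ n) n) (rate β σ) := by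
  obtain ⟨c, C, hc, -, hcC⟩ := hg.exists_bounds
  obtain ⟨M, hM⟩ := hg.exists_ae_le
  have hglow := fun u => (hcC u).1
  have hσ : 0 < σ := by linarith [hg.2.2.1]
  have hkm : ∀ n : ℕ, 1 ≤ n → ∀ p, MemLp (deconvFT g (bandwidth β σ n)) p := fun n hn p =>
    memLp_of_bounded_indicator (measurable_deconvFT hg.1.2.1 (bandwidth_pos hn))
      (norm_deconvFT_le hσ.le hc hglow (bandwidth_pos hn) (bandwidth_le_one hβ hσ hn)) p
  have hkm4 : ∀ n : ℕ, 1 ≤ n → ∀ p,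
      MemLp (fun ξ => ((‖deconvFT g (bandwidth β σ n) ξ‖ ^ 2 : ℝ) : ℂ)) p := fun n hn p => by
    refine memLp_of_bounded_indicator (B := (c⁻¹ * (2 / bandwidth β σ n) ^ σ) ^ 2)
      (R := (2 * Real.pi * bandwidth β σ n)⁻¹)
      (((measurable_deconvFT hg.1.2.1 (bandwidth_pos hn)).norm.pow_const 2).complex_ofReal)
      (fun ξ => ?_) p
    rw [Complex.norm_real, norm_pow, norm_norm]
    refine (pow_le_pow_left₀ (norm_nonneg _) (norm_deconvFT_le hσ.le hc hglow
      (bandwidth_pos hn) (bandwidth_le_one hβ hσ hn) ξ) 2).trans (le_of_eq ?_)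
    by_cases hm : ξ ∈ Set.Icc (-(2 * Real.pi * bandwidth β σ n)⁻¹)
        (2 * Real.pi * bandwidth β σ n)⁻¹
    · rw [Set.indicator_of_mem hm, Set.indicator_of_mem hm]
    · rw [Set.indicator_of_notMem hm, Set.indicator_of_notMem hm]; simp
  have hWeq : ∀ n : ℕ, 1 ≤ n → ∀ a b, pairKernel g (bandwidth β σ n) a b =
      (𝓕 (fun ξ => ((‖deconvFT g (bandwidth β σ n) ξ‖ ^ 2 : ℝ) : ℂ)) (a - b)).re :=
    fun n hn a b => by
      rw [← pairKernel_eq_fourier (bandwidth_pos hn)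
        (memLp_one_iff_integrable.1 (hkm n hn 1)) (hkm n hn 2), Complex.ofReal_re]
  have hWm : ∀ n : ℕ, 1 ≤ n →
      Measurable (Function.uncurry (pairKernel g (bandwidth β σ n))) := fun n hn => by
    have e : Function.uncurry (pairKernel g (bandwidth β σ n)) = fun p : ℝ × ℝ =>
        (𝓕 (fun ξ => ((‖deconvFT g (bandwidth β σ n) ξ‖ ^ 2 : ℝ) : ℂ)) (p.1 - p.2)).re :=
      funext fun p => hWeq n hn p.1 p.2
    rw [e]
    exact (Complex.continuous_re.comp ((continuous_fourier
      (memLp_one_iff_integrable.1 (hkm4 n hn 1))).comp (by fun_prop))).measurable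
  have hest : ∀ n y, estimator g (bandwidth β σ n) n y = 1 / ((n : ℝ) * (n - 1)) *
      ∑ q ∈ (Finset.univ : Finset (Fin n)).offDiag,
        pairKernel g (bandwidth β σ n) (y q.1) (y q.2) := fun n y => rfl
  have hmeas : ∀ n, Measurable (estimator g (bandwidth β σ n) n) := by
    intro n
    -- For n = 0 the bandwidth need not be positive, but the sample space is a single point.
    rcases Nat.eq_zero_or_pos n with rfl | hn
    · exact Measurable.of_discrete
    · rw [funext (hest n)]
      exact (Finset.measurable_sum _ fun q _ =>
        measurable_uncurry_eval (hWm n hn) q.1 q.2).const_mul _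
  refine ⟨hmeas, ?_⟩
  set C₀ : ℝ := 56 * (M * (c⁻¹ ^ 2 * 2 ^ (2 * σ) * 2 ^ (2 * β) * (1 + L))) +
    32 * (M * (c⁻¹ ^ 4 * 2 ^ (4 * σ))) with hC₀
  have hC₀0 : 0 ≤ C₀ := by positivity
  -- Bias plus standard deviation, both in units of h^(2β).
  refine ⟨L + Real.sqrt C₀, by positivity, limsup_le_of_le (by isBoundedDefault) ?_⟩
  filter_upwards [eventually_ge_atTop 2] with n hn
  refine iSup₂_le fun f hf => ?_
  have hn1 : 1 ≤ n := by omega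
  set h := bandwidth β σ n with hh_def
  have hh : 0 < h := bandwidth_pos hn1
  have hh1 : h ≤ 1 := bandwidth_le_one hβ hσ hn1
  have hprob := isProbabilityMeasure_marginal hf.1 hg.1
  have hrate : rate β σ n = h ^ (2 * β) := rate_eq_bandwidth_rpow β σ n
  have hrate0 : 0 < rate β σ n := by rw [hrate]; positivity
  have hB : ∀ x t, |pairKernel g h x t| ≤ ∫ ξ, ‖((‖deconvFT g h ξ‖ ^ 2 : ℝ) : ℂ)‖ :=
    fun x t => by
      rw [hWeq n hn1]
      exact (Complex.abs_re_le_norm _).trans (norm_fourier_le _ _)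
  have hvar := integral_sq_uStatistic_sub_le hn (marginal f g) (hWm n hn1) hB
    (pairKernel_symm g h)
  set θ := ∫ x, ∫ t, pairKernel g h x t ∂(marginal f g) ∂(marginal f g) with hθ
  have hbias : |θ - ∫ x, f x ^ 2| ≤ L * h ^ (2 * β) := by
    rw [hθ, integral_integral_pairKernel hf.1 hg.1 hg.2.1 hh (hkm n hn1) (hkm4 n hn1)]
    exact bias_le hβ hL hf hh
  have hV := integral_sq_integral_pairKernel_le hf.1 hg.1 hg.2.1 hM hh (hkm n hn1) (hkm4 n hn1)
  have hE := integral_integral_sq_pairKernel_le hf.1 hg.1 hM hh (hkm n hn1) (hkm4 n hn1)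
  have hV2 := integral_norm_sq_deconvFT_mul_le hβ hσ hβσ hL hf hc hglow hh hh1
  have hE2 := integral_norm_pow_four_deconvFT_le hσ hc hglow hh hh1
  have hninv : h ^ ((4 * β + 4 * σ + 1) / 2) = (n : ℝ)⁻¹ := bandwidth_rpow_eq_inv hβ hσ n
  have hn2inv : (n : ℝ)⁻¹ ^ 2 * h ^ (-(4 * σ + 1)) = h ^ (4 * β) := by
    rw [← hninv, ← Real.rpow_natCast, ← Real.rpow_mul hh.le, ← Real.rpow_add hh]
    congr 1; push_cast; ring
  have hsq : ∫ y, (estimator g h n y - θ) ^ 2 ∂(obsLaw f g n) ≤ C₀ * h ^ (4 * β) := by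
    refine hvar.trans ?_
    calc _ ≤ 56 / n * (M * ∫ ξ, ‖deconvFT g h ξ‖ ^ 2 * ‖charFn f (2 * Real.pi * ξ)‖ ^ 2) +
          32 / n ^ 2 * (M * (c⁻¹ ^ 4 * 2 ^ (4 * σ) * h ^ (-(4 * σ + 1)))) := by
          refine add_le_add (mul_le_mul_of_nonneg_left hV (by positivity))
            (mul_le_mul_of_nonneg_left (hE.trans ?_) (by positivity))
          exact mul_le_mul_of_nonneg_left hE2 M.2
      _ = 56 * (M * (h ^ ((4 * β + 4 * σ + 1) / 2) *
            ∫ ξ, ‖deconvFT g h ξ‖ ^ 2 * ‖charFn f (2 * Real.pi * ξ)‖ ^ 2)) +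
          32 * (M * (c⁻¹ ^ 4 * 2 ^ (4 * σ))) * ((n : ℝ)⁻¹ ^ 2 * h ^ (-(4 * σ + 1))) := by
          rw [hninv]; ring
      _ ≤ 56 * (M * (c⁻¹ ^ 2 * 2 ^ (2 * σ) * 2 ^ (2 * β) * (1 + L) * h ^ (4 * β))) +
          32 * (M * (c⁻¹ ^ 4 * 2 ^ (4 * σ))) * h ^ (4 * β) := by
          rw [hn2inv]
          gcongr
      _ = C₀ * h ^ (4 * β) := by rw [hC₀]; ring
  have hobs : obsLaw f g n = Measure.pi fun _ => marginal f g := rfl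
  have hprob' : IsProbabilityMeasure (obsLaw f g n) := by rw [hobs]; infer_instance
  set X : (Fin n → ℝ) → ℝ := fun y => estimator g h n y - θ with hX
  have hXm : Measurable X := (hmeas n).sub_const θ
  have hXb : ∃ B, ∀ y, ‖X y‖ ≤ B := by
    refine ⟨|1 / ((n : ℝ) * (n - 1))| * ((Finset.univ : Finset (Fin n)).offDiag.card *
      ∫ ξ, ‖((‖deconvFT g h ξ‖ ^ 2 : ℝ) : ℂ)‖) + |θ|, fun y => ?_⟩
    refine (norm_sub_le _ _).trans (add_le_add ?_ le_rfl)
    rw [hest, norm_mul, Real.norm_eq_abs]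
    refine mul_le_mul_of_nonneg_left ((norm_sum_le _ _).trans ?_) (abs_nonneg _)
    exact (Finset.sum_le_card_nsmul _ _ _ fun q _ => hB _ _).trans (by simp)
  obtain ⟨B, hXB⟩ := hXb
  have hX2 : MemLp X 2 (obsLaw f g n) := MemLp.of_bound hXm.aestronglyMeasurable B
    (Eventually.of_forall hXB)
  have hXi : Integrable X (obsLaw f g n) := hX2.integrable (by norm_num)
  -- Passage from the second to the first absolute moment, by non-negativity of the variance of |X|.
  have habs : ∫ y, |X y| ∂(obsLaw f g n) ≤ Real.sqrt C₀ * h ^ (2 * β) := by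
    have h1 := integral_sub_integral_sq (μ := obsLaw f g n) hXm.abs
      (B := B) (fun y => by rw [abs_abs]; exact hXB y)
    have h2 : 0 ≤ ∫ y, (|X y| - ∫ t, |X t| ∂(obsLaw f g n)) ^ 2 ∂(obsLaw f g n) :=
      integral_nonneg fun _ => sq_nonneg _
    simp only [sq_abs] at h1
    refine abs_le_of_sq_le_sq' ?_ (by positivity) |>.2
    have e : (h ^ (2 * β)) ^ 2 = h ^ (4 * β) := by
      rw [← Real.rpow_natCast, ← Real.rpow_mul hh.le]
      congr 1; push_cast; ring
    rw [mul_pow, Real.sq_sqrt hC₀0, e]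
    have h3 : ∫ y, X y ^ 2 ∂(obsLaw f g n) ≤ C₀ * h ^ (4 * β) := hsq
    linarith
  have hrisk : risk f g n (estimator g h n) ≤
      ENNReal.ofReal ((L + Real.sqrt C₀) * h ^ (2 * β)) := by
    unfold risk
    calc ∫⁻ y, ENNReal.ofReal |estimator g h n y - ∫ x, f x ^ 2| ∂(obsLaw f g n)
        ≤ ∫⁻ y, ENNReal.ofReal (|X y| + L * h ^ (2 * β)) ∂(obsLaw f g n) := by
          refine lintegral_mono fun y => ENNReal.ofReal_le_ofReal ?_
          calc |estimator g h n y - ∫ x, f x ^ 2| ≤ |estimator g h n y - θ| +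
                |θ - ∫ x, f x ^ 2| := abs_sub_le _ _ _
            _ ≤ _ := add_le_add le_rfl hbias
      _ = ENNReal.ofReal (∫ y, (|X y| + L * h ^ (2 * β)) ∂(obsLaw f g n)) :=
          (ofReal_integral_eq_lintegral_ofReal (hXi.abs.add (integrable_const _))
            (Eventually.of_forall fun y =>
              add_nonneg (abs_nonneg _) (by positivity : 0 ≤ L * h ^ (2 * β)))).symm
      _ ≤ _ := by
          refine ENNReal.ofReal_le_ofReal ?_
          rw [integral_add hXi.abs (integrable_const _)]
          simp only [integral_const, probReal_univ, one_smul]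
          linarith
  calc (ENNReal.ofReal (rate β σ n))⁻¹ * risk f g n (estimator g h n)
      ≤ (ENNReal.ofReal (rate β σ n))⁻¹ * ENNReal.ofReal ((L + Real.sqrt C₀) * h ^ (2 * β)) := by
        gcongr
    _ = ENNReal.ofReal (L + Real.sqrt C₀) := by
        rw [← hrate, ← ENNReal.ofReal_inv_of_pos hrate0,
          ← ENNReal.ofReal_mul (inv_nonneg.2 hrate0.le)]
        congr 1
        field_simp

/-! ### Testing a point against a finite mixture -/

theorem pi_withDensity_ofReal {n : ℕ} (μ : Measure ℝ) [IsProbabilityMeasure μ] {ρ : ℝ → ℝ}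
    (hρ : Measurable ρ) {B : ℝ} (h0 : ∀ x, 0 ≤ ρ x) (hB : ∀ x, ρ x ≤ B) :
    Measure.pi (fun _ : Fin n => μ.withDensity fun x => ENNReal.ofReal (ρ x)) =
      (Measure.pi fun _ => μ).withDensity fun y => ENNReal.ofReal (∏ i, ρ (y i)) := by
  have hi : Integrable ρ μ := Integrable.of_bound hρ.aestronglyMeasurable B
    (Eventually.of_forall fun x => by rw [Real.norm_eq_abs, abs_of_nonneg (h0 x)]; exact hB x)
  have : IsFiniteMeasure (μ.withDensity fun x => ENNReal.ofReal (ρ x)) :=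
    isFiniteMeasure_withDensity_ofReal hi.2
  refine Measure.pi_eq fun s hs => ?_
  have hpm : Measurable fun y : Fin n → ℝ => ∏ i, ρ (y i) :=
    Finset.measurable_prod _ fun i _ => hρ.comp (measurable_pi_apply i)
  rw [withDensity_apply _ (MeasurableSet.univ_pi hs), ← lintegral_indicator
    (MeasurableSet.univ_pi hs)]
  have e1 : ∀ y : Fin n → ℝ, (Set.univ.pi s).indicator
      (fun y => ENNReal.ofReal (∏ i, ρ (y i))) y =
      ENNReal.ofReal (∏ i, (s i).indicator ρ (y i)) := by
    intro y
    by_cases hy : y ∈ Set.univ.pi s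
    · rw [Set.indicator_of_mem hy]
      congr 1
      exact Finset.prod_congr rfl fun i _ => (Set.indicator_of_mem (hy i (Set.mem_univ i)) _).symm
    · rw [Set.indicator_of_notMem hy]
      simp only [Set.mem_pi, Set.mem_univ, true_implies, not_forall] at hy
      obtain ⟨i, hi⟩ := hy
      rw [Finset.prod_eq_zero (Finset.mem_univ i) (Set.indicator_of_notMem hi _),
        ENNReal.ofReal_zero]
  have hind : ∀ i x, 0 ≤ (s i).indicator ρ x := fun i x =>
    Set.indicator_nonneg (fun x _ => h0 x) x
  have hint : Integrable (fun y : Fin n → ℝ => ∏ i, (s i).indicator ρ (y i))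
      (Measure.pi fun _ => μ) :=
    Integrable.fintype_prod fun i => hi.indicator (hs i)
  simp only [e1]
  rw [← ofReal_integral_eq_lintegral_ofReal hint
    (Eventually.of_forall fun y => Finset.prod_nonneg fun i _ => hind i _),
    integral_fintype_prod_eq_prod (f := fun i => (s i).indicator ρ),
    ENNReal.ofReal_prod_of_nonneg fun i _ => integral_nonneg (hind i)]
  refine Finset.prod_congr rfl fun i _ => ?_
  rw [withDensity_apply _ (hs i), integral_indicator (hs i),
    ofReal_integral_eq_lintegral_ofReal hi.integrableOn (Eventually.of_forall h0)]

/-- The estimator is turned into a test of d₀ against the mixture, with threshold d₀ + s. By Markov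
both error probabilities are at most R/s, so the rejection region has small mass under P and large
mass under the mixture. A likelihood ratio with bounded second moment forbids this unless R is
comparable to s. -/
theorem le_risk_of_mixture {Ω Θ : Type*} [MeasurableSpace Ω] (P : Measure Ω)
    [IsProbabilityMeasure P] [Fintype Θ] [Nonempty Θ] {ℓ : Θ → Ω → ℝ}
    (hm : ∀ θ, Measurable (ℓ θ)) {B : ℝ} (h0 : ∀ θ y, 0 ≤ ℓ θ y) (hB : ∀ θ y, ℓ θ y ≤ B)
    (h1 : ∀ θ, ∫ y, ℓ θ y ∂P = 1) {K : ℝ} (hK1 : 1 ≤ K)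
    (hK : ∑ θ, ∑ θ', ∫ y, ℓ θ y * ℓ θ' y ∂P ≤ K * (Fintype.card Θ : ℝ) ^ 2)
    {δ : Ω → ℝ} (hδ : Measurable δ) {d₀ s R : ℝ} {d : Θ → ℝ} (hs : 0 < s) (hR : 0 ≤ R)
    (hd : ∀ θ, d₀ + 2 * s ≤ d θ)
    (hR0 : ∫⁻ y, ENNReal.ofReal |δ y - d₀| ∂P ≤ ENNReal.ofReal R)
    (hR1 : ∀ θ, ∫⁻ y, ENNReal.ofReal |δ y - d θ| ∂(P.withDensity fun y => ENNReal.ofReal (ℓ θ y))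
      ≤ ENNReal.ofReal R) :
    s / (4 * K) ≤ R := by
  set A : Set Ω := {y | d₀ + s ≤ δ y} with hA
  have hAm : MeasurableSet A := measurableSet_le measurable_const hδ
  have hi : ∀ θ, Integrable (ℓ θ) P := fun θ => Integrable.of_bound (hm θ).aestronglyMeasurable B
    (Eventually.of_forall fun x => by
      rw [Real.norm_eq_abs, abs_of_nonneg (h0 θ x)]; exact hB θ x)
  have hmark : ∀ (Q : Measure Ω) (t : ℝ) (D : Set Ω), MeasurableSet D →
      (∀ y ∈ D, s ≤ |δ y - t|) → ∫⁻ y, ENNReal.ofReal |δ y - t| ∂Q ≤ ENNReal.ofReal R →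
      ENNReal.ofReal s * Q D ≤ ENNReal.ofReal R := by
    intro Q t D hD hsD hQ
    refine le_trans ?_ hQ
    calc ENNReal.ofReal s * Q D = ∫⁻ y in D, ENNReal.ofReal s ∂Q := by
          rw [setLIntegral_const]
      _ ≤ ∫⁻ y in D, ENNReal.ofReal |δ y - t| ∂Q :=
          setLIntegral_mono' hD fun y hy => ENNReal.ofReal_le_ofReal (hsD y hy)
      _ ≤ ∫⁻ y, ENNReal.ofReal |δ y - t| ∂Q := setLIntegral_le_lintegral _ _
  have hp : s * P.real A ≤ R := by
    have := hmark P d₀ A hAm (fun y hy => by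
      have hy' : d₀ + s ≤ δ y := hy
      exact (by linarith : s ≤ δ y - d₀).trans (le_abs_self _)) hR0
    rw [← ENNReal.ofReal_toReal (measure_ne_top P A), ← ENNReal.ofReal_mul hs.le] at this
    exact (ENNReal.ofReal_le_ofReal_iff hR).1 this
  have hq : ∀ θ, s * ∫ y in Aᶜ, ℓ θ y ∂P ≤ R := by
    intro θ
    have := hmark _ (d θ) Aᶜ hAm.compl (fun y hy => by
      have hy' : δ y < d₀ + s := not_le.1 hy
      have := hd θ
      rw [abs_sub_comm]
      exact (by linarith : s ≤ d θ - δ y).trans (le_abs_self _)) (hR1 θ)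
    rw [withDensity_apply _ hAm.compl, ← ofReal_integral_eq_lintegral_ofReal
      (hi θ).integrableOn (Eventually.of_forall (h0 θ)), ← ENNReal.ofReal_mul hs.le] at this
    exact (ENNReal.ofReal_le_ofReal_iff hR).1 this
  have hA1 : ∀ θ, s - R ≤ s * ∫ y in A, ℓ θ y ∂P := by
    intro θ
    have := integral_add_compl hAm (hi θ)
    rw [h1] at this
    have h2 := hq θ
    have : s * ∫ y in A, ℓ θ y ∂P = s - s * ∫ y in Aᶜ, ℓ θ y ∂P := by
      rw [← mul_one_sub, ← this]; ring
    linarith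
  set N : ℝ := (Fintype.card Θ : ℝ) with hN
  have hN0 : 0 < N := Nat.cast_pos.2 Fintype.card_pos
  set Lb : Ω → ℝ := fun y => ∑ θ, ℓ θ y with hLb
  have hLA : N * (s - R) ≤ s * ∫ y in A, Lb y ∂P := by
    rw [hLb, integral_finsetSum _ fun θ _ => (hi θ).integrableOn, Finset.mul_sum]
    calc N * (s - R) = ∑ _θ : Θ, (s - R) := by
            rw [Finset.sum_const, Finset.card_univ, nsmul_eq_mul]
      _ ≤ _ := Finset.sum_le_sum fun θ _ => hA1 θ
  have hi2 : ∀ θ θ', Integrable (fun y => ℓ θ y * ℓ θ' y) P := fun θ θ' =>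
    Integrable.of_bound ((hm θ).mul (hm θ')).aestronglyMeasurable (B * B)
      (Eventually.of_forall fun y => by
        rw [norm_mul, Real.norm_eq_abs, Real.norm_eq_abs, abs_of_nonneg (h0 θ y),
          abs_of_nonneg (h0 θ' y)]
        exact mul_le_mul (hB _ _) (hB _ _) (h0 _ _) ((h0 θ y).trans (hB θ y)))
  have hLsq : ∀ y, Lb y ^ 2 = ∑ θ, ∑ θ', ℓ θ y * ℓ θ' y := fun y => by
    rw [hLb, sq, Finset.sum_mul_sum]
  have hL2i : Integrable (fun y => Lb y ^ 2) P := by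
    simp only [hLsq]
    exact integrable_finsetSum _ fun θ _ => integrable_finsetSum _ fun θ' _ => hi2 θ θ'
  have hL2 : ∫ y, Lb y ^ 2 ∂P ≤ K * N ^ 2 := by
    simp only [hLsq]
    rw [integral_finsetSum _ fun θ _ => integrable_finsetSum _ fun θ' _ => hi2 θ θ']
    refine le_trans (le_of_eq ?_) hK
    exact Finset.sum_congr rfl fun θ _ => integral_finsetSum _ fun θ' _ => hi2 θ θ'
  have hLi : Integrable Lb P := integrable_finsetSum _ fun θ _ => hi θ
  -- From 2tL ≤ L² + t². The choice t = 2KN shows that the mixture gives the region at most 1/4 plus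
  -- K times its probability under P.
  have hquad : 2 * (2 * K * N) * ∫ y in A, Lb y ∂P ≤
      K * N ^ 2 + (2 * K * N) ^ 2 * P.real A := by
    set t := 2 * K * N
    calc 2 * t * ∫ y in A, Lb y ∂P = ∫ y in A, 2 * t * Lb y ∂P := (integral_const_mul _ _).symm
      _ ≤ ∫ y in A, (Lb y ^ 2 + t ^ 2) ∂P := by
          refine integral_mono (hLi.integrableOn.const_mul _)
            (hL2i.integrableOn.add (integrable_const _)) fun y => ?_
          have := sq_nonneg (Lb y - t)
          simp only
          nlinarith
      _ = ∫ y in A, Lb y ^ 2 ∂P + t ^ 2 * P.real A := by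
          rw [integral_add hL2i.integrableOn (integrable_const _)]
          simp [mul_comm]
      _ ≤ K * N ^ 2 + t ^ 2 * P.real A := by
          gcongr
          exact (setIntegral_le_integral hL2i (Eventually.of_forall fun y => sq_nonneg _)).trans hL2
  rw [div_le_iff₀ (by positivity)]
  have h3 : 4 * K * N * (N * (s - R)) ≤ s * (K * N ^ 2) + (2 * K * N) ^ 2 * R := by
    calc 4 * K * N * (N * (s - R)) ≤ 4 * K * N * (s * ∫ y in A, Lb y ∂P) := by gcongr
      _ = s * (2 * (2 * K * N) * ∫ y in A, Lb y ∂P) := by ring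
      _ ≤ s * (K * N ^ 2 + (2 * K * N) ^ 2 * P.real A) := by gcongr
      _ = s * (K * N ^ 2) + (2 * K * N) ^ 2 * (s * P.real A) := by ring
      _ ≤ _ := by gcongr
  have h4 : K * N ^ 2 * (4 * (s - R)) ≤ K * N ^ 2 * (s + 4 * K * R) := by linarith
  have h5 := le_of_mul_le_mul_left h4 (by positivity)
  have h6 : R ≤ K * R := le_mul_of_one_le_left hR hK1
  linarith

/-- The sign attached to a Boolean. -/
def boolSign (b : Bool) : ℝ := if b then 1 else -1

theorem boolSign_sq (b : Bool) : boolSign b ^ 2 = 1 := by cases b <;> simp [boolSign]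

theorem abs_boolSign (b : Bool) : |boolSign b| = 1 := by cases b <;> simp [boolSign]

/-- Independence of the signs factorizes the sum, and each factor is 2 cosh c ≤ 2 exp(c²/2). -/
theorem sum_exp_boolSign_le {m : ℕ} (c : Fin m → ℝ) :
    ∑ θ : Fin m → Bool, Real.exp (∑ j, boolSign (θ j) * c j) ≤
      2 ^ m * Real.exp ((∑ j, c j ^ 2) / 2) := by
  have h1 : ∑ θ : Fin m → Bool, Real.exp (∑ j, boolSign (θ j) * c j) =
      ∏ j, ∑ b : Bool, Real.exp (boolSign b * c j) := by
    rw [Finset.prod_univ_sum, Fintype.piFinset_univ]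
    simp only [Real.exp_sum]
  rw [h1, Finset.sum_div, Real.exp_sum]
  calc ∏ j, ∑ b : Bool, Real.exp (boolSign b * c j) ≤ ∏ j, (2 * Real.exp (c j ^ 2 / 2)) := by
        refine Finset.prod_le_prod (fun j _ => Finset.sum_nonneg fun b _ => (Real.exp_pos _).le)
          fun j _ => ?_
        have := Real.cosh_le_exp_half_sq (c j)
        rw [Real.cosh_eq] at this
        simp [boolSign]
        linarith
    _ = _ := by rw [Finset.prod_mul_distrib]; simp

/-- Second moment of the likelihood ratio of a mixture over sign vectors. -/
theorem sum_sum_pow_le_exp {m n : ℕ} (μ : Measure ℝ) [IsProbabilityMeasure μ]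
    {r : Fin m → ℝ → ℝ} (hr : ∀ j, Measurable (r j)) {B : ℝ} (hB : ∀ j x, |r j x| ≤ B)
    {Λ : ℝ} (hΛ : 0 < Λ) (hΛr : ∀ v : Fin m → ℝ,
      ∫ x, (∑ j, v j * r j x) ^ 2 ∂μ ≤ Λ * ∑ j, v j ^ 2)
    (hsmall : ∀ (θ : Fin m → Bool) x, |∑ j, boolSign (θ j) * r j x| ≤ 1) :
    ∑ θ : Fin m → Bool, ∑ θ' : Fin m → Bool,
      (1 + ∫ x, (∑ j, boolSign (θ j) * r j x) * (∑ j, boolSign (θ' j) * r j x) ∂μ) ^ n ≤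
      Real.exp ((n : ℝ) ^ 2 * Λ ^ 2 * m / 2) * (Fintype.card (Fin m → Bool) : ℝ) ^ 2 := by
  set ρ : (Fin m → ℝ) → ℝ → ℝ := fun v x => ∑ j, v j * r j x with hρ
  have hρm : ∀ v, Measurable (ρ v) := fun v =>
    Finset.measurable_sum _ fun j _ => (hr j).const_mul _
  have hρB : ∀ v x, |ρ v x| ≤ ∑ j, |v j| * B := fun v x =>
    (Finset.abs_sum_le_sum_abs _ _).trans (Finset.sum_le_sum fun j _ => by
      rw [abs_mul]; exact mul_le_mul_of_nonneg_left (hB j x) (abs_nonneg _))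
  have hprod : ∀ v w, Integrable (fun x => ρ v x * ρ w x) μ := fun v w =>
    Integrable.of_bound ((hρm v).mul (hρm w)).aestronglyMeasurable
      ((∑ j, |v j| * B) * ∑ j, |w j| * B) (Eventually.of_forall fun x => by
        rw [norm_mul]
        exact mul_le_mul (hρB v x) (hρB w x) (abs_nonneg _) ((abs_nonneg _).trans (hρB v x)))
  set sg : (Fin m → Bool) → Fin m → ℝ := fun θ j => boolSign (θ j) with hsg
  have hsgsq : ∀ θ, ∑ j, sg θ j ^ 2 = m := fun θ => by simp [hsg, boolSign_sq]
  change ∑ θ, ∑ θ', (1 + ∫ x, ρ (sg θ) x * ρ (sg θ') x ∂μ) ^ n ≤ _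
  rcases Nat.eq_zero_or_pos n with rfl | hn
  · simp [sq]
  have hn0 : (0 : ℝ) < n := by exact_mod_cast hn
  have hrow : ∀ θ', ∑ θ, (1 + ∫ x, ρ (sg θ) x * ρ (sg θ') x ∂μ) ^ n ≤
      2 ^ m * Real.exp ((n : ℝ) ^ 2 * Λ ^ 2 * m / 2) := by
    intro θ'
    have hrw : ∀ j, Integrable (fun x => r j x * ρ (sg θ') x) μ := fun j => by
      have := hprod (Pi.single j 1) (sg θ')
      simpa [hρ, Pi.single_apply] using this
    set c : Fin m → ℝ := fun j => n * ∫ x, r j x * ρ (sg θ') x ∂μ with hc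
    have hlin : ∀ v : Fin m → ℝ, n * ∫ x, ρ v x * ρ (sg θ') x ∂μ = ∑ j, v j * c j := by
      intro v
      have : ∀ x, ρ v x * ρ (sg θ') x = ∑ j, v j * (r j x * ρ (sg θ') x) := fun x => by
        simp only [hρ, Finset.sum_mul, mul_assoc]
      simp only [this]
      rw [integral_finsetSum _ fun j _ => (hrw j).const_mul _, Finset.mul_sum]
      refine Finset.sum_congr rfl fun j _ => ?_
      rw [integral_const_mul, hc]
      ring
    -- Duality: evaluating the linear form with coefficients c at c itself gives ∑ c_j². The
    -- inequality 2xy ≤ x² + y² with weight nΛ, together with the quadratic form bound for c and for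
    -- the sign vector, lets half of the left side be absorbed.
    have hcsq : ∑ j, c j ^ 2 ≤ (n : ℝ) ^ 2 * Λ ^ 2 * m := by
      have h1 := hlin c
      simp only [← sq] at h1
      have h2 : 2 * (n * Λ) * ∫ x, ρ c x * ρ (sg θ') x ∂μ ≤
          (∫ x, ρ c x * ρ c x ∂μ) + (n * Λ) ^ 2 * ∫ x, ρ (sg θ') x * ρ (sg θ') x ∂μ := by
        rw [← integral_const_mul, ← integral_const_mul,
          ← integral_add (hprod _ _) ((hprod _ _).const_mul _)]
        refine integral_mono ((hprod _ _).const_mul _)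
          ((hprod _ _).add ((hprod _ _).const_mul _)) fun x => ?_
        have := sq_nonneg (ρ c x - n * Λ * ρ (sg θ') x)
        simp only
        nlinarith
      have h3 := hΛr c
      have h4 := hΛr (sg θ')
      rw [hsgsq] at h4
      simp only [sq (∑ j, _)] at h3 h4
      have h5 : 2 * Λ * ∑ j, c j ^ 2 ≤ Λ * ∑ j, c j ^ 2 + (n * Λ) ^ 2 * (Λ * m) := by
        calc 2 * Λ * ∑ j, c j ^ 2 = 2 * (n * Λ) * ∫ x, ρ c x * ρ (sg θ') x ∂μ := by
              rw [← h1]; ring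
          _ ≤ _ := h2.trans (add_le_add h3 (mul_le_mul_of_nonneg_left h4 (by positivity)))
      have h6 : Λ * ∑ j, c j ^ 2 ≤ Λ * ((n : ℝ) ^ 2 * Λ ^ 2 * m) := by linarith
      exact le_of_mul_le_mul_left h6 hΛ
    clear_value c
    calc ∑ θ : Fin m → Bool, (1 + ∫ x, ρ (sg θ) x * ρ (sg θ') x ∂μ) ^ n
        ≤ ∑ θ : Fin m → Bool, Real.exp (∑ j, boolSign (θ j) * c j) := by
          refine Finset.sum_le_sum fun θ _ => ?_
          rw [← hlin (sg θ), Real.exp_nat_mul]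
          -- The base of the n-th power must be non-negative before 1 + x ≤ exp x can be raised to
          -- it.
          have hge : -1 ≤ ∫ x, ρ (sg θ) x * ρ (sg θ') x ∂μ := by
            have : ∫ _x : ℝ, (-1 : ℝ) ∂μ ≤ ∫ x, ρ (sg θ) x * ρ (sg θ') x ∂μ :=
              integral_mono (integrable_const _) (hprod _ _) fun x => by
                have h1 : |ρ (sg θ) x * ρ (sg θ') x| ≤ 1 := by
                  rw [abs_mul]; exact mul_le_one₀ (hsmall θ x) (abs_nonneg _) (hsmall θ' x)
                exact (abs_le.1 h1).1
            simpa using this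
          refine pow_le_pow_left₀ (by linarith) ?_ n
          rw [add_comm]
          exact Real.add_one_le_exp _
      _ ≤ 2 ^ m * Real.exp ((∑ j, c j ^ 2) / 2) := sum_exp_boolSign_le c
      _ ≤ 2 ^ m * Real.exp ((n : ℝ) ^ 2 * Λ ^ 2 * m / 2) :=
          mul_le_mul_of_nonneg_left (Real.exp_le_exp.2 (by linarith)) (by positivity)
  rw [Finset.sum_comm]
  calc ∑ θ', ∑ θ, (1 + ∫ x, ρ (sg θ) x * ρ (sg θ') x ∂μ) ^ n
      ≤ ∑ _θ' : Fin m → Bool, 2 ^ m * Real.exp ((n : ℝ) ^ 2 * Λ ^ 2 * m / 2) :=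
        Finset.sum_le_sum fun θ' _ => hrow θ'
    _ = _ := by
        have hcard : (Fintype.card (Fin m → Bool) : ℝ) = 2 ^ m := by simp
        rw [Finset.sum_const, Finset.card_univ, nsmul_eq_mul, hcard]
        ring

/-! ### The density of one observation -/

/-- The convolution `∫ S(x - y) dν(y)`. -/
noncomputable def convLaw (ν : Measure ℝ) (S : ℝ → ℝ) (x : ℝ) : ℝ := ∫ y, S (x - y) ∂ν

theorem measurable_convLaw (ν : Measure ℝ) [SFinite ν] {S : ℝ → ℝ} (hS : Measurable S) :
    Measurable (convLaw ν S) := by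
  have h : Measurable (Function.uncurry fun x y : ℝ => S (x - y)) :=
    hS.comp (measurable_fst.sub measurable_snd)
  exact h.stronglyMeasurable.integral_prod_right.measurable

theorem integrable_comp_sub (ν : Measure ℝ) [IsFiniteMeasure ν] {S : ℝ → ℝ} (hS : Measurable S)
    {B : ℝ} (hB : ∀ x, |S x| ≤ B) (x : ℝ) : Integrable (fun y => S (x - y)) ν :=
  Integrable.of_bound (hS.comp (measurable_const.sub measurable_id)).aestronglyMeasurable B
    (Eventually.of_forall fun _ => hB _)

/-- Conditioning on the noise gives a density defined at every point, since f is bounded; likelihood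
ratios can then be handled pointwise. -/
theorem marginal_eq_withDensity {f g : ℝ → ℝ} (hf : IsDensity f) (hg : IsDensity g)
    (hfm : Measurable f) {B : ℝ} (hB : ∀ x, f x ≤ B) :
    marginal f g = volume.withDensity fun x => ENNReal.ofReal (convLaw (law g) f x) := by
  have := isProbabilityMeasure_law hf
  have := isProbabilityMeasure_law hg
  have hB' : ∀ x, |f x| ≤ B := fun x => by rw [abs_of_nonneg (hf.1 x)]; exact hB x
  ext s hs
  have hind : Measurable (s.indicator (fun _ => (1 : ℝ≥0∞))) := measurable_const.indicator hs
  have hfe : Measurable fun x => ENNReal.ofReal (f x) := hfm.ennreal_ofReal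
  have h2 : Measurable (Function.uncurry fun y x : ℝ =>
      s.indicator (fun _ => (1 : ℝ≥0∞)) x * ENNReal.ofReal (f (x - y))) :=
    (hind.comp measurable_snd).mul (hfe.comp (measurable_snd.sub measurable_fst))
  calc marginal f g s = ∫⁻ z, s.indicator (fun _ => 1) z ∂(marginal f g) := by
        rw [lintegral_indicator_const hs, one_mul]
    _ = ∫⁻ x, ∫⁻ y, s.indicator (fun _ => 1) (x + y) ∂(law g) ∂(law f) :=
        Measure.lintegral_conv hind
    _ = ∫⁻ y, ∫⁻ x, s.indicator (fun _ => 1) (x + y) ∂(law f) ∂(law g) :=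
        lintegral_lintegral_swap (hind.comp measurable_add).aemeasurable
    _ = ∫⁻ y, ∫⁻ x, s.indicator (fun _ => 1) x * ENNReal.ofReal (f (x - y)) ∂volume ∂(law g) := by
        refine lintegral_congr fun y => ?_
        have hsh : Measurable fun x => s.indicator (fun _ => (1 : ℝ≥0∞)) (x + y) :=
          hind.comp (measurable_id.add_const y)
        rw [law, lintegral_withDensity_eq_lintegral_mul _ hfe hsh,
          ← lintegral_add_right_eq_self (fun x => s.indicator (fun _ => (1 : ℝ≥0∞)) x *
            ENNReal.ofReal (f (x - y))) y]
        refine lintegral_congr fun x => ?_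
        simp [mul_comm]
    _ = ∫⁻ x, ∫⁻ y, s.indicator (fun _ => 1) x * ENNReal.ofReal (f (x - y)) ∂(law g) ∂volume :=
        lintegral_lintegral_swap h2.aemeasurable
    _ = ∫⁻ x, s.indicator (fun x => ENNReal.ofReal (convLaw (law g) f x)) x := by
        refine lintegral_congr fun x => ?_
        have hsh : Measurable fun y => ENNReal.ofReal (f (x - y)) :=
          hfe.comp (measurable_const.sub measurable_id)
        have hcv : ENNReal.ofReal (convLaw (law g) f x) =
            ∫⁻ y, ENNReal.ofReal (f (x - y)) ∂(law g) :=
          ofReal_integral_eq_lintegral_ofReal (integrable_comp_sub _ hfm hB' x)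
            (Eventually.of_forall fun y => hf.1 _)
        rw [lintegral_const_mul _ hsh, ← hcv]
        by_cases hx : x ∈ s <;> simp [hx]
    _ = _ := by rw [lintegral_indicator hs, withDensity_apply _ hs]

/-- Convolution with the noise multiplies the frequency profile by Φ^g. No integrability of S is
needed, only that of its profile a. -/
theorem convLaw_eq_fourier {S : ℝ → ℝ} {a : ℝ → ℂ} (ha : Integrable a)
    (hS : ∀ x, (S x : ℂ) = 𝓕 a x) {g : ℝ → ℝ} (hg : IsDensity g) (x : ℝ) :
    ((convLaw (law g) S x : ℝ) : ℂ) = 𝓕 (fun ξ => a ξ * charFn g (2 * Real.pi * ξ)) x := by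
  have := isProbabilityMeasure_law hg
  have h := integral_fourier_add_mul ha (law g) x (-1)
  simp only [integral_exp_law hg, neg_one_mul, neg_neg, ← sub_eq_add_neg, ← hS] at h
  rw [convLaw, ← integral_complex_ofReal]
  exact h

/-! ### The Cauchy densities -/

/-- The Cauchy density with characteristic function `exp(-a |u| / (2π))`. -/
noncomputable def cauchy (a x : ℝ) : ℝ := 2 * a / (a ^ 2 + 4 * Real.pi ^ 2 * x ^ 2)

theorem integrable_exp_neg_mul_abs {a : ℝ} (ha : 0 < a) :
    Integrable fun ξ : ℝ => Real.exp (-a * |ξ|) := by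
  refine Integrable.of_integral_ne_zero ?_
  rw [integral_comp_abs (f := fun x => Real.exp (-a * x)), integral_exp_mul_Ioi (by linarith)]
  simp [ha.ne']

theorem cauchy_eq_fourier {a : ℝ} (ha : 0 < a) (x : ℝ) :
    ((cauchy a x : ℝ) : ℂ) = 𝓕 (fun ξ : ℝ => ((Real.exp (-a * |ξ|) : ℝ) : ℂ)) x := by
  rw [Real.fourier_real_eq_integral_exp_smul]
  have hi : Integrable fun v : ℝ => Complex.exp (((-2 * Real.pi * v * x : ℝ) : ℂ) * Complex.I) •
      ((Real.exp (-a * |v|) : ℝ) : ℂ) := by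
    refine (integrable_exp_neg_mul_abs ha).mono
      (Continuous.aestronglyMeasurable (by fun_prop)) (Eventually.of_forall fun v => ?_)
    rw [norm_smul, Complex.norm_exp_ofReal_mul_I, one_mul, Complex.norm_real]
  rw [← integral_add_compl (measurableSet_Ioi (a := (0 : ℝ))) hi, Set.compl_Ioi]
  set z : ℂ := 2 * Real.pi * x * Complex.I with hz
  have hzre : z.re = 0 := by simp [hz]
  have e1 : ∫ v in Set.Ioi (0 : ℝ), Complex.exp (((-2 * Real.pi * v * x : ℝ) : ℂ) * Complex.I) •
      ((Real.exp (-a * |v|) : ℝ) : ℂ) = ∫ v in Set.Ioi (0 : ℝ), Complex.exp ((-a - z) * v) := by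
    refine setIntegral_congr_fun measurableSet_Ioi fun v hv => ?_
    simp only [abs_of_pos (Set.mem_Ioi.1 hv), smul_eq_mul, Complex.ofReal_exp]
    rw [← Complex.exp_add]
    congr 1
    rw [hz]; push_cast; ring
  have e2 : ∫ v in Set.Iic (0 : ℝ), Complex.exp (((-2 * Real.pi * v * x : ℝ) : ℂ) * Complex.I) •
      ((Real.exp (-a * |v|) : ℝ) : ℂ) = ∫ v in Set.Iic (0 : ℝ), Complex.exp ((a - z) * v) := by
    refine setIntegral_congr_fun measurableSet_Iic fun v hv => ?_
    simp only [abs_of_nonpos (Set.mem_Iic.1 hv), smul_eq_mul, Complex.ofReal_exp]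
    rw [← Complex.exp_add]
    congr 1
    rw [hz]; push_cast; ring
  have r1 : (-a - z : ℂ).re < 0 := by simp [hzre, ha]
  have r2 : 0 < (a - z : ℂ).re := by simp [hzre, ha]
  have n1 : (-a - z : ℂ) ≠ 0 := fun h => by rw [h] at r1; simp at r1
  have n2 : (a - z : ℂ) ≠ 0 := fun h => by rw [h] at r2; simp at r2
  rw [e1, e2, integral_exp_mul_complex_Ioi r1, integral_exp_mul_complex_Iic r2, cauchy]
  simp only [Complex.ofReal_zero, mul_zero, Complex.exp_zero]
  have hden : ((a ^ 2 + 4 * Real.pi ^ 2 * x ^ 2 : ℝ) : ℂ) ≠ 0 := by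
    have : 0 < a ^ 2 + 4 * Real.pi ^ 2 * x ^ 2 := by positivity
    exact_mod_cast this.ne'
  have hd2 : ((a ^ 2 + 4 * Real.pi ^ 2 * x ^ 2 : ℝ) : ℂ) = -((-a - z) * (a - z)) := by
    rw [hz]
    push_cast
    linear_combination (4 * (Real.pi : ℂ) ^ 2 * (x : ℂ) ^ 2) * Complex.I_sq
  rw [Complex.ofReal_div, hd2]
  field_simp
  push_cast
  ring

theorem cauchy_pos {a : ℝ} (ha : 0 < a) (x : ℝ) : 0 < cauchy a x := by
  unfold cauchy; positivity

theorem cauchy_le {a : ℝ} (ha : 0 < a) (x : ℝ) : cauchy a x ≤ 2 / a := by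
  unfold cauchy
  rw [div_le_div_iff₀ (by positivity) ha]
  nlinarith [mul_nonneg (sq_nonneg Real.pi) (sq_nonneg x)]

theorem le_cauchy {a : ℝ} (ha : 0 < a) (x : ℝ) :
    2 * a / (a ^ 2 + 4 * Real.pi ^ 2) / (1 + x ^ 2) ≤ cauchy a x := by
  unfold cauchy
  rw [div_div]
  refine div_le_div_of_nonneg_left (by positivity) (by positivity) ?_
  nlinarith [mul_nonneg (sq_nonneg a) (sq_nonneg x), sq_nonneg Real.pi]

theorem contDiff_cauchy {a : ℝ} (ha : 0 < a) {n : WithTop ℕ∞} : ContDiff ℝ n (cauchy a) :=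
  contDiff_const.div (by fun_prop) fun x => by positivity

theorem integrable_cauchy {a : ℝ} (ha : 0 < a) : Integrable (cauchy a) := by
  have h := (integrable_inv_one_add_sq.comp_mul_left' (by positivity : 2 * Real.pi / a ≠ 0)).const_mul
    (2 / a)
  refine h.congr (Eventually.of_forall fun x => ?_)
  simp only [cauchy]
  field_simp
  ring

theorem charFn_cauchy {a : ℝ} (ha : 0 < a) (ξ : ℝ) :
    charFn (cauchy a) (2 * Real.pi * ξ) = ((Real.exp (-a * |ξ|) : ℝ) : ℂ) := by
  have hc : (fun x => ((cauchy a x : ℝ) : ℂ)) = 𝓕 (fun ξ : ℝ => ((Real.exp (-a * |ξ|) : ℝ) : ℂ)) :=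
    funext fun x => cauchy_eq_fourier ha x
  rw [charFn_two_pi_mul, ← Real.fourierInv_eq_fourier_neg, hc,
    Continuous.fourierInv_fourier_eq (by fun_prop) (integrable_exp_neg_mul_abs ha).ofReal]
  rw [← hc]
  exact (integrable_cauchy ha).ofReal

theorem isDensity_cauchy {a : ℝ} (ha : 0 < a) : IsDensity (cauchy a) := by
  refine ⟨fun x => (cauchy_pos ha x).le, integrable_cauchy ha, ?_⟩
  have h := charFn_cauchy ha 0
  simp only [mul_zero, abs_zero, Real.exp_zero, Complex.ofReal_one, charFn, Complex.ofReal_zero,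
    Complex.exp_zero, one_mul] at h
  rw [integral_complex_ofReal] at h
  exact_mod_cast h

/-- Polynomial tails survive convolution with any law, through 1 + (x - y)² ≤ 2 (1 + x²)(1 + y²).
This is the reason for a Cauchy base density: the weight 1/p in the χ² distance then costs no more
than 1 + x². -/
theorem exists_le_convLaw_cauchy {a : ℝ} (ha : 0 < a) {g : ℝ → ℝ} (hg : IsDensity g) :
    ∃ c : ℝ, 0 < c ∧ ∀ x, c / (1 + x ^ 2) ≤ convLaw (law g) (cauchy a) x := by
  have := isProbabilityMeasure_law hg
  set c₀ := 2 * a / (a ^ 2 + 4 * Real.pi ^ 2) with hc₀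
  have hc₀0 : 0 < c₀ := by positivity
  have hi : Integrable (fun y : ℝ => (1 + y ^ 2)⁻¹) (law g) :=
    Integrable.of_bound (Measurable.aestronglyMeasurable (by fun_prop)) 1
      (Eventually.of_forall fun y => by
        rw [norm_inv, Real.norm_eq_abs, abs_of_pos (by positivity)]
        exact inv_le_one_of_one_le₀ (by nlinarith [sq_nonneg y]))
  have hpos : 0 < ∫ y : ℝ, (1 + y ^ 2)⁻¹ ∂(law g) := by
    rw [integral_pos_iff_support_of_nonneg (fun y => by positivity) hi]
    have : Function.support (fun y : ℝ => (1 + y ^ 2)⁻¹) = Set.univ := by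
      ext y
      simp only [Function.mem_support, Set.mem_univ, iff_true]
      positivity
    rw [this, measure_univ]
    exact one_pos
  refine ⟨c₀ / 2 * ∫ y : ℝ, (1 + y ^ 2)⁻¹ ∂(law g), by positivity, fun x => ?_⟩
  have hcm : Measurable (cauchy a) := (contDiff_cauchy ha (n := 0)).continuous.measurable
  calc c₀ / 2 * (∫ y : ℝ, (1 + y ^ 2)⁻¹ ∂(law g)) / (1 + x ^ 2)
      = ∫ y : ℝ, c₀ / 2 / (1 + x ^ 2) * (1 + y ^ 2)⁻¹ ∂(law g) := by
        rw [integral_const_mul]; ring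
    _ ≤ convLaw (law g) (cauchy a) x := by
        refine integral_mono (hi.const_mul _) (integrable_comp_sub _ hcm (B := 2 / a)
          (fun x => by rw [abs_of_pos (cauchy_pos ha x)]; exact cauchy_le ha x) x) fun y => ?_
        refine le_trans ?_ (le_cauchy ha (x - y))
        simp only
        rw [← div_eq_mul_inv, div_div, div_div]
        refine div_le_div_of_nonneg_left hc₀0.le (by positivity) ?_
        nlinarith [sq_nonneg (x + y), mul_nonneg (sq_nonneg x) (sq_nonneg y)]

/-- A widely spread Cauchy density has its characteristic function concentrated near 0, so its
Sobolev norm is as small as desired. The integral is an explicit Gamma integral, of order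
a^(-(2β+1)). -/
theorem exists_integral_exp_mul_rpow_le {β ε : ℝ} (hβ : 0 < β) (hε : 0 < ε) :
    ∃ a : ℝ, 0 < a ∧
      Integrable (fun ξ : ℝ => Real.exp (-a * |ξ|) ^ 2 * |2 * Real.pi * ξ| ^ (2 * β)) ∧
      ∫ ξ : ℝ, Real.exp (-a * |ξ|) ^ 2 * |2 * Real.pi * ξ| ^ (2 * β) ≤ ε := by
  have hform : ∀ a : ℝ, 0 < a →
      ∫ ξ : ℝ, Real.exp (-a * |ξ|) ^ 2 * |2 * Real.pi * ξ| ^ (2 * β) =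
      2 * ((2 * Real.pi) ^ (2 * β) * ((1 / (2 * a)) ^ (2 * β + 1) * Real.Gamma (2 * β + 1))) := by
    intro a ha
    have h1 : ∀ ξ : ℝ, Real.exp (-a * |ξ|) ^ 2 * |2 * Real.pi * ξ| ^ (2 * β) =
        (2 * Real.pi) ^ (2 * β) * (|ξ| ^ (2 * β + 1 - 1) * Real.exp (-(2 * a * |ξ|))) := by
      intro ξ
      rw [abs_mul, abs_of_pos (by positivity : 0 < 2 * Real.pi), Real.mul_rpow (by positivity)
        (abs_nonneg _), ← Real.exp_nat_mul, add_sub_cancel_right]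
      push_cast
      rw [show (2 : ℝ) * (-a * |ξ|) = -(2 * a * |ξ|) by ring]
      ring
    simp only [h1]
    rw [integral_const_mul, integral_comp_abs (f := fun x => x ^ (2 * β + 1 - 1) *
      Real.exp (-(2 * a * x))), Real.integral_rpow_mul_exp_neg_mul_Ioi (by positivity)
      (by positivity)]
    ring
  set C := 2 * ((2 * Real.pi) ^ (2 * β) * Real.Gamma (2 * β + 1)) with hC
  have hC0 : 0 < C := by
    have := Real.Gamma_pos_of_pos (by positivity : 0 < 2 * β + 1)
    positivity
  have hlim : Tendsto (fun a : ℝ => C * (1 / (2 * a)) ^ (2 * β + 1)) atTop (𝓝 (C * 0)) := by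
    refine Tendsto.const_mul C ?_
    have h1 : Tendsto (fun a : ℝ => 1 / (2 * a)) atTop (𝓝 0) := by
      simp only [one_div]
      exact tendsto_inv_atTop_zero.comp (tendsto_id.const_mul_atTop two_pos)
    have h2 := h1.rpow_const (p := 2 * β + 1) (Or.inr (by positivity))
    rwa [Real.zero_rpow (by positivity)] at h2
  rw [mul_zero] at hlim
  obtain ⟨a, ha1, ha⟩ := ((hlim.eventually_le_const hε).and (eventually_gt_atTop 0)).exists
  have hf := hform a ha
  have hf' : ∫ ξ : ℝ, Real.exp (-a * |ξ|) ^ 2 * |2 * Real.pi * ξ| ^ (2 * β) =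
      C * (1 / (2 * a)) ^ (2 * β + 1) := by rw [hf, hC]; ring
  refine ⟨a, ha, Integrable.of_integral_ne_zero ?_, hf'.le.trans ha1⟩
  rw [hf']
  positivity

/-! ### Trigonometric polynomials -/

/-- The trigonometric polynomial `∑ j, v j * exp(2π i j η)`. -/
noncomputable def trig {m : ℕ} (v : Fin m → ℂ) (η : ℝ) : ℂ :=
  ∑ j, v j * Complex.exp ((2 * Real.pi * (j : ℕ) * η : ℝ) * Complex.I)

theorem continuous_trig {m : ℕ} (v : Fin m → ℂ) : Continuous (trig v) := by
  unfold trig; fun_prop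

theorem hasDerivAt_trig {m : ℕ} (v : Fin m → ℂ) (η : ℝ) :
    HasDerivAt (trig v) (trig (fun j => 2 * Real.pi * (j : ℕ) * Complex.I * v j) η) η := by
  unfold trig
  refine HasDerivAt.fun_sum fun j _ => ?_
  have h1 : HasDerivAt (fun η : ℝ => ((2 * Real.pi * (j : ℕ) * η : ℝ) : ℂ) * Complex.I)
      (((2 * Real.pi * (j : ℕ) : ℝ) : ℂ) * Complex.I) η := by
    have := ((hasDerivAt_id η).const_mul (2 * Real.pi * ((j : ℕ) : ℝ))).ofReal_comp.mul_const
      Complex.I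
    simpa using this
  refine (h1.cexp.const_mul (v j)).congr_deriv ?_
  push_cast
  ring

theorem integral_exp_two_pi_int_mul {k : ℤ} (hk : k ≠ 0) (a b : ℤ) :
    ∫ η in (a : ℝ)..b, Complex.exp ((2 * Real.pi * k * Complex.I) * η) = 0 := by
  have hc : (2 * Real.pi * k * Complex.I : ℂ) ≠ 0 := by
    simp [Real.pi_ne_zero, hk]
  have h : ∀ l : ℤ, Complex.exp ((2 * Real.pi * k * Complex.I) * ((l : ℝ) : ℂ)) = 1 := by
    intro l
    rw [Complex.exp_eq_one_iff]
    exact ⟨k * l, by push_cast; ring⟩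
  rw [integral_exp_mul_complex hc, h, h]
  simp

/-- Orthogonality of the exponentials over whole periods, hence the integer endpoints. -/
theorem integral_norm_sq_trig {m : ℕ} (v : Fin m → ℂ) (a b : ℤ) :
    ∫ η in (a : ℝ)..b, ‖trig v η‖ ^ 2 = (b - a) * ∑ j, ‖v j‖ ^ 2 := by
  have h1 : ∀ η : ℝ, ((‖trig v η‖ ^ 2 : ℝ) : ℂ) = ∑ j : Fin m, ∑ l : Fin m,
      (conj (v j) * v l) *
        Complex.exp ((2 * Real.pi * (((l : ℕ) : ℤ) - ((j : ℕ) : ℤ) : ℤ) * Complex.I) * η) := by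
    intro η
    rw [Complex.ofReal_pow, ← Complex.conj_mul', trig, map_sum, Finset.sum_mul_sum]
    refine Finset.sum_congr rfl fun j _ => Finset.sum_congr rfl fun l _ => ?_
    rw [map_mul, mul_mul_mul_comm, ← Complex.exp_conj, ← Complex.exp_add]
    congr 2
    simp only [map_mul, Complex.conj_ofReal, Complex.conj_I]
    push_cast
    ring
  have hint : ∀ j l : Fin m, IntervalIntegrable (fun η : ℝ => (conj (v j) * v l) *
      Complex.exp ((2 * Real.pi * (((l : ℕ) : ℤ) - ((j : ℕ) : ℤ) : ℤ) * Complex.I) * η))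
      volume a b := fun j l => Continuous.intervalIntegrable (by fun_prop) _ _
  have h2 : ∀ j l : Fin m, ∫ η in (a : ℝ)..b, (conj (v j) * v l) *
      Complex.exp ((2 * Real.pi * (((l : ℕ) : ℤ) - ((j : ℕ) : ℤ) : ℤ) * Complex.I) * η) =
      if l = j then ((b : ℂ) - a) * (‖v j‖ ^ 2 : ℝ) else 0 := by
    intro j l
    split_ifs with h
    · subst h
      simp only [sub_self, Int.cast_zero, mul_zero, zero_mul, Complex.exp_zero, mul_one,
        intervalIntegral.integral_const, Complex.conj_mul', Complex.real_smul]
      push_cast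
      ring
    · rw [intervalIntegral.integral_const_mul, integral_exp_two_pi_int_mul, mul_zero]
      rw [sub_ne_zero]
      exact_mod_cast fun hc => h (Fin.ext hc)
  have h3 : ((∫ η in (a : ℝ)..b, ‖trig v η‖ ^ 2 : ℝ) : ℂ) =
      (((b - a) * ∑ j, ‖v j‖ ^ 2 : ℝ) : ℂ) := by
    rw [← intervalIntegral.integral_ofReal]
    simp only [h1]
    rw [intervalIntegral.integral_finsetSum fun j _ => Continuous.intervalIntegrable
      (by fun_prop) _ _]
    have : ∀ j : Fin m, ∫ η in (a : ℝ)..b, ∑ l : Fin m, (conj (v j) * v l) *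
        Complex.exp ((2 * Real.pi * (((l : ℕ) : ℤ) - ((j : ℕ) : ℤ) : ℤ) * Complex.I) * η) =
        ((b : ℂ) - a) * (‖v j‖ ^ 2 : ℝ) := fun j => by
      rw [intervalIntegral.integral_finsetSum fun l _ => hint j l]
      simp only [h2, Finset.sum_ite_eq', Finset.mem_univ, if_true]
    simp only [this, ← Finset.mul_sum]
    push_cast
    ring
  exact_mod_cast h3

theorem integrable_indicator_norm_sq_trig {m : ℕ} (v : Fin m → ℂ) (h : ℝ) (s : Set ℝ)
    (hs : IsCompact s) :
    Integrable (s.indicator fun ξ => ‖trig v (h * ξ)‖ ^ 2) := by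
  refine (integrable_indicator_iff hs.measurableSet).2 (Continuous.continuousOn ?_
    |>.integrableOn_compact hs)
  have := continuous_trig v
  fun_prop

theorem integral_indicator_norm_sq_trig {m : ℕ} (v : Fin m → ℂ) {h : ℝ} (hh : 0 < h) {a b : ℤ}
    (hab : a ≤ b) :
    ∫ ξ, (Set.Icc (a / h) (b / h)).indicator (fun ξ => ‖trig v (h * ξ)‖ ^ 2) ξ =
      (b - a) / h * ∑ j, ‖v j‖ ^ 2 := by
  have hab' : (a : ℝ) / h ≤ b / h := by gcongr
  rw [integral_indicator measurableSet_Icc, integral_Icc_eq_integral_Ioc,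
    ← intervalIntegral.integral_of_le hab',
    intervalIntegral.integral_comp_mul_left (fun η => ‖trig v η‖ ^ 2) hh.ne',
    mul_div_cancel₀ _ hh.ne', mul_div_cancel₀ _ hh.ne', integral_norm_sq_trig, smul_eq_mul]
  ring

/-! ### The frequency window and the wave it generates -/

/-- A smooth bump supported in `(1, 4)` and equal to `1` on `[2, 3]`. -/
noncomputable def halfWindow : ContDiffBump (5 / 2 : ℝ) where
  rIn := 1 / 2
  rOut := 3 / 2
  rIn_pos := by norm_num
  rIn_lt_rOut := by norm_num

/-- An even smooth function supported in `1 ≤ |η| ≤ 4` and at least `1` on `[2, 3]`. -/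
noncomputable def window (η : ℝ) : ℝ := halfWindow η + halfWindow (-η)

theorem contDiff_window {n : ℕ∞} : ContDiff ℝ n window :=
  halfWindow.contDiff.add (halfWindow.contDiff.comp contDiff_neg)

theorem window_neg (η : ℝ) : window (-η) = window η := by
  unfold window; rw [neg_neg, add_comm]

theorem window_nonneg (η : ℝ) : 0 ≤ window η := add_nonneg halfWindow.nonneg halfWindow.nonneg

theorem window_le_two (η : ℝ) : window η ≤ 2 := by
  have h1 := halfWindow.le_one (x := η)
  have h2 := halfWindow.le_one (x := -η)
  unfold window; linarith

theorem one_le_window {η : ℝ} (h : η ∈ Set.Icc (2 : ℝ) 3) : 1 ≤ window η := by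
  have h1 : halfWindow η = 1 := by
    refine halfWindow.one_of_mem_closedBall ?_
    rw [Metric.mem_closedBall, Real.dist_eq, abs_le]
    change -(1 / 2 : ℝ) ≤ η - 5 / 2 ∧ η - 5 / 2 ≤ 1 / 2
    constructor <;> linarith [h.1, h.2]
  have h2 : 0 ≤ halfWindow (-η) := halfWindow.nonneg
  unfold window; linarith

theorem window_eq_zero {η : ℝ} (h : η ∉ {η : ℝ | 1 ≤ |η| ∧ |η| ≤ 4}) : window η = 0 := by
  have key : ∀ t : ℝ, |t| = |η| → halfWindow t = 0 := by
    intro t ht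
    refine halfWindow.zero_of_le_dist ?_
    change (3 / 2 : ℝ) ≤ |t - 5 / 2|
    by_contra hc
    push Not at hc
    rw [abs_lt] at hc
    refine h ?_
    rw [Set.mem_ofPred_eq, ← ht, abs_of_pos (by linarith)]
    constructor <;> linarith
  unfold window
  rw [key η rfl, key (-η) (abs_neg η), add_zero]

theorem isClosed_annulus : IsClosed {η : ℝ | 1 ≤ |η| ∧ |η| ≤ 4} :=
  (isClosed_le continuous_const continuous_abs).inter (isClosed_le continuous_abs continuous_const)

theorem hasCompactSupport_window : HasCompactSupport window := by
  refine HasCompactSupport.intro (isCompact_Icc (a := (-4 : ℝ)) (b := 4)) fun η hη => ?_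
  refine window_eq_zero fun hc => hη ?_
  exact abs_le.1 hc.2

theorem deriv_window_eq_zero {η : ℝ} (h : η ∉ {η : ℝ | 1 ≤ |η| ∧ |η| ≤ 4}) :
    deriv window η = 0 := by
  have : window =ᶠ[𝓝 η] fun _ => 0 := by
    filter_upwards [isClosed_annulus.isOpen_compl.mem_nhds h] with t ht
    exact window_eq_zero ht
  rw [this.deriv_eq]
  simp

theorem exists_abs_deriv_window_le : ∃ C : ℝ, 0 < C ∧ ∀ η, |deriv window η| ≤ C := by
  have hc : Continuous (deriv window) := (contDiff_window (n := 1)).continuous_deriv le_rfl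
  obtain ⟨C, hC⟩ := hc.bounded_above_of_compact_support hasCompactSupport_window.deriv
  exact ⟨max C 1, by positivity, fun η => (hC η).trans (le_max_left _ _)⟩

/-- The inverse Fourier transform of the window, a real valued Schwartz function. -/
noncomputable def wave (x : ℝ) : ℝ := (𝓕 (fun η => ((window η : ℝ) : ℂ)) x).re

theorem ofReal_wave (x : ℝ) : ((wave x : ℝ) : ℂ) = 𝓕 (fun η => ((window η : ℝ) : ℂ)) x := by
  unfold wave
  rw [← Complex.conj_eq_iff_re, Real.fourier_real_eq_integral_exp_smul, ← integral_conj,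
    ← integral_neg_eq_self]
  refine integral_congr_ae (Eventually.of_forall fun η => ?_)
  simp only [smul_eq_mul, map_mul, window_neg, Complex.conj_ofReal, ← Complex.exp_conj,
    Complex.conj_I]
  congr 2
  push_cast
  ring

/-- The window as a Schwartz function. -/
noncomputable def windowSchwartz : SchwartzMap ℝ ℂ :=
  HasCompactSupport.toSchwartzMap (f := fun η => ((window η : ℝ) : ℂ))
    (hasCompactSupport_window.comp_left (g := fun x : ℝ => (x : ℂ)) (by simp))
    (Complex.ofRealCLM.contDiff.comp contDiff_window)

theorem wave_eq_re (x : ℝ) : wave x = ((𝓕 windowSchwartz : SchwartzMap ℝ ℂ) x).re := rfl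

theorem contDiff_wave {n : ℕ∞} : ContDiff ℝ n wave :=
  Complex.reCLM.contDiff.comp ((𝓕 windowSchwartz : SchwartzMap ℝ ℂ).smooth n)

/-- Two factors 1 + x² are kept on purpose: one yields the Cauchy-type tail of a perturbation, the
other the summability over the positions j. -/
theorem exists_abs_wave_le : ∃ C : ℝ, 0 < C ∧ ∀ x, |wave x| ≤ C / (1 + x ^ 2) ^ 2 := by
  obtain ⟨C₀, hC₀, h0⟩ := (𝓕 windowSchwartz : SchwartzMap ℝ ℂ).decay 0 0
  obtain ⟨C₄, hC₄, h4⟩ := (𝓕 windowSchwartz : SchwartzMap ℝ ℂ).decay 4 0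
  refine ⟨2 * C₀ + 2 * C₄, by positivity, fun x => ?_⟩
  have e0 := h0 x
  have e4 := h4 x
  simp only [pow_zero, one_mul, norm_iteratedFDeriv_zero, Real.norm_eq_abs] at e0 e4
  have hw : |wave x| ≤ ‖(𝓕 windowSchwartz : SchwartzMap ℝ ℂ) x‖ := by
    rw [wave_eq_re]; exact Complex.abs_re_le_norm _
  have ex : |x| ^ 4 = x ^ 4 := by
    rw [← abs_pow]; exact abs_of_nonneg (by positivity)
  rw [ex] at e4
  rw [le_div_iff₀ (by positivity)]
  set N := ‖(𝓕 windowSchwartz : SchwartzMap ℝ ℂ) x‖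
  calc |wave x| * (1 + x ^ 2) ^ 2 ≤ N * (1 + x ^ 2) ^ 2 := by gcongr
    _ ≤ N * (2 + 2 * x ^ 4) := by
        gcongr
        nlinarith [sq_nonneg (x ^ 2 - 1)]
    _ ≤ 2 * C₀ + 2 * C₄ := by linarith

/-! ### The perturbations -/

/-- The perturbation `A ∑ j, v j * wave(x/h - j)`. -/
noncomputable def pert {m : ℕ} (h A : ℝ) (v : Fin m → ℝ) (x : ℝ) : ℝ :=
  A * ∑ j, v j * wave (x / h - (j : ℕ))

/-- The inverse Fourier transform of `pert`. -/
noncomputable def pertFT {m : ℕ} (h A : ℝ) (v : Fin m → ℝ) (ξ : ℝ) : ℂ :=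
  ((A * h * window (h * ξ) : ℝ) : ℂ) * trig (fun j => (v j : ℂ)) (h * ξ)

theorem fourier_comp_mul_left (k : ℝ → ℂ) {h : ℝ} (hh : 0 < h) (x : ℝ) :
    𝓕 (fun ξ => k (h * ξ)) x = ((h⁻¹ : ℝ) : ℂ) * 𝓕 k (x / h) := by
  rw [Real.fourier_real_eq_integral_exp_smul, Real.fourier_real_eq_integral_exp_smul]
  have := Measure.integral_comp_mul_left (fun η : ℝ =>
    Complex.exp (((-2 * Real.pi * η * (x / h) : ℝ) : ℂ) * Complex.I) • k η) h
  rw [abs_of_pos (inv_pos.2 hh), Complex.real_smul] at this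
  rw [← this]
  refine integral_congr_ae (Eventually.of_forall fun ξ => ?_)
  simp only
  congr 4
  field_simp

theorem continuous_pertFT {m : ℕ} (h A : ℝ) (v : Fin m → ℝ) : Continuous (pertFT h A v) := by
  have h1 := (contDiff_window (n := 0)).continuous
  have h2 := continuous_trig (fun j => (v j : ℂ))
  unfold pertFT
  fun_prop

theorem pertFT_eq_zero {m : ℕ} (h A : ℝ) (v : Fin m → ℝ) {ξ : ℝ}
    (hξ : h * ξ ∉ {η : ℝ | 1 ≤ |η| ∧ |η| ≤ 4}) : pertFT h A v ξ = 0 := by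
  simp [pertFT, window_eq_zero hξ]

theorem hasCompactSupport_of_annulus {E : Type*} [Zero E] {F : ℝ → E} {h : ℝ} (hh : 0 < h)
    (hF : ∀ ξ, h * ξ ∉ {η : ℝ | 1 ≤ |η| ∧ |η| ≤ 4} → F ξ = 0) : HasCompactSupport F := by
  refine HasCompactSupport.intro (isCompact_Icc (a := -(4 / h)) (b := 4 / h)) fun ξ hξ => ?_
  refine hF ξ fun hc => hξ ?_
  rw [Set.mem_Icc, ← abs_le, le_div_iff₀ hh]
  have := hc.2
  rw [abs_mul, abs_of_pos hh] at this
  linarith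

theorem integrable_pertFT {m : ℕ} {h : ℝ} (hh : 0 < h) (A : ℝ) (v : Fin m → ℝ) :
    Integrable (pertFT h A v) :=
  (continuous_pertFT h A v).integrable_of_hasCompactSupport
    (hasCompactSupport_of_annulus hh fun _ => pertFT_eq_zero h A v)

/-- A shift by j becomes a modulation, so the sum over positions is the rescaled window times one
trigonometric polynomial. -/
theorem pert_eq_fourier {m : ℕ} {h : ℝ} (hh : 0 < h) (A : ℝ) (v : Fin m → ℝ) (x : ℝ) :
    ((pert h A v x : ℝ) : ℂ) = 𝓕 (pertFT h A v) x := by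
  have hterm : ∀ j : Fin m, 𝓕 (fun ξ : ℝ =>
      Complex.exp ((2 * Real.pi * ((j : ℕ) * h) * ξ : ℝ) * Complex.I) *
        ((window (h * ξ) : ℝ) : ℂ)) x = ((h⁻¹ : ℝ) : ℂ) * (wave (x / h - (j : ℕ)) : ℝ) := by
    intro j
    rw [fourier_exp_mul (fun ξ => ((window (h * ξ) : ℝ) : ℂ)),
      fourier_comp_mul_left (fun η => ((window η : ℝ) : ℂ)) hh, ofReal_wave]
    congr 2
    field_simp
  have hi : ∀ j : Fin m, Integrable (fun ξ : ℝ =>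
      Complex.exp (((-2 * Real.pi * ξ * x : ℝ) : ℂ) * Complex.I) • (((A * h * v j : ℝ) : ℂ) *
        (Complex.exp ((2 * Real.pi * ((j : ℕ) * h) * ξ : ℝ) * Complex.I) *
        ((window (h * ξ) : ℝ) : ℂ)))) := by
    intro j
    refine Continuous.integrable_of_hasCompactSupport ?_ (hasCompactSupport_of_annulus hh
      fun ξ hξ => by simp [window_eq_zero hξ])
    have h1 := (contDiff_window (n := 0)).continuous
    fun_prop
  have hexp : ∀ ξ : ℝ, Complex.exp (((-2 * Real.pi * ξ * x : ℝ) : ℂ) * Complex.I) •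
      pertFT h A v ξ = ∑ j, Complex.exp (((-2 * Real.pi * ξ * x : ℝ) : ℂ) * Complex.I) •
        (((A * h * v j : ℝ) : ℂ) *
        (Complex.exp ((2 * Real.pi * ((j : ℕ) * h) * ξ : ℝ) * Complex.I) *
        ((window (h * ξ) : ℝ) : ℂ))) := by
    intro ξ
    rw [pertFT, trig, Finset.mul_sum, Finset.smul_sum]
    refine Finset.sum_congr rfl fun j _ => ?_
    congr 1
    have : (2 * Real.pi * (j : ℕ) * (h * ξ) : ℝ) = 2 * Real.pi * ((j : ℕ) * h) * ξ := by ring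
    rw [this]
    push_cast
    ring
  rw [Real.fourier_real_eq_integral_exp_smul]
  simp only [hexp]
  rw [integral_finsetSum _ fun j _ => hi j, pert, Finset.mul_sum, Complex.ofReal_sum]
  refine Finset.sum_congr rfl fun j _ => ?_
  have h2 := hterm j
  rw [Real.fourier_real_eq_integral_exp_smul] at h2
  have hcomm : ∀ (z c k : ℂ), z • (c * k) = c * (z • k) := fun z c k => by
    simp only [smul_eq_mul]; ring
  simp only [hcomm] at h2 ⊢
  rw [integral_const_mul, h2]
  have hh' : (h : ℂ) ≠ 0 := by exact_mod_cast hh.ne'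
  push_cast
  field_simp

theorem contDiff_pert {m : ℕ} (h A : ℝ) (v : Fin m → ℝ) {n : ℕ∞} : ContDiff ℝ n (pert h A v) := by
  unfold pert
  refine contDiff_const.mul (ContDiff.sum fun j _ => contDiff_const.mul
    (contDiff_wave.comp ((contDiff_id.div_const h).sub contDiff_const)))

/-! ### Size and Fourier transform of the perturbations -/

/-- Replacing y by its integer part changes each term by a factor at most 3, and the resulting
integers are distinct, so a convergent series over ℤ bounds the sum uniformly in m and y. -/
theorem exists_sum_inv_one_add_sq_le :
    ∃ C : ℝ, 0 < C ∧ ∀ (m : ℕ) (y : ℝ), ∑ j : Fin m, 1 / (1 + (y - (j : ℕ)) ^ 2) ≤ C := by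
  have hs : Summable fun k : ℤ => 3 / (1 + (k : ℝ) ^ 2) := by
    -- The shift by 1/2 keeps the denominators of the comparison series away from 0.
    have h := ((Real.summable_one_div_int_add_rpow (1 / 2) 2).2 (by norm_num)).mul_left 6
    refine h.of_nonneg_of_le (fun k => by positivity) fun k => ?_
    have hk : (k : ℝ) + 1 / 2 ≠ 0 := by
      intro hc
      have : (2 * k + 1 : ℝ) = 0 := by linarith
      have : (2 * k + 1 : ℤ) = 0 := by exact_mod_cast this
      omega
    have hpos : 0 < ((k : ℝ) + 1 / 2) ^ 2 := by positivity
    rw [Real.rpow_two, sq_abs, mul_one_div, div_le_div_iff₀ (by positivity) hpos]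
    nlinarith [sq_nonneg ((k : ℝ) - 1)]
  refine ⟨(∑' k : ℤ, 3 / (1 + (k : ℝ) ^ 2)) + 1, ?_, fun m y => ?_⟩
  · have : 0 ≤ ∑' k : ℤ, 3 / (1 + (k : ℝ) ^ 2) := tsum_nonneg fun k => by positivity
    linarith
  · have hinj : Function.Injective fun j : Fin m => ⌊y⌋ - ((j : ℕ) : ℤ) := by
      intro i j hij
      simp only [sub_right_inj, Nat.cast_inj] at hij
      exact Fin.ext hij
    have h1 : ∀ j : Fin m, 1 / (1 + (y - (j : ℕ)) ^ 2) ≤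
        3 / (1 + ((⌊y⌋ - ((j : ℕ) : ℤ) : ℤ) : ℝ) ^ 2) := by
      intro j
      rw [div_le_div_iff₀ (by positivity) (by positivity)]
      have h2 := Int.floor_le y
      have h3 := Int.lt_floor_add_one y
      push_cast
      set t : ℝ := y - (j : ℕ)
      have e : (⌊y⌋ : ℝ) - (j : ℕ) = t - (y - ⌊y⌋) := by simp only [t]; ring
      rw [e]
      have h4 : 0 ≤ y - ⌊y⌋ := by linarith
      have h5 : y - ⌊y⌋ ≤ 1 := by linarith
      generalize y - (⌊y⌋ : ℝ) = r at h4 h5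
      nlinarith [sq_nonneg (t + r), mul_nonneg h4 (sub_nonneg.2 h5)]
    calc ∑ j : Fin m, 1 / (1 + (y - (j : ℕ)) ^ 2)
        ≤ ∑ j : Fin m, 3 / (1 + ((⌊y⌋ - ((j : ℕ) : ℤ) : ℤ) : ℝ) ^ 2) :=
          Finset.sum_le_sum fun j _ => h1 j
      _ = ∑ k ∈ Finset.univ.map ⟨_, hinj⟩, 3 / (1 + ((k : ℤ) : ℝ) ^ 2) := by
          rw [Finset.sum_map]; rfl
      _ ≤ ∑' k : ℤ, 3 / (1 + (k : ℝ) ^ 2) :=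
          hs.sum_le_tsum _ fun k _ => by positivity
      _ ≤ _ := by linarith

/-- With t = x/h - j one has x = ht + hj with h ≤ 1 and 0 ≤ hj ≤ 1, so 1 + x² ≤ 3 (1 + t²): the
positions all lie in [0, 1] and every wave has its tail around the origin. The constant does not
grow with m. -/
theorem exists_abs_pert_le : ∃ C : ℝ, 0 < C ∧ ∀ (m : ℕ) (h A : ℝ) (v : Fin m → ℝ), 0 < h → h ≤ 1 →
    h * m ≤ 1 → 0 ≤ A → (∀ j, |v j| ≤ 1) → ∀ x, |pert h A v x| ≤ A * C / (1 + x ^ 2) := by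
  obtain ⟨C₁, hC₁, h1⟩ := exists_abs_wave_le
  obtain ⟨C₂, hC₂, h2⟩ := exists_sum_inv_one_add_sq_le
  refine ⟨3 * C₁ * C₂, by positivity, fun m h A v hh hh1 hm hA hv x => ?_⟩
  have hj : ∀ j : Fin m, |v j * wave (x / h - (j : ℕ))| ≤
      3 * C₁ / (1 + x ^ 2) * (1 / (1 + (x / h - (j : ℕ)) ^ 2)) := by
    intro j
    rw [abs_mul]
    have e1 := h1 (x / h - (j : ℕ))
    have ex : x = h * (x / h - (j : ℕ)) + h * (j : ℕ) := by field_simp; ring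
    have hj0 : 0 ≤ h * (j : ℕ) := by positivity
    have hj1 : h * (j : ℕ) ≤ 1 := by
      refine le_trans ?_ hm
      have : ((j : ℕ) : ℝ) ≤ m := by exact_mod_cast j.2.le
      gcongr
    generalize x / h - ((j : ℕ) : ℝ) = t at *
    generalize h * ((j : ℕ) : ℝ) = r at *
    have ht : 1 + x ^ 2 ≤ 3 * (1 + t ^ 2) := by
      have : (h * t) ^ 2 ≤ t ^ 2 := by
        rw [mul_pow]
        nlinarith [sq_nonneg t, mul_nonneg hh.le (sub_nonneg.2 hh1)]
      rw [ex]
      nlinarith [sq_nonneg (h * t - r)]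
    calc |v j| * |wave t| ≤ 1 * (C₁ / (1 + t ^ 2) ^ 2) := by
          gcongr; exact hv j
      _ ≤ 3 * C₁ / (1 + x ^ 2) * (1 / (1 + t ^ 2)) := by
          rw [one_mul, div_mul_div_comm, div_le_div_iff₀ (by positivity) (by positivity)]
          have : 0 ≤ C₁ * (1 + t ^ 2) := by positivity
          nlinarith [mul_le_mul_of_nonneg_left ht this]
  unfold pert
  rw [abs_mul, abs_of_nonneg hA, mul_div_assoc]
  refine mul_le_mul_of_nonneg_left ?_ hA
  calc |∑ j, v j * wave (x / h - (j : ℕ))|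
      ≤ ∑ j : Fin m, 3 * C₁ / (1 + x ^ 2) * (1 / (1 + (x / h - (j : ℕ)) ^ 2)) :=
        (Finset.abs_sum_le_sum_abs _ _).trans (Finset.sum_le_sum fun j _ => hj j)
    _ = 3 * C₁ / (1 + x ^ 2) * ∑ j : Fin m, 1 / (1 + (x / h - (j : ℕ)) ^ 2) := by
        rw [Finset.mul_sum]
    _ ≤ 3 * C₁ / (1 + x ^ 2) * C₂ := by gcongr; exact h2 m _
    _ = _ := by ring

theorem integrable_pert {m : ℕ} (h A : ℝ) (v : Fin m → ℝ) {a : ℝ} (ha : 0 < a)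
    (hle : ∀ x, |pert h A v x| ≤ cauchy a x) : Integrable (pert h A v) :=
  (integrable_cauchy ha).mono' (contDiff_pert h A v (n := 0)).continuous.aestronglyMeasurable
    (Eventually.of_forall hle)

theorem charFn_pert {m : ℕ} {h : ℝ} (hh : 0 < h) (A : ℝ) (v : Fin m → ℝ)
    (hi : Integrable (pert h A v)) (ξ : ℝ) :
    charFn (pert h A v) (2 * Real.pi * ξ) = pertFT h A v ξ := by
  have hc : (fun x => ((pert h A v x : ℝ) : ℂ)) = 𝓕 (pertFT h A v) :=
    funext fun x => pert_eq_fourier hh A v x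
  rw [charFn_two_pi_mul, ← Real.fourierInv_eq_fourier_neg, hc,
    Continuous.fourierInv_fourier_eq (continuous_pertFT h A v) (integrable_pertFT hh A v)]
  rw [← hc]
  exact hi.ofReal

/-- The annulus lies in [-4, 4], eight full periods of the trigonometric polynomial, so Parseval
leaves no off-diagonal terms in v. -/
theorem integral_le_of_le_trig {m : ℕ} {h B : ℝ} (hh : 0 < h) (hB : 0 ≤ B) (v : Fin m → ℂ)
    {φ : ℝ → ℝ} (h0 : ∀ ξ, 0 ≤ φ ξ)
    (hφ : ∀ ξ, 1 ≤ |h * ξ| → |h * ξ| ≤ 4 → φ ξ ≤ B * ‖trig v (h * ξ)‖ ^ 2)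
    (hφ0 : ∀ ξ, h * ξ ∉ {η : ℝ | 1 ≤ |η| ∧ |η| ≤ 4} → φ ξ = 0) :
    ∫ ξ, φ ξ ≤ 8 * B / h * ∑ j, ‖v j‖ ^ 2 := by
  have h1 := integral_indicator_norm_sq_trig v hh (a := -4) (b := 4) (by norm_num)
  have h2 := (integrable_indicator_norm_sq_trig v h (Set.Icc (((-4 : ℤ) : ℝ) / h)
    (((4 : ℤ) : ℝ) / h)) isCompact_Icc).const_mul B
  calc ∫ ξ, φ ξ ≤ ∫ ξ, B * (Set.Icc (((-4 : ℤ) : ℝ) / h) (((4 : ℤ) : ℝ) / h)).indicator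
        (fun ξ => ‖trig v (h * ξ)‖ ^ 2) ξ := by
        refine integral_mono_of_nonneg (Eventually.of_forall h0) h2
          (Eventually.of_forall fun ξ => ?_)
        by_cases hξ : 1 ≤ |h * ξ| ∧ |h * ξ| ≤ 4
        · have hmem : ξ ∈ Set.Icc (((-4 : ℤ) : ℝ) / h) (((4 : ℤ) : ℝ) / h) := by
            have := abs_le.1 hξ.2
            push_cast
            rw [Set.mem_Icc, div_le_iff₀ hh, le_div_iff₀ hh]
            constructor <;> nlinarith
          simp only [Set.indicator_of_mem hmem]
          exact hφ ξ hξ.1 hξ.2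
        · rw [hφ0 ξ hξ]
          exact mul_nonneg hB (Set.indicator_nonneg (fun _ _ => by positivity) _)
    _ = 8 * B / h * ∑ j, ‖v j‖ ^ 2 := by
        rw [integral_const_mul, h1]
        push_cast
        ring

theorem norm_pertFT_sq {m : ℕ} (h A : ℝ) (v : Fin m → ℝ) (ξ : ℝ) :
    ‖pertFT h A v ξ‖ ^ 2 =
      (A * h * window (h * ξ)) ^ 2 * ‖trig (fun j => (v j : ℂ)) (h * ξ)‖ ^ 2 := by
  rw [pertFT, norm_mul, mul_pow, Complex.norm_real, Real.norm_eq_abs, sq_abs]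

theorem norm_pertFT_sq_le {m : ℕ} (h A : ℝ) (v : Fin m → ℝ) (ξ : ℝ) :
    ‖pertFT h A v ξ‖ ^ 2 ≤ 4 * (A * h) ^ 2 * ‖trig (fun j => (v j : ℂ)) (h * ξ)‖ ^ 2 := by
  rw [norm_pertFT_sq]
  refine mul_le_mul_of_nonneg_right ?_ (by positivity)
  have h1 := window_nonneg (h * ξ)
  have h2 := window_le_two (h * ξ)
  rw [mul_pow]
  have : window (h * ξ) ^ 2 ≤ 4 := by nlinarith
  nlinarith [sq_nonneg (A * h)]

theorem integral_pertFT_mul_rpow_le {m : ℕ} {h β : ℝ} (hh : 0 < h) (hβ : 0 < β) (A : ℝ)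
    (v : Fin m → ℝ) : ∫ ξ, ‖pertFT h A v ξ‖ ^ 2 * |2 * Real.pi * ξ| ^ (2 * β) ≤
      32 * (8 * Real.pi) ^ (2 * β) * (A ^ 2 * h ^ (-(2 * β))) * (h * ∑ j, v j ^ 2) := by
  have h1 := integral_le_of_le_trig hh (B := 4 * (A * h) ^ 2 * (8 * Real.pi / h) ^ (2 * β))
    (by positivity) (fun j => (v j : ℂ))
    (φ := fun ξ => ‖pertFT h A v ξ‖ ^ 2 * |2 * Real.pi * ξ| ^ (2 * β))
    (fun ξ => by positivity) ?_ ?_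
  · refine h1.trans (le_of_eq ?_)
    simp only [Complex.norm_real, Real.norm_eq_abs, sq_abs]
    rw [Real.div_rpow (by positivity) hh.le, Real.rpow_neg hh.le]
    field_simp
    ring
  · intro ξ _ h4
    calc ‖pertFT h A v ξ‖ ^ 2 * |2 * Real.pi * ξ| ^ (2 * β)
        ≤ 4 * (A * h) ^ 2 * ‖trig (fun j => (v j : ℂ)) (h * ξ)‖ ^ 2 *
          (8 * Real.pi / h) ^ (2 * β) := by
          refine mul_le_mul (norm_pertFT_sq_le h A v ξ) ?_ (by positivity) (by positivity)
          refine Real.rpow_le_rpow (abs_nonneg _) ?_ (by positivity)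
          rw [abs_mul, abs_of_pos hh] at h4
          rw [abs_mul, abs_of_pos (by positivity : (0 : ℝ) < 2 * Real.pi), le_div_iff₀ hh]
          nlinarith [Real.pi_pos]
      _ = _ := by ring
  · intro ξ hξ
    simp [pertFT_eq_zero h A v hξ]

/-- The window is at least 1 on [2, 3], and this single period already captures all of ∑ v_j². -/
theorem integral_norm_sq_pertFT_ge {m : ℕ} {h : ℝ} (hh : 0 < h) (A : ℝ) (v : Fin m → ℝ) :
    A ^ 2 * h * ∑ j, v j ^ 2 ≤ ∫ ξ, ‖pertFT h A v ξ‖ ^ 2 := by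
  have h1 := integral_indicator_norm_sq_trig (fun j => (v j : ℂ)) hh (a := 2) (b := 3)
    (by norm_num)
  have hi : Integrable fun ξ => ‖pertFT h A v ξ‖ ^ 2 := by
    have hc := continuous_pertFT h A v
    exact Continuous.integrable_of_hasCompactSupport (by fun_prop)
      (hasCompactSupport_of_annulus hh fun ξ hξ => by simp [pertFT_eq_zero h A v hξ])
  calc A ^ 2 * h * ∑ j, v j ^ 2
      = ∫ ξ, (A * h) ^ 2 * (Set.Icc (((2 : ℤ) : ℝ) / h) (((3 : ℤ) : ℝ) / h)).indicator
        (fun ξ => ‖trig (fun j => (v j : ℂ)) (h * ξ)‖ ^ 2) ξ := by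
        rw [integral_const_mul, h1]
        simp only [Complex.norm_real, Real.norm_eq_abs, sq_abs]
        push_cast
        field_simp
        ring
    _ ≤ _ := by
        refine integral_mono ((integrable_indicator_norm_sq_trig _ h _ isCompact_Icc).const_mul _)
          hi fun ξ => ?_
        by_cases hξ : ξ ∈ Set.Icc (((2 : ℤ) : ℝ) / h) (((3 : ℤ) : ℝ) / h)
        · simp only [Set.indicator_of_mem hξ]
          rw [norm_pertFT_sq, mul_pow]
          have hw : 1 ≤ window (h * ξ) := by
            refine one_le_window ?_
            push_cast at hξ
            rw [Set.mem_Icc, div_le_iff₀ hh, le_div_iff₀ hh] at hξ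
            constructor <;> nlinarith [hξ.1, hξ.2]
          refine mul_le_mul_of_nonneg_right ?_ (by positivity)
          have : 1 ≤ window (h * ξ) ^ 2 := by nlinarith
          nlinarith [sq_nonneg (A * h)]
        · simp only [Set.indicator_of_notMem hξ, mul_zero]
          positivity

/-! ### The perturbed densities -/

/-- The density `cauchy a` with a perturbation added. -/
noncomputable def perturbed {m : ℕ} (a h A : ℝ) (v : Fin m → ℝ) (x : ℝ) : ℝ :=
  cauchy a x + pert h A v x

theorem contDiff_perturbed {m : ℕ} {a : ℝ} (ha : 0 < a) (h A : ℝ) (v : Fin m → ℝ) {n : ℕ∞} :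
    ContDiff ℝ n (perturbed a h A v) := (contDiff_cauchy ha).add (contDiff_pert h A v)

/-- The derivative of order ⌊β⌋ is Lipschitz on a bounded interval, hence Hölder there of any
exponent at most 1. -/
theorem isClassC_of_contDiff {f : ℝ → ℝ} (hf : ∀ n : ℕ, ContDiff ℝ (n : ℕ∞) f) (β : ℝ) :
    IsClassC β f := by
  refine ⟨hf _, fun R => ?_⟩
  set k := ⌊β⌋₊
  have hd : ContDiff ℝ 1 (iteratedDeriv k f) := by
    have := hf (k + 1)
    rw [iteratedDeriv_eq_iterate]
    refine ContDiff.iterate_deriv' 1 k ?_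
    rw [add_comm]
    exact_mod_cast this
  obtain ⟨C, hC⟩ := isCompact_Icc.exists_bound_of_continuousOn (s := Set.Icc (-R) R)
    (hd.continuous_deriv le_rfl).continuousOn
  have hl : LipschitzOnWith C.toNNReal (iteratedDeriv k f) (Set.Icc (-R) R) := by
    refine (convex_Icc _ _).lipschitzOnWith_of_nnnorm_deriv_le
      (fun x _ => (hd.differentiable one_ne_zero) x) fun x hx => ?_
    rw [← NNReal.coe_le_coe, coe_nnnorm]
    exact (hC x hx).trans (Real.le_coe_toNNReal _)
  have hh := holderOnWith_one.2 hl
  refine ⟨_, hh.of_le (D := (2 * |R|).toNNReal) ?_ ?_⟩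
  · intro x hx y hy
    rw [edist_dist, Real.dist_eq]
    refine ENNReal.ofReal_le_ofReal ?_
    rw [abs_le]
    have := le_abs_self R
    constructor <;> linarith [hx.1, hx.2, hy.1, hy.2]
  · rw [← Real.toNNReal_one]
    refine Real.toNNReal_le_toNNReal ?_
    have := Nat.lt_floor_add_one β
    linarith

theorem charFn_perturbed {m : ℕ} {a h A : ℝ} (ha : 0 < a) (hh : 0 < h) (v : Fin m → ℝ)
    (hi : Integrable (pert h A v)) (ξ : ℝ) :
    charFn (perturbed a h A v) (2 * Real.pi * ξ) =
      ((Real.exp (-a * |ξ|) : ℝ) : ℂ) + pertFT h A v ξ := by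
  rw [← charFn_cauchy ha, ← charFn_pert hh A v hi]
  unfold charFn
  rw [← integral_add]
  · refine integral_congr_ae (Eventually.of_forall fun x => ?_)
    simp only [perturbed]
    push_cast
    ring
  all_goals
    refine Integrable.bdd_mul (c := 1) (Integrable.ofReal ?_)
      (Continuous.aestronglyMeasurable (by fun_prop)) (Eventually.of_forall fun x => ?_)
    · first | exact integrable_cauchy ha | exact hi
    · have : Complex.I * x * ((2 * Real.pi * ξ : ℝ) : ℂ) =
        ((x * (2 * Real.pi * ξ) : ℝ) : ℂ) * Complex.I := by push_cast; ring
      rw [this, Complex.norm_exp_ofReal_mul_I]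

section
variable {m : ℕ} {a h A : ℝ} {v : Fin m → ℝ}

/-- The total mass is the characteristic function at 0, a frequency outside the annulus, so the
perturbation contributes nothing. -/
theorem isDensity_perturbed (ha : 0 < a) (hh : 0 < h)
    (hle : ∀ x, |pert h A v x| ≤ cauchy a x) : IsDensity (perturbed a h A v) := by
  have hi := integrable_pert h A v ha hle
  refine ⟨fun x => ?_, (integrable_cauchy ha).add hi, ?_⟩
  · have := abs_le.1 (hle x)
    simp only [perturbed]; linarith [this.1]
  · have h0 := charFn_perturbed ha hh v hi 0
    rw [pertFT_eq_zero h A v (by simp)] at h0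
    simp only [mul_zero, abs_zero, Real.exp_zero, Complex.ofReal_one, charFn, Complex.ofReal_zero,
      Complex.exp_zero, one_mul, add_zero] at h0
    rw [integral_complex_ofReal] at h0
    exact_mod_cast h0

theorem perturbed_le (ha : 0 < a) (hle : ∀ x, |pert h A v x| ≤ cauchy a x) (x : ℝ) :
    perturbed a h A v x ≤ 4 / a := by
  have h1 := (abs_le.1 (hle x)).2
  have h2 := cauchy_le ha x
  have h3 : 4 / a = 2 / a + 2 / a := by ring
  simp only [perturbed]; linarith

theorem memLp_two_of_density_le {f : ℝ → ℝ} (hf : IsDensity f) {B : ℝ} (hB : ∀ x, f x ≤ B) :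
    MemLp f 2 := by
  refine (memLp_two_iff_integrable_sq hf.2.1.aestronglyMeasurable).2 ?_
  refine (hf.2.1.const_mul B).mono' (hf.2.1.aestronglyMeasurable.pow 2)
    (Eventually.of_forall fun x => ?_)
  rw [Real.norm_eq_abs, abs_of_nonneg (sq_nonneg _), sq]
  exact mul_le_mul_of_nonneg_right (hB x) (hf.1 x)

/-- By |x + y|² ≤ 2 |x|² + 2 |y|², a budget of L/4 for each summand is enough. -/
theorem perturbed_mem_sobolevClass {β L : ℝ} (hβ : 0 < β) (ha : 0 < a)
    (haI : Integrable fun ξ : ℝ => Real.exp (-a * |ξ|) ^ 2 * |2 * Real.pi * ξ| ^ (2 * β))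
    (haL : ∫ ξ : ℝ, Real.exp (-a * |ξ|) ^ 2 * |2 * Real.pi * ξ| ^ (2 * β) ≤ L / 4)
    (hh : 0 < h) (hle : ∀ x, |pert h A v x| ≤ cauchy a x)
    (hL : 32 * (8 * Real.pi) ^ (2 * β) * (A ^ 2 * h ^ (-(2 * β))) * (h * ∑ j, v j ^ 2) ≤ L / 4) :
    perturbed a h A v ∈ sobolevClass β L := by
  have hd := isDensity_perturbed ha hh hle
  have hi := integrable_pert h A v ha hle
  refine ⟨⟨hd, memLp_two_of_density_le hd (perturbed_le ha hle), ?_⟩,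
    isClassC_of_contDiff (fun n => contDiff_perturbed ha h A v) β⟩
  have h2 := (integral_pertFT_mul_rpow_le hh hβ A v).trans hL
  have hcont := continuous_pertFT h A v
  have hp : Continuous fun ξ : ℝ => |2 * Real.pi * ξ| ^ (2 * β) :=
    Continuous.rpow_const (by fun_prop) fun _ => Or.inr (by positivity)
  have hI2 : Integrable fun ξ => ‖pertFT h A v ξ‖ ^ 2 * |2 * Real.pi * ξ| ^ (2 * β) :=
    Continuous.integrable_of_hasCompactSupport (by fun_prop)
      (hasCompactSupport_of_annulus hh fun ξ hξ => by simp [pertFT_eq_zero h A v hξ])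
  have hsum : Integrable fun ξ : ℝ => 2 * (Real.exp (-a * |ξ|) ^ 2 * |2 * Real.pi * ξ| ^ (2 * β)) +
      2 * (‖pertFT h A v ξ‖ ^ 2 * |2 * Real.pi * ξ| ^ (2 * β)) :=
    (haI.const_mul 2).add (hI2.const_mul 2)
  rw [lintegral_comp_two_pi_mul, ENNReal.ofReal_mul (p := 2 * Real.pi) (q := L) (by positivity)]
  gcongr
  calc ∫⁻ ξ : ℝ, ENNReal.ofReal (‖charFn (perturbed a h A v) (2 * Real.pi * ξ)‖ ^ 2 *
        |2 * Real.pi * ξ| ^ (2 * β))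
      ≤ ∫⁻ ξ : ℝ, ENNReal.ofReal (2 * (Real.exp (-a * |ξ|) ^ 2 * |2 * Real.pi * ξ| ^ (2 * β)) +
      2 * (‖pertFT h A v ξ‖ ^ 2 * |2 * Real.pi * ξ| ^ (2 * β))) := by
        refine lintegral_mono fun ξ => ENNReal.ofReal_le_ofReal ?_
        rw [charFn_perturbed ha hh v hi, ← mul_assoc, ← mul_assoc, ← add_mul]
        refine mul_le_mul_of_nonneg_right ?_ (by positivity)
        have e := norm_add_le ((Real.exp (-a * |ξ|) : ℝ) : ℂ) (pertFT h A v ξ)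
        rw [Complex.norm_real, Real.norm_eq_abs, abs_of_pos (Real.exp_pos _)] at e
        have := pow_le_pow_left₀ (norm_nonneg _) e 2
        nlinarith [sq_nonneg (Real.exp (-a * |ξ|) - ‖pertFT h A v ξ‖)]
    _ = ENNReal.ofReal (∫ ξ : ℝ, (2 * (Real.exp (-a * |ξ|) ^ 2 * |2 * Real.pi * ξ| ^ (2 * β)) +
      2 * (‖pertFT h A v ξ‖ ^ 2 * |2 * Real.pi * ξ| ^ (2 * β)))) := by
        rw [ofReal_integral_eq_lintegral_ofReal hsum (Eventually.of_forall fun ξ => by positivity)]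
    _ ≤ ENNReal.ofReal L := by
        refine ENNReal.ofReal_le_ofReal ?_
        rw [integral_add (haI.const_mul 2) (hI2.const_mul 2), integral_const_mul,
          integral_const_mul]
        linarith

/-- On the annulus the Cauchy characteristic function e satisfies e² ≤ E = exp(-2a/h), and |p|² ≤ 2
|e + p|² + 2 e² then yields the pointwise bound with loss 2E, whatever the phase of the perturbation
p. The loss is integrated over an interval of length 8/h. -/
theorem integral_sq_perturbed_ge (ha : 0 < a) (hh : 0 < h)
    (hle : ∀ x, |pert h A v x| ≤ cauchy a x) :
    (∫ x, cauchy a x ^ 2) + (A ^ 2 * h * ∑ j, v j ^ 2) / 2 - 16 / h * Real.exp (-(2 * a / h)) ≤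
      ∫ x, perturbed a h A v x ^ 2 := by
  have hd := isDensity_perturbed ha hh hle
  have hi := integrable_pert h A v ha hle
  obtain ⟨hI, hp⟩ := integral_sq_eq_charFn hd (memLp_two_of_density_le hd (perturbed_le ha hle))
  have hd0 := isDensity_cauchy ha
  obtain ⟨hI0, hp0⟩ := integral_sq_eq_charFn hd0 (memLp_two_of_density_le hd0 (cauchy_le ha))
  have hcont := continuous_pertFT h A v
  have hIs : Integrable fun ξ => ‖pertFT h A v ξ‖ ^ 2 :=
    Continuous.integrable_of_hasCompactSupport (by fun_prop)
      (hasCompactSupport_of_annulus hh fun ξ hξ => by simp [pertFT_eq_zero h A v hξ])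
  set s : Set ℝ := Set.Icc (-(4 / h)) (4 / h)
  set E := Real.exp (-(2 * a / h))
  have hIe : Integrable (s.indicator fun _ : ℝ => 2 * E) :=
    (integrable_indicator_iff measurableSet_Icc).2 (integrableOn_const (by simp))
  have hIe' : ∫ ξ, s.indicator (fun _ : ℝ => 2 * E) ξ = 16 / h * E := by
    rw [integral_indicator measurableSet_Icc, setIntegral_const, smul_eq_mul, measureReal_def,
      Real.volume_Icc, ENNReal.toReal_ofReal (by rw [sub_neg_eq_add]; positivity)]
    ring
  have h1 : ∀ ξ : ℝ, ‖charFn (cauchy a) (2 * Real.pi * ξ)‖ ^ 2 + ‖pertFT h A v ξ‖ ^ 2 / 2 -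
      s.indicator (fun _ : ℝ => 2 * E) ξ ≤ ‖charFn (perturbed a h A v) (2 * Real.pi * ξ)‖ ^ 2 := by
    intro ξ
    rw [charFn_perturbed ha hh v hi, charFn_cauchy ha]
    by_cases hξ : 1 ≤ |h * ξ| ∧ |h * ξ| ≤ 4
    · rw [abs_mul, abs_of_pos hh] at hξ
      have hmem : ξ ∈ s := by
        rw [Set.mem_Icc, ← abs_le, le_div_iff₀ hh]
        linarith [hξ.2]
      have e := norm_sub_le (((Real.exp (-a * |ξ|) : ℝ) : ℂ) + pertFT h A v ξ)
        ((Real.exp (-a * |ξ|) : ℝ) : ℂ)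
      have hE : Real.exp (-a * |ξ|) ^ 2 ≤ E := by
        rw [← Real.exp_nat_mul]
        refine Real.exp_le_exp.2 ?_
        have : 1 / h ≤ |ξ| := by rw [div_le_iff₀ hh]; linarith [hξ.1]
        have h2 : a * (1 / h) ≤ a * |ξ| := by gcongr
        have h3 : 2 * a / h = 2 * (a * (1 / h)) := by ring
        push_cast
        rw [h3]; linarith
      rw [add_sub_cancel_left] at e
      rw [Set.indicator_of_mem hmem]
      rw [Complex.norm_real, Real.norm_eq_abs, abs_of_pos (Real.exp_pos _)] at e ⊢
      have h4 := pow_le_pow_left₀ (norm_nonneg _) e 2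
      nlinarith [sq_nonneg (Real.exp (-a * |ξ|) -
        ‖((Real.exp (-a * |ξ|) : ℝ) : ℂ) + pertFT h A v ξ‖)]
    · rw [pertFT_eq_zero h A v hξ, add_zero]
      have : 0 ≤ s.indicator (fun _ : ℝ => 2 * E) ξ :=
        Set.indicator_nonneg (fun _ _ => by positivity) _
      simp only [norm_zero]
      linarith
  have hge := integral_norm_sq_pertFT_ge hh A v
  rw [hp, hp0]
  have hI1 : Integrable fun ξ : ℝ => ‖charFn (cauchy a) (2 * Real.pi * ξ)‖ ^ 2 +
      ‖pertFT h A v ξ‖ ^ 2 / 2 := hI0.add (hIs.div_const 2)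
  refine le_trans ?_ (integral_mono (hI1.sub hIe) hI h1)
  simp only [Pi.sub_apply]
  rw [integral_sub hI1 hIe, integral_add hI0 (hIs.div_const 2), integral_div, hIe']
  linarith
end

/-! ### The size of a perturbation after convolution with the noise -/

/-- On the annulus |u| ≥ 1/h, and h ≤ 1/A₂ puts u in the range where Assumption (P) bounds the
derivative. Differentiating Φ^g gains a factor h. -/
theorem exists_norm_charFn_le_of_annulus {σ : ℝ} {g : ℝ → ℝ} (hg : IsPolynomialNoise σ g)
    (hP : AssumptionP σ g) : ∃ C h₀ : ℝ, 0 < C ∧ 0 < h₀ ∧ h₀ ≤ 1 ∧ ∀ h ξ : ℝ, 0 < h → h ≤ h₀ →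
      1 ≤ |h * ξ| → ‖charFn g (2 * Real.pi * ξ)‖ ≤ C * h ^ σ ∧
        ‖deriv (charFn g) (2 * Real.pi * ξ)‖ ≤ C * (h ^ σ * h) := by
  obtain ⟨c, C, hc, hC, hb⟩ := hg.exists_bounds
  obtain ⟨-, A₁, A₂, u₀, u₁, u₂, hA₁, hA₂, hu₀, hu₁, hu₂, -, h1, -⟩ := hP
  have hσ : 1 < σ := hg.2.2.1
  refine ⟨max C u₁, 1 / A₂, by positivity, by positivity,
    (div_le_one (by linarith)).2 hA₂.le, fun h ξ hh hh0 hξ => ?_⟩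
  rw [abs_mul, abs_of_pos hh] at hξ
  have hu : 1 / h ≤ |2 * Real.pi * ξ| := by
    rw [div_le_iff₀ hh, abs_mul, abs_of_pos (by positivity : (0 : ℝ) < 2 * Real.pi)]
    nlinarith [Real.pi_gt_three, abs_nonneg ξ]
  have hA : A₂ ≤ |2 * Real.pi * ξ| := by
    refine le_trans ?_ hu
    rw [le_div_iff₀ hh]
    rw [le_div_iff₀ (by linarith)] at hh0
    linarith
  have hpos : 0 < 1 / h := by positivity
  have hpow : ∀ s : ℝ, 0 < s → |2 * Real.pi * ξ| ^ (-s) ≤ h ^ s := by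
    intro s hs
    calc |2 * Real.pi * ξ| ^ (-s) ≤ (1 / h) ^ (-s) :=
          Real.rpow_le_rpow_of_nonpos hpos hu (by linarith)
      _ = h ^ s := by rw [one_div, Real.inv_rpow hh.le, Real.rpow_neg hh.le, inv_inv]
  constructor
  · calc ‖charFn g (2 * Real.pi * ξ)‖ ≤ C * (1 + |2 * Real.pi * ξ|) ^ (-σ) := (hb _).2
      _ ≤ C * |2 * Real.pi * ξ| ^ (-σ) := by
          gcongr C * ?_
          exact Real.rpow_le_rpow_of_nonpos (hpos.trans_le hu) (by linarith) (by linarith)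
      _ ≤ max C u₁ * h ^ σ := by
          refine mul_le_mul (le_max_left _ _) (hpow σ (by linarith)) (by positivity) (by positivity)
  · have h2 := h1 _ hA
    rw [iteratedDeriv_one] at h2
    calc ‖deriv (charFn g) (2 * Real.pi * ξ)‖ ≤ u₁ / |2 * Real.pi * ξ| ^ (σ + 1) := h2
      _ = u₁ * |2 * Real.pi * ξ| ^ (-(σ + 1)) := by
          rw [Real.rpow_neg (abs_nonneg _), div_eq_mul_inv]
      _ ≤ max C u₁ * (h ^ σ * h) := by
          rw [← Real.rpow_add_one hh.ne']
          refine mul_le_mul (le_max_right _ _) (hpow _ (by linarith)) (by positivity)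
            (by positivity)

/-- The inverse Fourier transform of a perturbation convolved with the noise. -/
noncomputable def noisyFT {m : ℕ} (g : ℝ → ℝ) (h A : ℝ) (v : Fin m → ℝ) (ξ : ℝ) : ℂ :=
  pertFT h A v ξ * charFn g (2 * Real.pi * ξ)

section
variable {m : ℕ} {σ h A C : ℝ} {g : ℝ → ℝ}

theorem noisyFT_eq_zero (v : Fin m → ℝ) {ξ : ℝ}
    (hξ : h * ξ ∉ {η : ℝ | 1 ≤ |η| ∧ |η| ≤ 4}) : noisyFT g h A v ξ = 0 := by
  simp [noisyFT, pertFT_eq_zero h A v hξ]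

theorem integral_norm_sq_noisyFT_le (hh : 0 < h)
    (hC : ∀ ξ : ℝ, 1 ≤ |h * ξ| → ‖charFn g (2 * Real.pi * ξ)‖ ≤ C * h ^ σ) (v : Fin m → ℝ) :
    ∫ ξ, ‖noisyFT g h A v ξ‖ ^ 2 ≤ 32 * C ^ 2 * (A ^ 2 * h * (h ^ σ) ^ 2 * ∑ j, v j ^ 2) := by
  have h1 := integral_le_of_le_trig hh (B := 4 * (A * h) ^ 2 * (C * h ^ σ) ^ 2)
    (by positivity) (fun j => (v j : ℂ)) (φ := fun ξ => ‖noisyFT g h A v ξ‖ ^ 2)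
    (fun ξ => by positivity) ?_ ?_
  · refine h1.trans (le_of_eq ?_)
    simp only [Complex.norm_real, Real.norm_eq_abs, sq_abs]
    field_simp
    ring
  · intro ξ hξ _
    rw [noisyFT, norm_mul, mul_pow]
    calc ‖pertFT h A v ξ‖ ^ 2 * ‖charFn g (2 * Real.pi * ξ)‖ ^ 2
        ≤ 4 * (A * h) ^ 2 * ‖trig (fun j => (v j : ℂ)) (h * ξ)‖ ^ 2 * (C * h ^ σ) ^ 2 := by
          gcongr
          · exact norm_pertFT_sq_le h A v ξ
          · exact hC ξ hξ
      _ = _ := by ring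
  · intro ξ hξ
    simp [noisyFT_eq_zero v hξ]

/-- A derivative costs only a constant. On the window it brings a factor h ≤ 1; on the trigonometric
polynomial, a factor 2πjh ≤ 2π because hm ≤ 1; on Φ^g, the extra h of Assumption (P). Each of the
three terms is then bounded by Parseval. -/
theorem integral_norm_sq_deriv_noisyFT_le {D : ℝ}
    (hD : ∀ η, |deriv window η| ≤ D) (hgc : ContDiff ℝ 1 (charFn g)) (hh : 0 < h) (hh1 : h ≤ 1)
    (hm : h * m ≤ 1)
    (hC : ∀ ξ : ℝ, 1 ≤ |h * ξ| → ‖charFn g (2 * Real.pi * ξ)‖ ≤ C * h ^ σ)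
    (hC' : ∀ ξ : ℝ, 1 ≤ |h * ξ| → ‖deriv (charFn g) (2 * Real.pi * ξ)‖ ≤ C * (h ^ σ * h))
    (v : Fin m → ℝ) :
    Differentiable ℝ (noisyFT g h A v) ∧ Continuous (deriv (noisyFT g h A v)) ∧
    (∀ ξ, h * ξ ∉ {η : ℝ | 1 ≤ |η| ∧ |η| ≤ 4} → deriv (noisyFT g h A v) ξ = 0) ∧
    ∫ ξ, ‖deriv (noisyFT g h A v) ξ‖ ^ 2 ≤
      24 * (D ^ 2 + 32 * Real.pi ^ 2) * C ^ 2 * (A ^ 2 * h * (h ^ σ) ^ 2 * ∑ j, v j ^ 2) := by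
  set T : ℝ → ℂ := trig fun j => (v j : ℂ) with hT
  set v' : Fin m → ℂ := fun j => 2 * Real.pi * (j : ℕ) * Complex.I * (v j : ℂ) with hv'
  set G : ℝ → ℂ := fun ξ => charFn g (2 * Real.pi * ξ) with hG
  set G' : ℝ → ℂ := fun ξ => deriv (charFn g) (2 * Real.pi * ξ) with hG'
  set w₁ : ℝ → ℂ := fun ξ => ((A * h * (deriv window (h * ξ) * h) : ℝ) : ℂ) * T (h * ξ) * G ξ
  set w₂ : ℝ → ℂ := fun ξ => ((A * h * window (h * ξ) : ℝ) : ℂ) * (trig v' (h * ξ) * h) * G ξ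
  set w₃ : ℝ → ℂ := fun ξ => ((A * h * window (h * ξ) : ℝ) : ℂ) * T (h * ξ) *
    (G' ξ * (2 * Real.pi : ℝ))
  have hder : ∀ ξ, HasDerivAt (noisyFT g h A v) (w₁ ξ + w₂ ξ + w₃ ξ) ξ := by
    intro ξ
    have e1 : HasDerivAt (fun ξ : ℝ => h * ξ) h ξ := by
      simpa using (hasDerivAt_id ξ).const_mul h
    have e2 : HasDerivAt (fun ξ : ℝ => 2 * Real.pi * ξ) (2 * Real.pi) ξ := by
      simpa using (hasDerivAt_id ξ).const_mul (2 * Real.pi)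
    have e3 : HasDerivAt window (deriv window (h * ξ)) (h * ξ) :=
      ((contDiff_window (n := 1)).differentiable one_ne_zero _).hasDerivAt
    have e4 : HasDerivAt (charFn g) (G' ξ) (2 * Real.pi * ξ) :=
      (hgc.differentiable one_ne_zero _).hasDerivAt
    have e5 : HasDerivAt (fun ξ : ℝ => ((A * h * window (h * ξ) : ℝ) : ℂ))
        ((A * h * (deriv window (h * ξ) * h) : ℝ) : ℂ) ξ :=
      ((e3.comp ξ e1).const_mul (A * h)).ofReal_comp
    have e6 : HasDerivAt (fun ξ : ℝ => T (h * ξ)) (trig v' (h * ξ) * h) ξ := by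
      have := (hasDerivAt_trig (fun j => (v j : ℂ)) (h * ξ)).scomp ξ e1
      rw [Complex.real_smul, mul_comm] at this
      exact this
    have e7 : HasDerivAt G (G' ξ * (2 * Real.pi : ℝ)) ξ := by
      have := e4.scomp ξ e2
      rw [Complex.real_smul, mul_comm _ (G' ξ)] at this
      exact this
    exact ((e5.mul e6).mul e7).congr_deriv (by simp only [w₁, w₂, w₃, Pi.mul_apply]; ring)
  have hd : deriv (noisyFT g h A v) = fun ξ => w₁ ξ + w₂ ξ + w₃ ξ := funext fun ξ => (hder ξ).deriv
  have cw : Continuous window := (contDiff_window (n := 0)).continuous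
  have cw' : Continuous (deriv window) := (contDiff_window (n := 1)).continuous_deriv le_rfl
  have cT : Continuous T := continuous_trig _
  have cT' : Continuous (trig v') := continuous_trig _
  have cG : Continuous G := hgc.continuous.comp (by fun_prop)
  have cG' : Continuous G' := (hgc.continuous_deriv le_rfl).comp (by fun_prop)
  have c₁ : Continuous w₁ := by fun_prop
  have c₂ : Continuous w₂ := by fun_prop
  have c₃ : Continuous w₃ := by fun_prop
  have z₁ : ∀ ξ, h * ξ ∉ {η : ℝ | 1 ≤ |η| ∧ |η| ≤ 4} → w₁ ξ = 0 := fun ξ hξ => by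
    simp [w₁, deriv_window_eq_zero hξ]
  have z₂ : ∀ ξ, h * ξ ∉ {η : ℝ | 1 ≤ |η| ∧ |η| ≤ 4} → w₂ ξ = 0 := fun ξ hξ => by
    simp [w₂, window_eq_zero hξ]
  have z₃ : ∀ ξ, h * ξ ∉ {η : ℝ | 1 ≤ |η| ∧ |η| ≤ 4} → w₃ ξ = 0 := fun ξ hξ => by
    simp [w₃, window_eq_zero hξ]
  have hI : ∀ {w : ℝ → ℂ}, Continuous w →
      (∀ ξ, h * ξ ∉ {η : ℝ | 1 ≤ |η| ∧ |η| ≤ 4} → w ξ = 0) → Integrable fun ξ => ‖w ξ‖ ^ 2 :=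
    fun hw hz => Continuous.integrable_of_hasCompactSupport (by fun_prop)
      (hasCompactSupport_of_annulus hh fun ξ hξ => by simp [hz ξ hξ])
  have hhσ : 0 < h ^ σ := Real.rpow_pos_of_pos hh σ
  have hwin : ∀ η, window η ^ 2 ≤ 4 := fun η => by
    have e1 := window_nonneg η
    have e2 := window_le_two η
    nlinarith
  have hV : 0 ≤ ∑ j, v j ^ 2 := Finset.sum_nonneg fun j _ => sq_nonneg _
  have b₁ : ∫ ξ, ‖w₁ ξ‖ ^ 2 ≤ 8 * D ^ 2 * C ^ 2 * (A ^ 2 * h * (h ^ σ) ^ 2 * ∑ j, v j ^ 2) := by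
    have h1 := integral_le_of_le_trig hh (B := (A * h) ^ 2 * (D * h) ^ 2 * (C * h ^ σ) ^ 2)
      (by positivity) (fun j => (v j : ℂ)) (φ := fun ξ => ‖w₁ ξ‖ ^ 2)
      (fun ξ => by positivity) ?_ fun ξ hξ => by simp [z₁ ξ hξ]
    · refine h1.trans ?_
      simp only [Complex.norm_real, Real.norm_eq_abs, sq_abs]
      have : 8 * ((A * h) ^ 2 * (D * h) ^ 2 * (C * h ^ σ) ^ 2) / h * ∑ j, v j ^ 2 =
          (8 * D ^ 2 * C ^ 2 * (A ^ 2 * h * (h ^ σ) ^ 2 * ∑ j, v j ^ 2)) * h ^ 2 := by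
        field_simp
      rw [this]
      refine mul_le_of_le_one_right (by positivity) (pow_le_one₀ hh.le hh1)
    · intro ξ hξ _
      have e1 := hC ξ hξ
      have e2 : (deriv window (h * ξ)) ^ 2 ≤ D ^ 2 := by
        rw [← sq_abs]; exact pow_le_pow_left₀ (abs_nonneg _) (hD _) 2
      have e3 : ‖G ξ‖ ^ 2 ≤ (C * h ^ σ) ^ 2 := pow_le_pow_left₀ (norm_nonneg _) e1 2
      simp only [w₁]
      rw [norm_mul, norm_mul, mul_pow, mul_pow, Complex.norm_real, Real.norm_eq_abs, sq_abs]
      calc (A * h * (deriv window (h * ξ) * h)) ^ 2 * ‖T (h * ξ)‖ ^ 2 * ‖G ξ‖ ^ 2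
          = (A * h) ^ 2 * ((deriv window (h * ξ)) ^ 2 * h ^ 2) * ‖T (h * ξ)‖ ^ 2 * ‖G ξ‖ ^ 2 := by
            ring
        _ ≤ (A * h) ^ 2 * (D ^ 2 * h ^ 2) * ‖T (h * ξ)‖ ^ 2 * (C * h ^ σ) ^ 2 := by gcongr
        _ = _ := by ring
  have b₂ : ∫ ξ, ‖w₂ ξ‖ ^ 2 ≤
      8 * (16 * Real.pi ^ 2) * C ^ 2 * (A ^ 2 * h * (h ^ σ) ^ 2 * ∑ j, v j ^ 2) := by
    have h1 := integral_le_of_le_trig hh (B := (A * h) ^ 2 * (4 * h ^ 2) * (C * h ^ σ) ^ 2)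
      (by positivity) v' (φ := fun ξ => ‖w₂ ξ‖ ^ 2)
      (fun ξ => by positivity) ?_ fun ξ hξ => by simp [z₂ ξ hξ]
    · refine h1.trans ?_
      have hv2 : ∑ j, ‖v' j‖ ^ 2 ≤ 4 * Real.pi ^ 2 * (m : ℝ) ^ 2 * ∑ j, v j ^ 2 := by
        rw [Finset.mul_sum]
        refine Finset.sum_le_sum fun j _ => ?_
        have hj : ((j : ℕ) : ℝ) ≤ m := by exact_mod_cast j.2.le
        have e : v' j = ((2 * Real.pi * (j : ℕ) * v j : ℝ) : ℂ) * Complex.I := by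
          simp only [hv']; push_cast; ring
        rw [e, norm_mul, Complex.norm_I, mul_one, Complex.norm_real, Real.norm_eq_abs, sq_abs]
        calc (2 * Real.pi * (j : ℕ) * v j) ^ 2 = 4 * Real.pi ^ 2 * ((j : ℕ) : ℝ) ^ 2 * v j ^ 2 := by
              ring
          _ ≤ _ := by gcongr
      calc 8 * ((A * h) ^ 2 * (4 * h ^ 2) * (C * h ^ σ) ^ 2) / h * ∑ j, ‖v' j‖ ^ 2
          ≤ 8 * ((A * h) ^ 2 * (4 * h ^ 2) * (C * h ^ σ) ^ 2) / h *
            (4 * Real.pi ^ 2 * (m : ℝ) ^ 2 * ∑ j, v j ^ 2) := by gcongr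
        _ = (8 * (16 * Real.pi ^ 2) * C ^ 2 * (A ^ 2 * h * (h ^ σ) ^ 2 * ∑ j, v j ^ 2)) *
            (h * m) ^ 2 := by field_simp; ring
        _ ≤ _ := mul_le_of_le_one_right (by positivity) (pow_le_one₀ (by positivity) hm)
    · intro ξ hξ _
      have e3 : ‖G ξ‖ ^ 2 ≤ (C * h ^ σ) ^ 2 := pow_le_pow_left₀ (norm_nonneg _) (hC ξ hξ) 2
      have e2 := hwin (h * ξ)
      simp only [w₂]
      rw [norm_mul, norm_mul, norm_mul, mul_pow, mul_pow, mul_pow, Complex.norm_real,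
        Complex.norm_real, Real.norm_eq_abs, sq_abs, Real.norm_eq_abs, sq_abs]
      calc (A * h * window (h * ξ)) ^ 2 * (‖trig v' (h * ξ)‖ ^ 2 * h ^ 2) * ‖G ξ‖ ^ 2
          = (A * h) ^ 2 * (window (h * ξ) ^ 2 * h ^ 2) * ‖trig v' (h * ξ)‖ ^ 2 * ‖G ξ‖ ^ 2 := by
            ring
        _ ≤ (A * h) ^ 2 * (4 * h ^ 2) * ‖trig v' (h * ξ)‖ ^ 2 * (C * h ^ σ) ^ 2 := by gcongr
        _ = _ := by ring
  have b₃ : ∫ ξ, ‖w₃ ξ‖ ^ 2 ≤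
      8 * (16 * Real.pi ^ 2) * C ^ 2 * (A ^ 2 * h * (h ^ σ) ^ 2 * ∑ j, v j ^ 2) := by
    have h1 := integral_le_of_le_trig hh
      (B := (A * h) ^ 2 * (16 * Real.pi ^ 2) * (C * (h ^ σ * h)) ^ 2)
      (by positivity) (fun j => (v j : ℂ)) (φ := fun ξ => ‖w₃ ξ‖ ^ 2)
      (fun ξ => by positivity) ?_ fun ξ hξ => by simp [z₃ ξ hξ]
    · refine h1.trans ?_
      simp only [Complex.norm_real, Real.norm_eq_abs, sq_abs]
      have : 8 * ((A * h) ^ 2 * (16 * Real.pi ^ 2) * (C * (h ^ σ * h)) ^ 2) / h * ∑ j, v j ^ 2 =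
          (8 * (16 * Real.pi ^ 2) * C ^ 2 * (A ^ 2 * h * (h ^ σ) ^ 2 * ∑ j, v j ^ 2)) * h ^ 2 := by
        field_simp
      rw [this]
      refine mul_le_of_le_one_right (by positivity) (pow_le_one₀ hh.le hh1)
    · intro ξ hξ _
      have e3 : ‖G' ξ‖ ^ 2 ≤ (C * (h ^ σ * h)) ^ 2 :=
        pow_le_pow_left₀ (norm_nonneg _) (hC' ξ hξ) 2
      have e2 := hwin (h * ξ)
      simp only [w₃]
      rw [norm_mul, norm_mul, norm_mul, mul_pow, mul_pow, mul_pow, Complex.norm_real,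
        Complex.norm_real, Real.norm_eq_abs, sq_abs, Real.norm_eq_abs, sq_abs]
      calc (A * h * window (h * ξ)) ^ 2 * ‖T (h * ξ)‖ ^ 2 * (‖G' ξ‖ ^ 2 * (2 * Real.pi) ^ 2)
          = (A * h) ^ 2 * (4 * window (h * ξ) ^ 2 * Real.pi ^ 2) * ‖T (h * ξ)‖ ^ 2 *
            ‖G' ξ‖ ^ 2 := by ring
        _ ≤ (A * h) ^ 2 * (4 * 4 * Real.pi ^ 2) * ‖T (h * ξ)‖ ^ 2 *
            (C * (h ^ σ * h)) ^ 2 := by gcongr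
        _ = _ := by ring
  refine ⟨fun ξ => (hder ξ).differentiableAt, ?_, fun ξ hξ => ?_, ?_⟩
  · rw [hd]; fun_prop
  · rw [hd]; simp [z₁ ξ hξ, z₂ ξ hξ, z₃ ξ hξ]
  · rw [hd]
    have i12 : Integrable fun ξ => ‖w₁ ξ‖ ^ 2 + ‖w₂ ξ‖ ^ 2 := (hI c₁ z₁).add (hI c₂ z₂)
    have i123 : Integrable fun ξ => ‖w₁ ξ‖ ^ 2 + ‖w₂ ξ‖ ^ 2 + ‖w₃ ξ‖ ^ 2 := i12.add (hI c₃ z₃)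
    calc ∫ ξ, ‖w₁ ξ + w₂ ξ + w₃ ξ‖ ^ 2
        ≤ ∫ ξ, 3 * (‖w₁ ξ‖ ^ 2 + ‖w₂ ξ‖ ^ 2 + ‖w₃ ξ‖ ^ 2) := by
          refine integral_mono_of_nonneg (Eventually.of_forall fun ξ => by positivity)
            (i123.const_mul 3) (Eventually.of_forall fun ξ => ?_)
          have e := norm_add₃_le (a := w₁ ξ) (b := w₂ ξ) (c := w₃ ξ)
          have := pow_le_pow_left₀ (norm_nonneg _) e 2
          simp only
          nlinarith [sq_nonneg (‖w₁ ξ‖ - ‖w₂ ξ‖), sq_nonneg (‖w₂ ξ‖ - ‖w₃ ξ‖),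
            sq_nonneg (‖w₁ ξ‖ - ‖w₃ ξ‖)]
      _ ≤ _ := by
          rw [integral_const_mul, integral_add i12 (hI c₃ z₃), integral_add (hI c₁ z₁) (hI c₂ z₂)]
          nlinarith [b₁, b₂, b₃]
end

/-- The weight is at most (1 + x²)/c; by Plancherel the part 1 is the squared norm of `noisyFT` and
the part x² that of its derivative. -/
theorem exists_integral_convLaw_pert_sq_div_le {σ a : ℝ} {g : ℝ → ℝ} (hg : IsPolynomialNoise σ g)
    (hP : AssumptionP σ g) (ha : 0 < a) :
    ∃ C h₀ : ℝ, 0 < C ∧ 0 < h₀ ∧ h₀ ≤ 1 ∧ ∀ (m : ℕ) (h A : ℝ) (v : Fin m → ℝ), 0 < h → h ≤ h₀ →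
      h * m ≤ 1 →
      ∫ x, convLaw (law g) (pert h A v) x ^ 2 / convLaw (law g) (cauchy a) x ≤
        C * (A ^ 2 * h * (h ^ σ) ^ 2 * ∑ j, v j ^ 2) := by
  obtain ⟨C, h₀, hC, hh₀, hh₀1, hb⟩ := exists_norm_charFn_le_of_annulus hg hP
  obtain ⟨D, hD, hDb⟩ := exists_abs_deriv_window_le
  obtain ⟨c, hc, hcb⟩ := exists_le_convLaw_cauchy ha hg.1
  have hgc : ContDiff ℝ 1 (charFn g) := hP.1.of_le (by norm_num)
  refine ⟨c⁻¹ * (32 * C ^ 2 + 24 * (D ^ 2 + 32 * Real.pi ^ 2) * C ^ 2), h₀, by positivity, hh₀,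
    hh₀1, fun m h A v hh hhh hm => ?_⟩
  have b1 := integral_norm_sq_noisyFT_le (A := A) hh (fun ξ hξ => (hb h ξ hh hhh hξ).1) v
  obtain ⟨hdiff, hdc, hdz, b2⟩ := integral_norm_sq_deriv_noisyFT_le (A := A) hDb hgc hh
    (hhh.trans hh₀1) hm (fun ξ hξ => (hb h ξ hh hhh hξ).1) (fun ξ hξ => (hb h ξ hh hhh hξ).2) v
  set w := noisyFT g h A v with hw
  have hwz : ∀ ξ, h * ξ ∉ {η : ℝ | 1 ≤ |η| ∧ |η| ≤ 4} → w ξ = 0 := fun ξ hξ =>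
    noisyFT_eq_zero v hξ
  have hws : HasCompactSupport w := hasCompactSupport_of_annulus hh hwz
  have hds : HasCompactSupport (deriv w) := hasCompactSupport_of_annulus hh hdz
  have hwc : Continuous w := hdiff.continuous
  have hwi : Integrable w := hwc.integrable_of_hasCompactSupport hws
  have hdi : Integrable (deriv w) := hdc.integrable_of_hasCompactSupport hds
  have hw2 : MemLp w 2 := hwc.memLp_of_hasCompactSupport hws
  have hd2 : MemLp (deriv w) 2 := hdc.memLp_of_hasCompactSupport hds
  have hF : ∀ x, ((convLaw (law g) (pert h A v) x : ℝ) : ℂ) = 𝓕 w x := fun x =>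
    convLaw_eq_fourier (integrable_pertFT hh A v) (fun x => pert_eq_fourier hh A v x) hg.1 x
  have hF2 : ∀ x, ‖𝓕 w x‖ ^ 2 = convLaw (law g) (pert h A v) x ^ 2 := fun x => by
    rw [← hF, Complex.norm_real, Real.norm_eq_abs, sq_abs]
  have hFd : ∀ x, ‖𝓕 (deriv w) x‖ ^ 2 =
      4 * Real.pi ^ 2 * (x ^ 2 * convLaw (law g) (pert h A v) x ^ 2) := fun x => by
    rw [Real.fourier_deriv hwi hdiff hdi, norm_smul, mul_pow, hF2]
    simp only [norm_mul, Complex.norm_real, Complex.norm_I, Real.norm_eq_abs, mul_pow, sq_abs]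
    norm_num
    ring
  have p1 := integral_norm_sq_fourier hwi hw2
  have p2 := integral_norm_sq_fourier hdi hd2
  have i1 : Integrable fun x => ‖𝓕 w x‖ ^ 2 := (memLp_fourier hwi hw2).integrable_norm_pow
    (by norm_num)
  have i2 : Integrable fun x => ‖𝓕 (deriv w) x‖ ^ 2 := (memLp_fourier hdi hd2).integrable_norm_pow
    (by norm_num)
  have hp0 : ∀ x, 0 < convLaw (law g) (cauchy a) x := fun x =>
    lt_of_lt_of_le (by positivity) (hcb x)
  calc ∫ x, convLaw (law g) (pert h A v) x ^ 2 / convLaw (law g) (cauchy a) x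
      ≤ ∫ x, c⁻¹ * (‖𝓕 w x‖ ^ 2 + ‖𝓕 (deriv w) x‖ ^ 2) := by
        refine integral_mono_of_nonneg (Eventually.of_forall fun x =>
          div_nonneg (sq_nonneg _) (hp0 x).le) ((i1.add i2).const_mul _)
          (Eventually.of_forall fun x => ?_)
        simp only
        rw [hF2, hFd]
        set F2 := convLaw (law g) (pert h A v) x ^ 2 with hF2'
        have hF20 : 0 ≤ F2 := sq_nonneg _
        have hpi : 1 ≤ 4 * Real.pi ^ 2 := by nlinarith [Real.pi_gt_three]
        calc F2 / convLaw (law g) (cauchy a) x ≤ F2 / (c / (1 + x ^ 2)) := by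
              gcongr; exact hcb x
          _ = c⁻¹ * (F2 + 1 * (x ^ 2 * F2)) := by field_simp
          _ ≤ _ := by gcongr
    _ = c⁻¹ * (∫ ξ, ‖w ξ‖ ^ 2) + c⁻¹ * ∫ ξ, ‖deriv w ξ‖ ^ 2 := by
        rw [integral_const_mul, integral_add i1 i2, p1, p2]; ring
    _ ≤ c⁻¹ * (32 * C ^ 2 * (A ^ 2 * h * (h ^ σ) ^ 2 * ∑ j, v j ^ 2)) +
        c⁻¹ * (24 * (D ^ 2 + 32 * Real.pi ^ 2) * C ^ 2 *
          (A ^ 2 * h * (h ^ σ) ^ 2 * ∑ j, v j ^ 2)) := by gcongr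
    _ = _ := by ring

/-! ### Reduction to a mixture of perturbations -/

/-- The density of the noisy perturbation relative to the noisy Cauchy density. -/
noncomputable def relPert {m : ℕ} (g : ℝ → ℝ) (a h A : ℝ) (v : Fin m → ℝ) (x : ℝ) : ℝ :=
  convLaw (law g) (pert h A v) x / convLaw (law g) (cauchy a) x

section
variable {m : ℕ} {a h A : ℝ} {g : ℝ → ℝ} {v : Fin m → ℝ}

theorem measurable_pert (h A : ℝ) (v : Fin m → ℝ) : Measurable (pert h A v) :=
  (contDiff_pert h A v (n := 0)).continuous.measurable

theorem measurable_cauchy (ha : 0 < a) : Measurable (cauchy a) :=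
  (contDiff_cauchy ha (n := 0)).continuous.measurable

theorem convLaw_cauchy_pos (hg : IsDensity g) (ha : 0 < a) (x : ℝ) :
    0 < convLaw (law g) (cauchy a) x := by
  obtain ⟨c, hc, h⟩ := exists_le_convLaw_cauchy ha hg
  exact lt_of_lt_of_le (by positivity) (h x)

theorem measurable_relPert (hg : IsDensity g) (ha : 0 < a) : Measurable (relPert g a h A v) := by
  have := isProbabilityMeasure_law hg
  exact (measurable_convLaw _ (measurable_pert h A v)).div
    (measurable_convLaw _ (measurable_cauchy ha))

theorem abs_pert_le_const (ha : 0 < a) (hle : ∀ x, |pert h A v x| ≤ cauchy a x / 2) (x : ℝ) :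
    |pert h A v x| ≤ 2 / a := by
  have := hle x
  have := cauchy_le ha x
  have := cauchy_pos ha x
  linarith

/-- Convolution with a probability law preserves pointwise domination. The margin 1/2 keeps all
likelihood ratios positive. -/
theorem abs_relPert_le (hg : IsDensity g) (ha : 0 < a)
    (hle : ∀ x, |pert h A v x| ≤ cauchy a x / 2) (x : ℝ) : |relPert g a h A v x| ≤ 1 / 2 := by
  have := isProbabilityMeasure_law hg
  have hp := convLaw_cauchy_pos hg ha x
  rw [relPert, abs_div, abs_of_pos hp, div_le_iff₀ hp, convLaw, convLaw, ← integral_const_mul]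
  refine (abs_integral_le_integral_abs).trans (integral_mono
    (integrable_comp_sub _ (measurable_pert h A v) (abs_pert_le_const ha hle) x).abs
    ((integrable_comp_sub _ (measurable_cauchy ha) (B := 2 / a) (fun y => ?_) x).const_mul _)
    fun y => ?_)
  · rw [abs_of_pos (cauchy_pos ha y)]; exact cauchy_le ha y
  · have := hle (x - y)
    simp only
    linarith

theorem marginal_perturbed (hg : IsDensity g) (ha : 0 < a) (hh : 0 < h)
    (hle : ∀ x, |pert h A v x| ≤ cauchy a x / 2) :
    marginal (perturbed a h A v) g =
      (marginal (cauchy a) g).withDensity fun x => ENNReal.ofReal (1 + relPert g a h A v x) := by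
  have := isProbabilityMeasure_law hg
  have hle' : ∀ x, |pert h A v x| ≤ cauchy a x := fun x => by
    linarith [hle x, cauchy_pos ha x]
  have hm := measurable_convLaw (law g) (measurable_cauchy ha)
  have hm1 : Measurable fun x => 1 + relPert g a h A v x :=
    measurable_const.add (measurable_relPert hg ha)
  rw [marginal_eq_withDensity (isDensity_perturbed ha hh hle') hg
    (contDiff_perturbed ha h A v (n := 0)).continuous.measurable (perturbed_le ha hle'),
    marginal_eq_withDensity (isDensity_cauchy ha) hg (measurable_cauchy ha) (cauchy_le ha),
    ← withDensity_mul _ hm.ennreal_ofReal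
      hm1.ennreal_ofReal]
  congr 1
  funext x
  have hp := convLaw_cauchy_pos hg ha x
  rw [Pi.mul_apply, ← ENNReal.ofReal_mul hp.le]
  congr 1
  rw [relPert, mul_add, mul_one, mul_div_cancel₀ _ hp.ne']
  exact integral_add (integrable_comp_sub _ (measurable_cauchy ha) (B := 2 / a) (fun y => by
      rw [abs_of_pos (cauchy_pos ha y)]; exact cauchy_le ha y) x)
    (integrable_comp_sub _ (measurable_pert h A v) (abs_pert_le_const ha hle) x)

/-- Both noisy laws have total mass one. -/
theorem integral_relPert (hg : IsDensity g) (ha : 0 < a) (hh : 0 < h)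
    (hle : ∀ x, |pert h A v x| ≤ cauchy a x / 2) :
    ∫ x, relPert g a h A v x ∂(marginal (cauchy a) g) = 0 := by
  have hle' : ∀ x, |pert h A v x| ≤ cauchy a x := fun x => by
    linarith [hle x, cauchy_pos ha x]
  have h0 := isProbabilityMeasure_marginal (isDensity_cauchy ha) hg
  have h1 := (isProbabilityMeasure_marginal (isDensity_perturbed ha hh hle') hg).measure_univ
  have hi : Integrable (relPert g a h A v) (marginal (cauchy a) g) :=
    Integrable.of_bound (measurable_relPert hg ha).aestronglyMeasurable (1 / 2)
      (Eventually.of_forall fun x => abs_relPert_le hg ha hle x)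
  have hi1 : Integrable (fun x => 1 + relPert g a h A v x) (marginal (cauchy a) g) :=
    (integrable_const 1).add hi
  rw [marginal_perturbed hg ha hh hle, withDensity_apply _ MeasurableSet.univ,
    Measure.restrict_univ, ← ofReal_integral_eq_lintegral_ofReal hi1
      (Eventually.of_forall fun x => by
        have := (abs_le.1 (abs_relPert_le hg ha hle x)).1
        simp only [Pi.zero_apply]; linarith), integral_add (integrable_const 1) hi,
    integral_const, probReal_univ, one_smul, ENNReal.ofReal_eq_one] at h1
  linarith

theorem obsLaw_perturbed (hg : IsDensity g) (ha : 0 < a) (hh : 0 < h)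
    (hle : ∀ x, |pert h A v x| ≤ cauchy a x / 2) (n : ℕ) :
    obsLaw (perturbed a h A v) g n = (obsLaw (cauchy a) g n).withDensity
      fun y => ENNReal.ofReal (∏ i, (1 + relPert g a h A v (y i))) := by
  have h0 := isProbabilityMeasure_marginal (isDensity_cauchy ha) hg
  have h1 := pi_withDensity_ofReal (n := n) (marginal (cauchy a) g)
    (ρ := fun x => 1 + relPert g a h A v x) (measurable_const.add (measurable_relPert hg ha))
    (B := 3 / 2)
    (fun x => by linarith [(abs_le.1 (abs_relPert_le hg ha hle x)).1])
    (fun x => by linarith [(abs_le.1 (abs_relPert_le hg ha hle x)).2])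
  rw [← marginal_perturbed hg ha hh hle] at h1
  exact h1

/-- Linearity in v, which holds for every v: the domination hypothesis is needed only for the unit
vectors, to have each summand integrable. -/
theorem relPert_eq_sum (hg : IsDensity g) (ha : 0 < a)
    (hle : ∀ v : Fin m → ℝ, (∀ j, |v j| ≤ 1) → ∀ x, |pert h A v x| ≤ cauchy a x / 2)
    (v : Fin m → ℝ) (x : ℝ) :
    relPert g a h A v x = ∑ j, v j * relPert g a h A (Pi.single j 1 : Fin m → ℝ) x := by
  have := isProbabilityMeasure_law hg
  have hs : ∀ j : Fin m, ∀ x, |pert h A (Pi.single j 1 : Fin m → ℝ) x| ≤ cauchy a x / 2 :=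
    fun j => hle _ fun i => by
      rcases eq_or_ne i j with rfl | hij
      · simp
      · simp [Pi.single_eq_of_ne hij]
  have hp : ∀ x, pert h A v x = ∑ j, v j * pert h A (Pi.single j 1 : Fin m → ℝ) x := fun x => by
    simp only [pert, Pi.single_apply, ite_mul, one_mul, zero_mul, Finset.sum_ite_eq',
      Finset.mem_univ, if_true, Finset.mul_sum]
    refine Finset.sum_congr rfl fun j _ => by ring
  have hi : ∀ j ∈ Finset.univ, Integrable
      (fun y => v j * pert h A (Pi.single j 1 : Fin m → ℝ) (x - y)) (law g) := fun j _ =>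
    (integrable_comp_sub _ (measurable_pert _ _ _) (abs_pert_le_const ha (hs j)) x).const_mul _
  simp only [relPert, convLaw, hp]
  rw [integral_finsetSum _ hi, Finset.sum_div]
  refine Finset.sum_congr rfl fun j _ => ?_
  rw [integral_const_mul, mul_div_assoc]

theorem integral_relPert_sq (hg : IsDensity g) (ha : 0 < a) (v : Fin m → ℝ) :
    ∫ x, relPert g a h A v x ^ 2 ∂(marginal (cauchy a) g) =
      ∫ x, convLaw (law g) (pert h A v) x ^ 2 / convLaw (law g) (cauchy a) x := by
  have := isProbabilityMeasure_law hg
  have hm := measurable_convLaw (law g) (measurable_cauchy ha)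
  rw [marginal_eq_withDensity (isDensity_cauchy ha) hg (measurable_cauchy ha) (cauchy_le ha),
    integral_withDensity_eq_integral_toReal_smul hm.ennreal_ofReal
      (Eventually.of_forall fun x => ENNReal.ofReal_lt_top)]
  refine integral_congr_ae (Eventually.of_forall fun x => ?_)
  have hp := convLaw_cauchy_pos hg ha x
  simp only [smul_eq_mul, relPert, ENNReal.toReal_ofReal hp.le]
  field_simp

/-- The relative perturbations r have mean zero, so by independence the mixed moment of two
likelihood ratios is (1 + ∫ r r')^n, the quantity bounded by `sum_sum_pow_le_exp`. -/
theorem le_risk_of_perturbed (hg : IsDensity g) (ha : 0 < a) (hh : 0 < h)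
    (hle : ∀ v : Fin m → ℝ, (∀ j, |v j| ≤ 1) → ∀ x, |pert h A v x| ≤ cauchy a x / 2)
    {Λ K s R : ℝ} (hΛ : 0 < Λ)
    (hΛr : ∀ v : Fin m → ℝ, ∫ x, convLaw (law g) (pert h A v) x ^ 2 /
      convLaw (law g) (cauchy a) x ≤ Λ * ∑ j, v j ^ 2) {n : ℕ}
    (hK1 : 1 ≤ K) (hK : Real.exp ((n : ℝ) ^ 2 * Λ ^ 2 * m / 2) ≤ K) (hs : 0 < s) (hR : 0 ≤ R)
    (hd : ∀ θ : Fin m → Bool, (∫ x, cauchy a x ^ 2) + 2 * s ≤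
      ∫ x, perturbed a h A (fun j => boolSign (θ j)) x ^ 2)
    {δ : (Fin n → ℝ) → ℝ} (hδ : Measurable δ)
    (hR0 : risk (cauchy a) g n δ ≤ ENNReal.ofReal R)
    (hR1 : ∀ θ : Fin m → Bool, risk (perturbed a h A fun j => boolSign (θ j)) g n δ ≤
      ENNReal.ofReal R) : s / (4 * K) ≤ R := by
  set μ := marginal (cauchy a) g with hμ
  have h0 : IsProbabilityMeasure μ := isProbabilityMeasure_marginal (isDensity_cauchy ha) hg
  set r : (Fin m → Bool) → ℝ → ℝ := fun θ => relPert g a h A fun j => boolSign (θ j) with hr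
  have hsgn : ∀ (θ : Fin m → Bool) (j : Fin m), |boolSign (θ j)| ≤ 1 := fun θ j =>
    (abs_boolSign _).le
  have hsingle : ∀ j : Fin m, ∀ i, |(Pi.single j 1 : Fin m → ℝ) i| ≤ 1 := fun j i => by
    rcases eq_or_ne i j with rfl | hij
    · simp
    · simp [Pi.single_eq_of_ne hij]
  have hrm : ∀ θ, Measurable (r θ) := fun θ => measurable_relPert hg ha
  have hrb : ∀ θ x, |r θ x| ≤ 1 / 2 := fun θ x => abs_relPert_le hg ha (hle _ (hsgn θ)) x
  have hri : ∀ θ, Integrable (r θ) μ := fun θ =>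
    Integrable.of_bound (hrm θ).aestronglyMeasurable (1 / 2) (Eventually.of_forall (hrb θ))
  have hr0 : ∀ θ, ∫ x, r θ x ∂μ = 0 := fun θ => integral_relPert hg ha hh (hle _ (hsgn θ))
  have hrs : ∀ θ x, r θ x = ∑ j, boolSign (θ j) * relPert g a h A (Pi.single j 1 : Fin m → ℝ) x :=
    fun θ x => relPert_eq_sum hg ha hle _ x
  set ℓ : (Fin m → Bool) → (Fin n → ℝ) → ℝ := fun θ y => ∏ i, (1 + r θ (y i)) with hℓ
  have hfac : ∀ θ x, 0 ≤ 1 + r θ x := fun θ x => by linarith [(abs_le.1 (hrb θ x)).1]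
  have hP : obsLaw (cauchy a) g n = Measure.pi fun _ => μ := rfl
  have hPp : IsProbabilityMeasure (obsLaw (cauchy a) g n) := by rw [hP]; infer_instance
  refine le_risk_of_mixture (obsLaw (cauchy a) g n) (ℓ := ℓ) (fun θ => ?_) (B := 2 ^ n)
    (fun θ y => Finset.prod_nonneg fun i _ => hfac θ _) (fun θ y => ?_) (fun θ => ?_) hK1 ?_ hδ
    hs hR hd hR0 fun θ => ?_
  · exact Finset.measurable_prod _ fun i _ => measurable_const.add ((hrm θ).comp (measurable_pi_apply i))
  · calc ℓ θ y ≤ ∏ _i : Fin n, (2 : ℝ) := Finset.prod_le_prod (fun i _ => hfac θ _) fun i _ => by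
          linarith [(abs_le.1 (hrb θ (y i))).2]
      _ = 2 ^ n := by simp
  · rw [hP, integral_fintype_prod_eq_prod (f := fun (_ : Fin n) x => 1 + r θ x)]
    have : ∫ x, (1 + r θ x) ∂μ = 1 := by
      rw [integral_add (integrable_const 1) (hri θ), hr0 θ]; simp
    simp [this]
  · have hprod : ∀ θ θ', ∫ y, ℓ θ y * ℓ θ' y ∂(obsLaw (cauchy a) g n) =
        (1 + ∫ x, r θ x * r θ' x ∂μ) ^ n := by
      intro θ θ'
      simp only [hℓ, ← Finset.prod_mul_distrib]
      rw [hP, integral_fintype_prod_eq_prod (f := fun (_ : Fin n) x => (1 + r θ x) * (1 + r θ' x)),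
        Finset.prod_const, Finset.card_univ, Fintype.card_fin]
      congr 1
      have hmul : Integrable (fun x => r θ x * r θ' x) μ :=
        (hri θ').bdd_mul (c := 1 / 2) (hrm θ).aestronglyMeasurable (Eventually.of_forall (hrb θ))
      have i1 : Integrable (fun x => 1 + r θ x) μ := (integrable_const 1).add (hri θ)
      have i2 : Integrable (fun x => 1 + r θ x + r θ' x) μ := i1.add (hri θ')
      calc ∫ x, (1 + r θ x) * (1 + r θ' x) ∂μ
          = ∫ x, (1 + r θ x + r θ' x) + r θ x * r θ' x ∂μ := by
            refine integral_congr_ae (Eventually.of_forall fun x => ?_)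
            simp only; ring
        _ = _ := by
            rw [integral_add i2 hmul, integral_add i1 (hri θ'),
              integral_add (integrable_const 1) (hri θ), hr0, hr0]
            simp
    have key := sum_sum_pow_le_exp (n := n) μ
      (r := fun j => relPert g a h A (Pi.single j 1 : Fin m → ℝ))
      (fun j => measurable_relPert hg ha) (B := 1 / 2)
      (fun j x => abs_relPert_le hg ha (hle _ (hsingle j)) x) hΛ (fun v => ?_) (fun θ x => ?_)
    · simp only [hprod]
      simp only [← hrs] at key
      exact key.trans (mul_le_mul_of_nonneg_right hK (by positivity))
    · refine le_trans (le_of_eq ?_) (hΛr v)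
      rw [← integral_relPert_sq hg ha v]
      simp only [relPert_eq_sum hg ha hle v]
      rfl
    · rw [← hrs]; linarith [hrb θ x]
  · have := hR1 θ
    rw [risk, obsLaw_perturbed hg ha hh (hle _ (hsgn θ))] at this
    exact this

end

theorem tendsto_bandwidth {β σ : ℝ} (hβ : 0 < β) (hσ : 0 < σ) :
    Tendsto (bandwidth β σ) atTop (𝓝[>] 0) := by
  refine tendsto_nhdsWithin_iff.2 ⟨?_, ?_⟩
  · have h := (tendsto_rpow_neg_atTop (y := 2 / (4 * β + 4 * σ + 1)) (by positivity)).comp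
      tendsto_natCast_atTop_atTop
    refine h.congr fun n => ?_
    simp only [Function.comp_apply, bandwidth, neg_div]
  · filter_upwards [eventually_ge_atTop 1] with n hn
    exact bandwidth_pos hn

/-- The exponential cross term is negligible against any power of h. -/
theorem eventually_exp_neg_div_le {a c p : ℝ} (ha : 0 < a) (hc : 0 < c) :
    ∀ᶠ h : ℝ in 𝓝[>] 0, 16 / h * Real.exp (-(2 * a / h)) ≤ c * h ^ p := by
  have h1 := (tendsto_rpow_mul_exp_neg_mul_atTop_nhds_zero (1 + p) (2 * a) (by positivity)).comp
    tendsto_inv_nhdsGT_zero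
  filter_upwards [h1.eventually_le_const (u := c / 16) (by positivity), self_mem_nhdsWithin]
    with h hh (hpos : 0 < h)
  simp only [Function.comp_apply] at hh
  rw [Real.inv_rpow hpos.le, Real.rpow_add hpos, Real.rpow_one, mul_inv, neg_mul,
    ← div_eq_mul_inv] at hh
  have hp : 0 < h ^ p := Real.rpow_pos_of_pos hpos p
  have := mul_le_mul_of_nonneg_left hh (by positivity : 0 ≤ 16 * h ^ p)
  calc 16 / h * Real.exp (-(2 * a / h))
      = 16 * h ^ p * (h⁻¹ * (h ^ p)⁻¹ * Real.exp (-(2 * a / h))) := by field_simp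
    _ ≤ 16 * h ^ p * (c / 16) := by
        simpa only [div_eq_mul_inv] using this
    _ = c * h ^ p := by ring

/-! ### The lower bound -/

theorem pert_zero {m : ℕ} (h A x : ℝ) : pert h A (0 : Fin m → ℝ) x = 0 := by simp [pert]

theorem perturbed_zero {m : ℕ} (a h A : ℝ) : perturbed a h A (0 : Fin m → ℝ) = cauchy a := by
  funext x; simp [perturbed, pert_zero]

theorem half_le_mul_floor {h : ℝ} (hh : 0 < h) (hh2 : h ≤ 1 / 2) :
    1 / 2 ≤ h * ⌊1 / h⌋₊ ∧ h * ⌊1 / h⌋₊ ≤ 1 := by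
  have h1 := Nat.floor_le (by positivity : 0 ≤ 1 / h)
  have h2 := Nat.lt_floor_add_one (1 / h)
  rw [le_div_iff₀ hh] at h1
  rw [div_lt_iff₀ hh] at h2
  constructor <;> nlinarith

/-- The balance that fixes the bandwidth: (h^(2β+2σ+1))² = n⁻² h, and the remaining h offsets the
number m of positions. -/
theorem rpow_mul_sq_mul_le {β σ h : ℝ} (hh : 0 < h) {n m : ℕ}
    (hn : h ^ ((4 * β + 4 * σ + 1) / 2) = (n : ℝ)⁻¹) (hm : h * m ≤ 1) :
    (n : ℝ) ^ 2 * ((h ^ β) ^ 2 * h * (h ^ σ) ^ 2) ^ 2 * m ≤ 1 := by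
  have e : ((h ^ β) ^ 2 * h * (h ^ σ) ^ 2) ^ 2 = (h ^ ((4 * β + 4 * σ + 1) / 2)) ^ 2 * h := by
    have h1 : ∀ (s : ℝ) (k : ℕ), (h ^ s) ^ k = h ^ (s * k) := fun s k => by
      rw [← Real.rpow_natCast, ← Real.rpow_mul hh.le]
    rw [h1, h1, h1, ← Real.rpow_add_one hh.ne', ← Real.rpow_add hh, h1, ← Real.rpow_add_one hh.ne']
    congr 1
    push_cast
    ring
  rw [e, hn]
  rcases Nat.eq_zero_or_pos n with rfl | hpos
  · simp
  · have : (n : ℝ) ≠ 0 := by positivity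
    calc (n : ℝ) ^ 2 * ((n : ℝ)⁻¹ ^ 2 * h) * m = h * m := by field_simp
      _ ≤ 1 := hm

theorem rateLowerBound_sobolevClass {β L σ : ℝ} {g : ℝ → ℝ} (hβ : 0 < β) (hL : 0 < L)
    (hg : IsPolynomialNoise σ g) (hP : AssumptionP σ g) :
    RateLowerBound (sobolevClass β L) g (rate β σ) := by
  have hσ : 0 < σ := by linarith [hg.2.2.1]
  obtain ⟨a, ha, haI, haL⟩ := exists_integral_exp_mul_rpow_le hβ (by positivity : 0 < L / 4)
  obtain ⟨C₁, hC₁, hpert⟩ := exists_abs_pert_le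
  obtain ⟨C, h₀, hC, hh₀, -, hchi⟩ := exists_integral_convLaw_pert_sq_div_le hg hP ha
  set c₀ : ℝ := 2 * a / (a ^ 2 + 4 * Real.pi ^ 2)
  have hc₀ : 0 < c₀ := by positivity
  set B : ℝ := 32 * (8 * Real.pi) ^ (2 * β)
  have hB : 0 < B := by positivity
  -- The first constraint keeps the perturbation below half of the Cauchy density, the second keeps
  -- it within its share of the Sobolev budget.
  obtain ⟨κ, hκ, hκ1, hκ2⟩ : ∃ κ : ℝ, 0 < κ ∧ κ * C₁ ≤ c₀ / 2 ∧ B * κ ^ 2 ≤ L / 4 := by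
    refine ⟨min (c₀ / 2 / C₁) (Real.sqrt (L / 4 / B)), ?_, ?_, ?_⟩
    · exact lt_min (by positivity) (Real.sqrt_pos.2 (by positivity))
    · rw [← le_div_iff₀ hC₁]; exact min_le_left _ _
    · rw [mul_comm, ← le_div_iff₀ hB]
      refine (pow_le_pow_left₀ ?_ (min_le_right _ _) 2).trans
        (Real.sq_sqrt (by positivity : 0 ≤ L / 4 / B)).le
      exact le_min (by positivity) (Real.sqrt_nonneg _)
  -- The bound on exp(n² Λ² m / 2) for Λ = C A² h^(1+2σ) with A = κ h^β.
  set K : ℝ := Real.exp (C ^ 2 * κ ^ 4 / 2)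
  have hK1 : 1 ≤ K := Real.one_le_exp (by positivity)
  refine ⟨κ ^ 2 / 16 / (4 * K), by positivity, ?_⟩
  have hband := tendsto_bandwidth hβ hσ
  have hsmall : ∀ᶠ h : ℝ in 𝓝[>] 0, 0 < h ∧ h ≤ h₀ ∧ h ≤ 1 / 2 ∧
      16 / h * Real.exp (-(2 * a / h)) ≤ κ ^ 2 / 8 * h ^ (2 * β) := by
    filter_upwards [self_mem_nhdsWithin, eventually_nhdsWithin_of_eventually_nhds
      (eventually_le_nhds hh₀), eventually_nhdsWithin_of_eventually_nhds
      (eventually_le_nhds (by norm_num : (0 : ℝ) < 1 / 2)),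
      eventually_exp_neg_div_le (p := 2 * β) ha (by positivity : 0 < κ ^ 2 / 8)] with h e1 e2 e3 e4
    exact ⟨e1, e2, e3, e4⟩
  refine le_liminf_of_le (by isBoundedDefault) ?_
  filter_upwards [hband.eventually hsmall] with n hn
  have hhn := bandwidth_rpow_eq_inv hβ hσ n
  have hφ := rate_eq_bandwidth_rpow β σ n
  generalize bandwidth β σ n = h at hn hhn hφ
  obtain ⟨hh, hhh, hh2, hexp⟩ := hn
  rw [hφ]
  refine le_iInf₂ fun δ hδ => ?_
  obtain ⟨hm2, hm1⟩ := half_le_mul_floor hh hh2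
  generalize ⌊1 / h⌋₊ = m at hm1 hm2
  have hhβ1 : h ^ β ≤ 1 := Real.rpow_le_one hh.le (by linarith) hβ.le
  have hhβ : 0 < h ^ β := Real.rpow_pos_of_pos hh β
  have hpow2 : h ^ (2 * β) = (h ^ β) ^ 2 := by
    rw [← Real.rpow_natCast, ← Real.rpow_mul hh.le]; congr 1; push_cast; ring
  set A : ℝ := κ * h ^ β with hA
  have hA0 : 0 < A := by positivity
  have hle : ∀ v : Fin m → ℝ, (∀ j, |v j| ≤ 1) → ∀ x, |pert h A v x| ≤ cauchy a x / 2 := by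
    intro v hv x
    calc |pert h A v x| ≤ A * C₁ / (1 + x ^ 2) := hpert m h A v hh (by linarith) hm1 hA0.le hv x
      _ ≤ c₀ / 2 / (1 + x ^ 2) := by
          gcongr
          calc A * C₁ = κ * C₁ * h ^ β := by rw [hA]; ring
            _ ≤ κ * C₁ * 1 := by gcongr
            _ ≤ c₀ / 2 := by linarith
      _ = c₀ / (1 + x ^ 2) / 2 := by ring
      _ ≤ cauchy a x / 2 := by gcongr; exact le_cauchy ha x
  have hle' : ∀ v : Fin m → ℝ, (∀ j, |v j| ≤ 1) → ∀ x, |pert h A v x| ≤ cauchy a x :=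
    fun v hv x => by linarith [hle v hv x, cauchy_pos ha x]
  have hsgn : ∀ (θ : Fin m → Bool) (j : Fin m), |boolSign (θ j)| ≤ 1 := fun θ j =>
    (abs_boolSign _).le
  have hAh : A ^ 2 * h ^ (-(2 * β)) = κ ^ 2 := by
    rw [Real.rpow_neg hh.le, hpow2, hA]; field_simp
  have hmem : ∀ v : Fin m → ℝ, (∀ j, |v j| ≤ 1) → perturbed a h A v ∈ sobolevClass β L := by
    intro v hv
    refine perturbed_mem_sobolevClass hβ ha haI haL hh (hle' v hv) ?_
    rw [hAh]
    have hsum : ∑ j, v j ^ 2 ≤ m := by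
      calc ∑ j, v j ^ 2 ≤ ∑ _j : Fin m, (1 : ℝ) := Finset.sum_le_sum fun j _ => by
            rw [← sq_abs]; exact pow_le_one₀ (abs_nonneg _) (hv j)
        _ = m := by simp
    calc B * κ ^ 2 * (h * ∑ j, v j ^ 2) ≤ B * κ ^ 2 * 1 := by
          gcongr
          exact le_trans (by gcongr) hm1
      _ ≤ L / 4 := by rw [mul_one]; exact hκ2
  have hmem0 : cauchy a ∈ sobolevClass β L := by
    rw [← perturbed_zero (m := m) a h A]
    exact hmem 0 fun j => by simp
  set S := ⨆ f ∈ sobolevClass β L, (ENNReal.ofReal (h ^ (2 * β)))⁻¹ * risk f g n δ with hS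
  -- An infinite normalized risk satisfies the bound trivially; otherwise S becomes a real bound on
  -- every risk in the class.
  rcases eq_or_ne S ⊤ with hST | hST
  · rw [hST]; exact le_top
  have hφ0 : 0 < h ^ (2 * β) := Real.rpow_pos_of_pos hh _
  have hrisk : ∀ f ∈ sobolevClass β L, risk f g n δ ≤ ENNReal.ofReal (h ^ (2 * β) * S.toReal) := by
    intro f hf
    have h1 : (ENNReal.ofReal (h ^ (2 * β)))⁻¹ * risk f g n δ ≤ S :=
      le_iSup₂ (f := fun f (_ : f ∈ sobolevClass β L) =>
        (ENNReal.ofReal (h ^ (2 * β)))⁻¹ * risk f g n δ) f hf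
    rw [ENNReal.ofReal_mul hφ0.le, ENNReal.ofReal_toReal hST]
    rwa [ENNReal.inv_mul_le_iff (by simpa using hφ0) ENNReal.ofReal_ne_top] at h1
  have hsq : ∀ θ : Fin m → Bool, ∑ j, boolSign (θ j) ^ 2 = m := fun θ => by simp [boolSign_sq]
  -- Since hm ≥ 1/2, the gain A² h m / 2 is at least κ² h^(2β) / 4; the cross term takes away at
  -- most κ² h^(2β) / 8, and what is left is 2s.
  have key := le_risk_of_perturbed (n := n) (s := κ ^ 2 / 16 * h ^ (2 * β))
    (R := h ^ (2 * β) * S.toReal) (K := K)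
    (Λ := C * (A ^ 2 * h * (h ^ σ) ^ 2)) hg.1 ha hh hle (by positivity) (fun v => ?_) hK1 ?_
    (by positivity) (by positivity) (fun θ => ?_) hδ (hrisk _ hmem0)
    (fun θ => hrisk _ (hmem _ (hsgn θ)))
  · rw [← ENNReal.ofReal_toReal hST]
    refine ENNReal.ofReal_le_ofReal ?_
    have e : κ ^ 2 / 16 * h ^ (2 * β) / (4 * K) = h ^ (2 * β) * (κ ^ 2 / 16 / (4 * K)) := by ring
    rw [e] at key
    exact le_of_mul_le_mul_left key hφ0
  · exact (hchi m h A v hh hhh hm1).trans (le_of_eq (by ring))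
  · refine Real.exp_le_exp.2 ?_
    have h1 := rpow_mul_sq_mul_le hh hhn hm1
    have h2 : (n : ℝ) ^ 2 * (C * (A ^ 2 * h * (h ^ σ) ^ 2)) ^ 2 * m =
        C ^ 2 * κ ^ 4 * ((n : ℝ) ^ 2 * ((h ^ β) ^ 2 * h * (h ^ σ) ^ 2) ^ 2 * m) := by
      rw [hA]; ring
    rw [h2]
    have : C ^ 2 * κ ^ 4 * ((n : ℝ) ^ 2 * ((h ^ β) ^ 2 * h * (h ^ σ) ^ 2) ^ 2 * m) ≤
        C ^ 2 * κ ^ 4 * 1 := by gcongr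
    linarith
  · have h1 := integral_sq_perturbed_ge ha hh (hle' _ (hsgn θ))
    rw [hsq] at h1
    have h2 : κ ^ 2 * h ^ (2 * β) / 2 ≤ A ^ 2 * h * m := by
      have : A ^ 2 * h * m = κ ^ 2 * h ^ (2 * β) * (h * m) := by rw [hA, hpow2]; ring
      rw [this]
      have := mul_le_mul_of_nonneg_left hm2 (by positivity : 0 ≤ κ ^ 2 * h ^ (2 * β))
      linarith
    linarith

end Deconv

/-- The upper bound is stated over the whole Sobolev ball and the lower bound over its subset of
densities of class `C^β`, so that both hold over either of the two classes. -/
theorem theorem2 (β L σ : ℝ) (g : ℝ → ℝ) (hβ : 0 < β) (hβσ : β ≤ σ + 1 / 4) (hL : 0 < L)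
    (hg : Deconv.IsPolynomialNoise σ g) :
    Deconv.AttainsRate (Deconv.sobolevBall β L) g
        (fun n => Deconv.estimator g (Deconv.bandwidth β σ n) n) (Deconv.rate β σ) ∧
      (Deconv.AssumptionP σ g →
        Deconv.RateLowerBound (Deconv.sobolevClass β L) g (Deconv.rate β σ)) := by
  exact ⟨Deconv.attainsRate_estimator hβ hβσ hL hg,
    fun hP => Deconv.rateLowerBound_sobolevClass hβ hL hg hP⟩
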